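/- All Hilbert spaces are complex and finite-dimensional, inner products are conjugate-linear in the first variable, and $[X]$ denotes the linear span of $X$. A nondegenerate $C^*$-subalgebra of $\mathcal L(H)$ is then the same as a unital $*$-subalgebra. $*$-homomorphisms need not be unital unless this is said. **Data.** 1. $H$ is a finite-dimensional Hilbert space and $A\subseteq\mathcal L(H)$ is a nondegenerate $C^*$-subalgebra. 2. $N$ is a finite-dimensional $C^*$-algebra with a faithful state $\mu$ and GNS-representation $(H_\mu,\pi_\mu,\zeta_\mu)$; $J_\mu$ is the antiunitary part in the polar decomposition of $\pi_\mu(b)\zeta_\mu\mapsto\pi_\mu(b)^*\zeta_\mu$, and $\pi_\mu^{op}(b^{op})=J_\mu\pi_\mu(b)^*J_\mu$. Further, $\rho\colon N^{op}\to A$ and $\sigma\colon N\to A$ are injective unital $*$-homomorphisms with commuting images. 3. $\mathfrak B,\mathfrak B^\dagger\subseteq\mathcal L(\mathfrak H)$ are commuting nondegenerate $C^*$-algebras on a finite-dimensional Hilbert space $\mathfrak H$, and $\zeta\in\mathfrak H$ is cyclic for $\mathfrak B$ and for $\mathfrak B^\dagger$. A $C^*$-factorization of a Hilbert space $K$ with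 respect to $(\mathfrak H,\mathfrak B,\mathfrak B^\dagger)$ is a subspace $\gamma\subseteq\mathcal L(\mathfrak H,K)$ with $[\gamma^*\gamma]=\mathfrak B$, $[\gamma\mathfrak B]=\gamma$, $[\gamma\mathfrak H]=K$; it defines a representation $\rho_\gamma\colon\mathfrak B^\dagger\to\mathcal L(K)$ by $\rho_\gamma(b^\dagger)\xi v=\xi b^\dagger v$ for $\xi\in\gamma$, $v\in\mathfrak H$. We are given $C^*$-factorizations $\alpha$ of $H$ with respect to $(\mathfrak H,\mathfrak B,\mathfrak B^\dagger)$ and $\beta$ of $H$ with respect to $(\mathfrak H,\mathfrak B^\dagger,\mathfrak B)$ such that $\rho_\alpha(\mathfrak B^\dagger)\subseteq A$ and $\rho_\beta(\mathfrak B)\subseteq A$, and that are compatible: $[\rho_\alpha(\mathfrak B^\dagger)\beta]=\beta$ and $[\rho_\beta(\mathfrak B)\alpha]=\alpha$. 4. $U\colon\mathfrak H\to H_\mu$ is a unitary with $U\zeta=\zeta_\mu$, $U\mathfrak BU^*=\pi_\mu(N)$, $U\mathfrak B^\dagger U^*=\pi_\mu^{op}(N^{op})$, $\rho(x)=\rho_\alpha(U^*\pi_\mu^{op}(x)U)$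 for all $x\in N^{op}$, and $\sigma(y)=\rho_\beta(U^*\pi_\mu(y)U)$ for all $y\in N$. **Relative tensor products.** For unital representations $\rho'$ of $N^{op}$ on $H'$ and $\sigma'$ of $N$ on $K'$, let $R(\xi)\colon H_\mu\to H'$, $\pi_\mu^{op}(b^{op})\zeta_\mu\mapsto\rho'(b^{op})\xi$, and $R(\eta)\colon H_\mu\to K'$, $\pi_\mu(b)\zeta_\mu\mapsto\sigma'(b)\eta$. The space $H'\otimes_\mu K'$ is obtained from the algebraic tensor product $H'\otimes K'$ with the form $\langle\xi\otimes\eta,\xi'\otimes\eta'\rangle=\langle R(\xi')^*R(\xi)\zeta_\mu,\,R(\eta)^*R(\eta')\zeta_\mu\rangle$ by factoring out null vectors. If $\alpha'$, $\beta'$ are $C^*$-factorizations of $H'$, $K'$ with respect to $(\mathfrak H,\mathfrak B,\mathfrak B^\dagger)$ and $(\mathfrak H,\mathfrak B^\dagger,\mathfrak B)$, then $H'\otimes_{\mathfrak H}K'$ is obtained in the same way from $\alpha'\otimes\mathfrak H\otimes\beta'$ with the form $\langle\xi\otimes v\otimes\eta,\xi'\otimes v'\otimes\eta'\rangle=\langle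 v,\xi^*\xi'\eta^*\eta'v'\rangle$; there are operators $|\xi\rangle_1\colon K'\to H'\otimes_{\mathfrak H}K'$, $\eta v\mapsto\xi\otimes v\otimes\eta$, and $|\eta\rangle_2\colon H'\to H'\otimes_{\mathfrak H}K'$, $\xi v\mapsto\xi\otimes v\otimes\eta$. There is a unitary $$\Phi\colon H\otimes_\mu H\to H\otimes_{\mathfrak H}H,\qquad \xi\otimes\eta\mapsto R(\xi)U\otimes\zeta\otimes R(\eta)U,$$ formed with $\rho'=\rho$, $\sigma'=\sigma$, $\alpha'=\alpha$, $\beta'=\beta$. **Fibre products.** For nondegenerate $C^*$-algebras $A_1\subseteq\mathcal L(H')$ and $A_2\subseteq\mathcal L(K')$ with $\rho'(N^{op})\subseteq A_1$ and $\sigma'(N)\subseteq A_2$, put $A_1*_\mu A_2=\{S\otimes T: S\in A_1',\,T\in A_2'\}'\subseteq\mathcal L(H'\otimes_\mu K')$. For $A_1\supseteq\rho_{\alpha'}(\mathfrak B^\dagger)$ and $A_2\supseteq\rho_{\beta'}(\mathfrak B)$, let $A_1*_{\mathfrak H}A_2$ be the set of all $T\in\mathcal L(H'\otimes_{\mathfrak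 H}K')$ such that $T|\alpha'\rangle_1,\,T^*|\alpha'\rangle_1\subseteq[|\alpha'\rangle_1A_2]$ and $T|\beta'\rangle_2,\,T^*|\beta'\rangle_2\subseteq[|\beta'\rangle_2A_1]$. For $*$-homomorphisms $\phi\colon A_1\to C_1\subseteq\mathcal L(H'')$ and $\psi\colon A_2\to C_2\subseteq\mathcal L(K'')$, put $\mathcal L^\phi=\{X\in\mathcal L(H',H''): Xa=\phi(a)X\text{ for all }a\in A_1\}$, and define $\mathcal L^\psi$ likewise. If $\phi$ and $\psi$ are compatible with the representations of $N^{op}$ and $N$ (respectively, are morphisms as defined below), then $\phi*\psi\colon A_1*A_2\to C_1*C_2$ is the unique $*$-homomorphism with $(\phi*\psi)(S)(X\otimes Y)=(X\otimes Y)S$ for all $S\in A_1*A_2$, $X\in\mathcal L^\phi$, $Y\in\mathcal L^\psi$. **Bimodules.** $(N,\mu,A,\rho,\sigma,\Delta)$ is a *finite-dimensional Hopf–von Neumann bimodule* if $\Delta\colon A\to A*_\mu A$ is a $*$-homomorphism with $\Delta(\rho(x))=1\otimes\rho(x)$ for $x\in N^{op}$, $\Delta(\sigma(y))=\sigma(y)\otimes1$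 for $y\in N$, and $(\Delta*\mathrm{id})\circ\Delta=(\mathrm{id}*\Delta)\circ\Delta$ as maps into $A*_\mu A*_\mu A$; here the iterated relative tensor products, formed with the representations $1\otimes\rho$ and $\sigma\otimes1$ on $H\otimes_\mu H$, are identified by $(\xi\otimes\eta)\otimes\theta\mapsto\xi\otimes(\eta\otimes\theta)$. Put $\alpha\triangleright\alpha=[|\alpha\rangle_1\alpha]$ and $\beta\triangleleft\beta=[|\beta\rangle_2\beta]$; these are $C^*$-factorizations of $H\otimes_{\mathfrak H}H$ with respect to $(\mathfrak H,\mathfrak B,\mathfrak B^\dagger)$ and $(\mathfrak H,\mathfrak B^\dagger,\mathfrak B)$, respectively. For a $*$-homomorphism $\pi\colon A_1\to C_1$ of nondegenerate $C^*$-algebras on $H'$ and $H''$, and $C^*$-factorizations $\gamma$ of $H'$ and $\delta$ of $H''$ with respect to the same triple, $\pi$ is a *morphism* from $(A_1)_\gamma$ to $(C_1)_\delta$ if $\delta=[I_\pi\gamma]$, where $I_\pi=\{V\in\mathcal L^\pi: V\gamma\subseteq\delta,\ V^*\delta\subseteq\gamma\}$. Then $((\mathfrak H,\mathfrak B,\mathfrak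 B^\dagger),H,A,\alpha,\beta,\Delta)$ is a *finite-dimensional concrete Hopf $C^*$-bimodule* if $\Delta\colon A\to A*_{\mathfrak H}A$ is a $*$-homomorphism that is a morphism from $A_\alpha$ to $(A*_{\mathfrak H}A)_{\alpha\triangleright\alpha}$ and from $A_\beta$ to $(A*_{\mathfrak H}A)_{\beta\triangleleft\beta}$, and if $(\Delta*\mathrm{id})\circ\Delta=(\mathrm{id}*\Delta)\circ\Delta$ as maps into $A*_{\mathfrak H}A*_{\mathfrak H}A$; here the iterated $C^*$-relative tensor products, formed with $\alpha\triangleright\alpha$ and $\beta\triangleleft\beta$ on $H\otimes_{\mathfrak H}H$, are identified by $|\theta\rangle_2|\xi\rangle_1 x\mapsto|\xi\rangle_1|\theta\rangle_2x$ for $\xi\in\alpha$, $\theta\in\beta$, $x\in H$. **Theorem.** Let $\Delta_\mu\colon A\to A*_\mu A$ and $\Delta_{\mathfrak H}\colon A\to A*_{\mathfrak H}A$ be $*$-homomorphisms such that $\Delta_{\mathfrak H}(a)=\Phi\,\Delta_\mu(a)\,\Phi^*$ for all $a\in A$. Then $(N,\mu,A,\rho,\sigma,\Delta_\mu)$ is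 a finite-dimensional Hopf–von Neumann bimodule if and only if $((\mathfrak H,\mathfrak B,\mathfrak B^\dagger),H,A,\alpha,\beta,\Delta_{\mathfrak H})$ is a finite-dimensional concrete Hopf $C^*$-bimodule. -/

import Mathlib

open scoped InnerProductSpace TensorProduct ComplexOrder ComplexConjugate

namespace HopfBimodule

section Shortcuts

/-! Shortcuts for instance search -/

variable {E F : Type*} [NormedAddCommGroup E] [InnerProductSpace ℂ E]
  [NormedAddCommGroup F] [InnerProductSpace ℂ F]

instance : AddCommMonoid (E →L[ℂ] F) := ContinuousLinearMap.addCommMonoid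
instance : Module ℂ (E →L[ℂ] F) := ContinuousLinearMap.module
instance : Semiring (E →L[ℂ] E) := ContinuousLinearMap.semiring
instance : Algebra ℂ (E →L[ℂ] E) := ContinuousLinearMap.algebra

end Shortcuts

section General

set_option linter.unusedSectionVars false

variable {E F H K : Type*}
  [NormedAddCommGroup E] [InnerProductSpace ℂ E] [CompleteSpace E] [FiniteDimensional ℂ E]
  [NormedAddCommGroup F] [InnerProductSpace ℂ F] [CompleteSpace F] [FiniteDimensional ℂ F]
  [NormedAddCommGroup H] [InnerProductSpace ℂ H] [CompleteSpace H] [FiniteDimensional ℂ H]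
  [NormedAddCommGroup K] [InnerProductSpace ℂ K] [CompleteSpace K] [FiniteDimensional ℂ K]

theorem commute_sqrt {T D : E →L[ℂ] E} (h : Commute T D) : Commute (CFC.sqrt T) D := by
  rw [CFC.sqrt]
  exact h.cfcₙ_nnreal _

theorem gram_nonneg_aux {n : ℕ} (pr : Fin n → (F →L[ℂ] E))
    (res : ∀ w : F, w = ∑ k, (pr k).adjoint (pr k w))
    (pr_inn : ∀ i j x, pr i ((pr j).adjoint x) = if i = j then x else 0)
    (v : Fin n → E) (a : Fin n → (E →L[ℂ] H)) (b : Fin n → (E →L[ℂ] K))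
    (hc : ∀ i j k l, Commute ((a i).adjoint ∘L a j) ((b k).adjoint ∘L b l)) :
    0 ≤ ∑ i, ∑ j, ⟪v i, (a i).adjoint (a j ((b i).adjoint (b j (v j))))⟫_ℂ := by
  obtain ⟨inn, hinn⟩ : ∃ inn : Fin n → (E →L[ℂ] F), ∀ i, (pr i).adjoint = inn i :=
    ⟨_, fun _ => rfl⟩
  simp only [hinn] at res pr_inn
  obtain ⟨X, hXdef⟩ : ∃ X : F →L[ℂ] H, X = ∑ i, a i ∘L pr i := ⟨_, rfl⟩
  have hX : ∀ i x, X (inn i x) = a i x := by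
    intro i x
    simp only [hXdef, sum_apply, ContinuousLinearMap.comp_apply, pr_inn]
    rw [Finset.sum_eq_single i]
    · simp
    · intro b _ hb; simp [hb]
    · simp
  have hXa : ∀ h i, pr i (X.adjoint h) = (a i).adjoint h := by
    intro h i
    refine ext_inner_right ℂ fun y => ?_
    rw [← ContinuousLinearMap.adjoint_inner_right (pr i), ContinuousLinearMap.adjoint_inner_left,
      ContinuousLinearMap.adjoint_inner_left, hinn, hX]
  obtain ⟨T, hTdef⟩ : ∃ T : F →L[ℂ] F, T = X.adjoint ∘L X := ⟨_, rfl⟩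
  have hT : 0 ≤ T := by
    rw [ContinuousLinearMap.nonneg_iff_isPositive, hTdef]
    exact ContinuousLinearMap.isPositive_adjoint_comp_self X
  obtain ⟨Q, hQc, hQ, hQs⟩ : ∃ Q : F →L[ℂ] F, (∀ D, Commute T D → Commute Q D) ∧
      Q ∘L Q = T ∧ Q.adjoint = Q :=
    ⟨CFC.sqrt T, fun D h => commute_sqrt h, CFC.sqrt_mul_sqrt_self T hT,
      IsSelfAdjoint.of_nonneg (CFC.sqrt_nonneg T)⟩
  -- block-diagonal operators commute with `T`, hence with its square root
  have hcomm : ∀ (k l : Fin n) (i j : Fin n) (x : E),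
      pr i (Q (inn j ((b k).adjoint (b l x)))) = (b k).adjoint (b l (pr i (Q (inn j x)))) := by
    intro k l i j x
    obtain ⟨c, hcdef⟩ : ∃ c : E →L[ℂ] E, c = (b k).adjoint ∘L b l := ⟨_, rfl⟩
    have hc' : ∀ i j y, (a i).adjoint (a j (c y)) = c ((a i).adjoint (a j y)) := by
      intro i j y
      rw [hcdef]
      exact DFunLike.congr_fun (hc i j k l) y
    obtain ⟨D, hD⟩ : ∃ D : F →L[ℂ] F, D = ∑ m, inn m ∘L c ∘L pr m := ⟨_, rfl⟩
    have prD : ∀ m w, pr m (D w) = c (pr m w) := by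
      intro m w
      simp only [hD, sum_apply, ContinuousLinearMap.comp_apply, map_sum, pr_inn]
      rw [Finset.sum_eq_single m]
      · simp
      · intro b _ hb; simp [Ne.symm hb]
      · simp
    have Dinn : ∀ m y, D (inn m y) = inn m (c y) := by
      intro m y
      simp only [hD, sum_apply, ContinuousLinearMap.comp_apply, pr_inn]
      rw [Finset.sum_eq_single m]
      · simp
      · intro b _ hb; simp [hb]
      · simp
    have hTm : ∀ m y, T (inn m (c y)) = D (T (inn m y)) := by
      intro m y
      rw [res (T (inn m (c y))), res (D _)]
      refine Finset.sum_congr rfl fun p _ => ?_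
      rw [prD, hTdef, ContinuousLinearMap.comp_apply, ContinuousLinearMap.comp_apply, hX, hX, hXa,
        hXa, hc']
    have hDT : Commute T D := by
      change T ∘L D = D ∘L T
      ext w : 1
      rw [ContinuousLinearMap.comp_apply, ContinuousLinearMap.comp_apply, res w]
      simp only [map_sum]
      refine Finset.sum_congr rfl fun m _ => ?_
      rw [Dinn, hTm]
    have h3 : Q (D (inn j x)) = D (Q (inn j x)) := DFunLike.congr_fun (hQc D hDT) (inn j x)
    have h4 : ∀ y, (b k).adjoint (b l y) = c y := fun y => by rw [hcdef]; rfl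
    rw [h4, h4, ← prD, ← h3, Dinn]
  have key : ∀ i j, ⟪v i, (a i).adjoint (a j ((b i).adjoint (b j (v j))))⟫_ℂ
      = ∑ k, ⟪b i (pr k (Q (inn i (v i)))), b j (pr k (Q (inn j (v j))))⟫_ℂ := by
    intro i j
    have hTQ : ∀ w, X.adjoint (X w) = Q (Q w) := fun w => by
      rw [← ContinuousLinearMap.comp_apply, ← hTdef, ← hQ]; rfl
    rw [← hX j, ← hXa, hTQ, ← ContinuousLinearMap.adjoint_inner_left (pr i), hinn,
      ← ContinuousLinearMap.adjoint_inner_left Q, hQs, res (Q (inn j _)), inner_sum]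
    refine Finset.sum_congr rfl fun k _ => ?_
    rw [← hinn k, ContinuousLinearMap.adjoint_inner_right,
      ← ContinuousLinearMap.adjoint_inner_right (b i), ← hcomm]
  have : ∑ i, ∑ j, ⟪v i, (a i).adjoint (a j ((b i).adjoint (b j (v j))))⟫_ℂ
      = ∑ k, ⟪∑ i, b i (pr k (Q (inn i (v i)))), ∑ i, b i (pr k (Q (inn i (v i))))⟫_ℂ := by
    simp only [key, sum_inner, inner_sum]
    rw [Finset.sum_congr rfl fun j _ => Finset.sum_comm]
    rw [Finset.sum_comm]
    exact Finset.sum_congr rfl fun y _ => Finset.sum_comm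
  rw [this]
  refine Finset.sum_nonneg fun k _ => ?_
  rw [inner_self_eq_norm_sq_to_K]
  norm_cast
  exact Complex.zero_le_real.2 (sq_nonneg _)

/-- The positivity that underlies all relative tensor products: if the operators `aᵢ* aⱼ` commute
with the operators `bₖ* bₗ`, then `∑ᵢⱼ ⟨vᵢ, aᵢ* aⱼ bᵢ* bⱼ vⱼ⟩ ≥ 0`. -/
theorem gram_nonneg {n : ℕ} (v : Fin n → E) (a : Fin n → (E →L[ℂ] H)) (b : Fin n → (E →L[ℂ] K))
    (hc : ∀ i j k l, Commute ((a i).adjoint ∘L a j) ((b k).adjoint ∘L b l)) :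
    0 ≤ ∑ i, ∑ j, ⟪v i, (a i).adjoint (a j ((b i).adjoint (b j (v j))))⟫_ℂ := by
  classical
  refine gram_nonneg_aux (F := PiLp 2 (fun _ : Fin n => E))
    (fun i => PiLp.proj 2 (fun _ : Fin n => E) i) ?_ ?_ v a b hc
  · intro w
    refine ext_inner_right ℂ fun y => ?_
    rw [sum_inner, PiLp.inner_apply]
    refine Finset.sum_congr rfl fun k _ => ?_
    rw [ContinuousLinearMap.adjoint_inner_left]
    rfl
  · intro i j x
    have h1 : (PiLp.proj 2 (fun _ : Fin n => E) j : _ →L[ℂ] E).adjoint x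
        = WithLp.toLp 2 (Pi.single j x) := by
      refine ext_inner_right ℂ fun y => ?_
      rw [ContinuousLinearMap.adjoint_inner_left, PiLp.inner_apply, Finset.sum_eq_single j]
      · simp
      · intro b _ hb; simp [Pi.single_eq_of_ne hb]
      · simp
    rw [h1]
    change (Pi.single j x : Fin n → E) i = _
    by_cases hij : i = j
    · subst hij; simp
    · simp [hij]

/-- An operator is determined by its values on a total family, and exists as soon as the prescribed
values admit a formal adjoint. -/
theorem exists_operator {ι κ : Type*} (x : ι → E) (hx : Submodule.span ℂ (Set.range x) = ⊤)
    (y : ι → F) (x' : κ → F) (hx' : Submodule.span ℂ (Set.range x') = ⊤) (z : κ → E)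
    (h : ∀ i j, ⟪x' j, y i⟫_ℂ = ⟪z j, x i⟫_ℂ) :
    ∃ T : E →L[ℂ] F, ∀ i, T (x i) = y i := by
  have hs : Function.Surjective (Finsupp.linearCombination ℂ x) := by
    rw [← LinearMap.range_eq_top, Finsupp.range_linearCombination, hx]
  obtain ⟨g, hg⟩ := (Finsupp.linearCombination ℂ x).exists_rightInverse_of_surjective
    (LinearMap.range_eq_top.2 hs)
  have key : ∀ c j, ⟪x' j, Finsupp.linearCombination ℂ y c⟫_ℂ
      = ⟪z j, Finsupp.linearCombination ℂ x c⟫_ℂ := by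
    intro c j
    simp only [Finsupp.linearCombination_apply, Finsupp.sum, inner_sum, inner_smul_right, h]
  have hker : ∀ c, Finsupp.linearCombination ℂ x c = 0 → Finsupp.linearCombination ℂ y c = 0 := by
    intro c hc
    have : ∀ w ∈ Submodule.span ℂ (Set.range x'),
        ⟪w, Finsupp.linearCombination ℂ y c⟫_ℂ = 0 := by
      intro w hw
      induction hw using Submodule.span_induction with
      | mem w hw => obtain ⟨j, rfl⟩ := hw; rw [key, hc, inner_zero_right]
      | zero => simp
      | add u w _ _ hu hw => rw [inner_add_left, hu, hw, add_zero]
      | smul t u _ hu => rw [inner_smul_left, hu, mul_zero]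
    exact inner_self_eq_zero.1 (this _ (by rw [hx']; trivial))
  refine ⟨LinearMap.toContinuousLinearMap (Finsupp.linearCombination ℂ y ∘ₗ g), fun i => ?_⟩
  have h1 : Finsupp.linearCombination ℂ x (g (x i) - Finsupp.single i 1) = 0 := by
    rw [map_sub, ← LinearMap.comp_apply, hg]
    simp
  have h2 := hker _ h1
  rw [map_sub, sub_eq_zero] at h2
  simpa using h2

theorem operator_ext {ι : Type*} {x : ι → E} (hx : Submodule.span ℂ (Set.range x) = ⊤)
    {S T : E →L[ℂ] F} (h : ∀ i, S (x i) = T (x i)) : S = T := by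
  ext w
  have hw : w ∈ Submodule.span ℂ (Set.range x) := by rw [hx]; trivial
  induction hw using Submodule.span_induction with
  | mem w hw => obtain ⟨j, rfl⟩ := hw; exact h j
  | zero => simp
  | add u w _ _ hu hw => rw [map_add, map_add, hu, hw]
  | smul t u _ hu => rw [map_smul, map_smul, hu]

/-- Total families with equal Gram matrices are related by a unitary. -/
theorem exists_unitary {ι : Type*} (x : ι → E) (hx : Submodule.span ℂ (Set.range x) = ⊤)
    (y : ι → F) (hy : Submodule.span ℂ (Set.range y) = ⊤)
    (h : ∀ i j, ⟪x i, x j⟫_ℂ = ⟪y i, y j⟫_ℂ) :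
    ∃ T : E ≃ₗᵢ[ℂ] F, ∀ i, T (x i) = y i := by
  obtain ⟨T, hT⟩ := exists_operator x hx y y hy x fun i j => (h j i).symm
  obtain ⟨S, hS⟩ := exists_operator y hy x x hx y fun i j => (h j i)
  have hST : S ∘L T = ContinuousLinearMap.id ℂ E := operator_ext hx fun i => by simp [hT, hS]
  have hTS : T ∘L S = ContinuousLinearMap.id ℂ F := operator_ext hy fun i => by simp [hT, hS]
  have hadj : T.adjoint = S := by
    refine operator_ext hy fun j => ?_
    have : ∀ w, ⟪T.adjoint (y j), w⟫_ℂ = ⟪S (y j), w⟫_ℂ := by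
      intro w
      have hw : w ∈ Submodule.span ℂ (Set.range x) := by rw [hx]; trivial
      induction hw using Submodule.span_induction with
      | mem w hw =>
        obtain ⟨i, rfl⟩ := hw
        rw [ContinuousLinearMap.adjoint_inner_left, hT, hS, h]
      | zero => simp
      | add u w _ _ hu hw => rw [inner_add_right, inner_add_right, hu, hw]
      | smul t u _ hu => rw [inner_smul_right, inner_smul_right, hu]
    exact ext_inner_right ℂ this
  refine ⟨{ toFun := T, invFun := S, map_add' := map_add T, map_smul' := map_smul T,
            left_inv := DFunLike.congr_fun hST, right_inv := DFunLike.congr_fun hTS,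
            norm_map' := ?_ }, hT⟩
  · intro w
    change ‖T w‖ = ‖w‖
    have : ‖T w‖ ^ 2 = ‖w‖ ^ 2 := by
      have h1 : ⟪T w, T w⟫_ℂ = ⟪w, w⟫_ℂ := by
        rw [← ContinuousLinearMap.adjoint_inner_left, hadj]
        congr 1
        exact DFunLike.congr_fun hST w
      rw [inner_self_eq_norm_sq_to_K, inner_self_eq_norm_sq_to_K] at h1
      exact_mod_cast h1
    exact (sq_eq_sq₀ (norm_nonneg _) (norm_nonneg _)).1 this

end General

end HopfBimodule

namespace HopfBimodule

/-! ### Factoring out the null space of a positive semi-definite form -/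

section Quotient

variable {V : Type*} [AddCommGroup V] [Module ℂ V]

/-- A positive semi-definite sesquilinear form as a pre-inner product. -/
@[reducible]
def coreOfForm (B : V →ₗ⋆[ℂ] V →ₗ[ℂ] ℂ) (hs : ∀ x y, conj (B y x) = B x y)
    (hp : ∀ x, 0 ≤ B x x) : PreInnerProductSpace.Core ℂ V where
  inner x y := B x y
  conj_inner_symm x y := hs x y
  re_inner_nonneg x := (Complex.le_def.1 (hp x)).1
  add_left x y z := by simp
  smul_left x y r := by simp

/-- The space `V`, seen as a semi-normed space through a pre-inner product. -/
def PreHilbert (_c : PreInnerProductSpace.Core ℂ V) : Type _ := V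

namespace PreHilbert

variable (c : PreInnerProductSpace.Core ℂ V)

noncomputable instance : SeminormedAddCommGroup (PreHilbert c) :=
  @InnerProductSpace.Core.toSeminormedAddCommGroup ℂ V _ _ _ c

noncomputable instance : InnerProductSpace ℂ (PreHilbert c) :=
  @InnerProductSpace.ofCore ℂ V _ _ _ c

end PreHilbert

/-- The quotient of `V` by the null space of a pre-inner product. It is used for finite-dimensional
`V` only, where it is a Hilbert space. -/
def HilbertQuotient (c : PreInnerProductSpace.Core ℂ V) : Type _ :=
  SeparationQuotient (PreHilbert c)

namespace HilbertQuotient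

variable (c : PreInnerProductSpace.Core ℂ V)

noncomputable instance : NormedAddCommGroup (HilbertQuotient c) :=
  inferInstanceAs (NormedAddCommGroup (SeparationQuotient (PreHilbert c)))

noncomputable instance : InnerProductSpace ℂ (HilbertQuotient c) :=
  inferInstanceAs (InnerProductSpace ℂ (SeparationQuotient (PreHilbert c)))

/-- The quotient map. -/
noncomputable def mk : V →ₗ[ℂ] HilbertQuotient c :=
  ((SeparationQuotient.mkCLM ℂ (PreHilbert c) : PreHilbert c →L[ℂ] _) :
    PreHilbert c →ₗ[ℂ] SeparationQuotient (PreHilbert c))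

theorem mk_surjective : Function.Surjective (mk c) := fun x =>
  SeparationQuotient.surjective_mk (X := PreHilbert c) x

theorem inner_mk_mk (x y : V) : ⟪mk c x, mk c y⟫_ℂ = c.inner x y := rfl

instance [FiniteDimensional ℂ V] : FiniteDimensional ℂ (HilbertQuotient c) :=
  Module.Finite.of_surjective (mk c) (mk_surjective c)

instance [FiniteDimensional ℂ V] : CompleteSpace (HilbertQuotient c) :=
  FiniteDimensional.complete ℂ _

end HilbertQuotient

end Quotient

/-! ### Faithful states, GNS-representations and the modular conjugation -/

/-- A faithful state on a (finite-dimensional) C⋆-algebra. -/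
structure FaithfulState (N : Type*) [CStarAlgebra N] extends N →ₗ[ℂ] ℂ where
  nonneg' : ∀ a : N, 0 ≤ toFun (star a * a)
  map_one' : toFun 1 = 1
  faithful' : ∀ a : N, toFun (star a * a) = 0 → a = 0

/-- A GNS-representation `(L, π_μ, ζ_μ)` of a faithful state `μ` on a finite-dimensional
C⋆-algebra, on a finite-dimensional Hilbert space `L = H_μ`. -/
structure GNS {N : Type*} [CStarAlgebra N] (μ : FaithfulState N) (L : Type*)
    [NormedAddCommGroup L] [InnerProductSpace ℂ L] [CompleteSpace L] where
  /-- the representation `π_μ` -/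
  π : N →⋆ₐ[ℂ] (L →L[ℂ] L)
  /-- the cyclic vector `ζ_μ` -/
  ζ : L
  cyclic : ∀ x : L, ∃ b : N, π b ζ = x
  inner_eq : ∀ b : N, ⟪ζ, π b ζ⟫_ℂ = μ.toLinearMap b

namespace GNS

set_option linter.unusedSectionVars false

variable {N : Type*} [CStarAlgebra N] [FiniteDimensional ℂ N] {μ : FaithfulState N}
  {L : Type*} [NormedAddCommGroup L] [InnerProductSpace ℂ L] [CompleteSpace L]
  [FiniteDimensional ℂ L] (G : GNS μ L)

theorem inner_π (a b : N) : ⟪G.π a G.ζ, G.π b G.ζ⟫_ℂ = μ.toLinearMap (star a * b) := by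
  rw [← G.inner_eq, map_mul, map_star, ContinuousLinearMap.star_eq_adjoint]
  exact (ContinuousLinearMap.adjoint_inner_right (G.π a) _ _).symm

theorem state_star (G : GNS μ L) (a : N) :
    μ.toLinearMap (star a) = conj (μ.toLinearMap a) := by
  have h := G.inner_π a 1
  rw [mul_one, ← inner_conj_symm, G.inner_π, star_one, one_mul] at h
  exact h.symm

/-- The map `b ↦ π_μ(b) ζ_μ` identifies `N` with `H_μ`. -/
noncomputable def equiv : N ≃ₗ[ℂ] L :=
  LinearEquiv.ofBijective
    { toFun := fun b => G.π b G.ζ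
      map_add' := fun a b => by simp
      map_smul' := fun r a => by simp }
    ⟨by
      rw [← LinearMap.ker_eq_bot, LinearMap.ker_eq_bot']
      intro a ha
      refine μ.faithful' a ?_
      change μ.toLinearMap _ = 0
      rw [← G.inner_π]
      have h : G.π a G.ζ = 0 := ha
      rw [h, inner_zero_left], G.cyclic⟩

theorem equiv_apply (b : N) : G.equiv b = G.π b G.ζ := rfl

theorem inner_equiv (a b : N) : ⟪G.equiv a, G.equiv b⟫_ℂ = μ.toLinearMap (star a * b) :=
  G.inner_π a b

theorem π_equiv (a b : N) : G.π a (G.equiv b) = G.equiv (a * b) := by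
  rw [equiv_apply, equiv_apply, map_mul]; rfl

theorem equiv_one : G.equiv 1 = G.ζ := by rw [equiv_apply, map_one]; rfl

/-- `J` is the antiunitary part in the polar decomposition `S = J P` of the antilinear map
`S : π_μ(b) ζ_μ ↦ π_μ(b)* ζ_μ`, where `P` is positive; since `S` is invertible, this determines
`P` and `J`. -/
def IsModularConjugation (J : L ≃ₗᵢ⋆[ℂ] L) : Prop :=
  ∃ P : L →L[ℂ] L, P.IsPositive ∧ ∀ b : N, star (G.π b) G.ζ = J (P (G.π b G.ζ))

theorem exists_isModularConjugation : ∃ J : L ≃ₗᵢ⋆[ℂ] L, G.IsModularConjugation J := by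
  let S : L ≃ₗ⋆[ℂ] L := (G.equiv.symm.trans (starLinearEquiv ℂ : N ≃ₗ⋆[ℂ] N)).trans G.equiv
  have hS : ∀ b, S (G.equiv b) = G.equiv (star b) := fun b => by simp [S]
  let e := stdOrthonormalBasis ℂ L
  -- the operator `S* S`
  let D : L →L[ℂ] L := LinearMap.toContinuousLinearMap
    { toFun := fun y => ∑ i, ⟪S y, S (e i)⟫_ℂ • e i
      map_add' := fun y z => by simp only [map_add, inner_add_left, add_smul, Finset.sum_add_distrib]
      map_smul' := fun r y => by
        simp only [LinearEquiv.map_smulₛₗ, inner_smul_left, Finset.smul_sum, mul_smul,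
          RingHom.id_apply, Complex.conj_conj] }
  have hD : ∀ x y, ⟪x, D y⟫_ℂ = ⟪S y, S x⟫_ℂ := by
    intro x y
    have h1 : D y = ∑ i, ⟪S y, S (e i)⟫_ℂ • e i := rfl
    conv_rhs => rw [← e.sum_repr x]
    rw [h1]
    simp only [inner_sum, map_sum, LinearEquiv.map_smulₛₗ, inner_smul_right]
    refine Finset.sum_congr rfl fun i _ => ?_
    rw [e.repr_apply_apply, inner_conj_symm, mul_comm]
  have hDpos : 0 ≤ D := by
    rw [ContinuousLinearMap.nonneg_iff_isPositive, ContinuousLinearMap.isPositive_iff_complex]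
    intro x
    have : ⟪D x, x⟫_ℂ = ⟪S x, S x⟫_ℂ := by
      rw [← inner_conj_symm, hD, inner_conj_symm]
    rw [this, inner_self_eq_norm_sq_to_K]
    norm_cast
    simp
  obtain ⟨P, hP, hPP, hPs⟩ : ∃ P : L →L[ℂ] L, P.IsPositive ∧ P ∘L P = D ∧ P.adjoint = P :=
    ⟨CFC.sqrt D, (ContinuousLinearMap.nonneg_iff_isPositive _).1 (CFC.sqrt_nonneg D),
      CFC.sqrt_mul_sqrt_self D hDpos, IsSelfAdjoint.of_nonneg (CFC.sqrt_nonneg D)⟩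
  have hnorm : ∀ x, ‖P x‖ = ‖S x‖ := by
    intro x
    have h1 : ⟪P x, P x⟫_ℂ = ⟪S x, S x⟫_ℂ := by
      rw [← hD, ← hPP, ← ContinuousLinearMap.adjoint_inner_right, hPs]; rfl
    rw [inner_self_eq_norm_sq_to_K, inner_self_eq_norm_sq_to_K] at h1
    have h2 : ‖P x‖ ^ 2 = ‖S x‖ ^ 2 := by exact_mod_cast h1
    exact (sq_eq_sq₀ (norm_nonneg _) (norm_nonneg _)).1 h2
  have hinj : Function.Injective P := by
    rw [injective_iff_map_eq_zero]
    intro x hx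
    have := hnorm x
    rw [hx, norm_zero] at this
    simpa using (norm_eq_zero.1 this.symm)
  let Pe : L ≃ₗ[ℂ] L := LinearEquiv.ofInjectiveEndo (P : L →ₗ[ℂ] L) hinj
  have hPe : ∀ x, Pe x = P x := fun x => rfl
  refine ⟨⟨Pe.symm.trans S, fun x => ?_⟩, P, hP, fun b => ?_⟩
  · change ‖S (Pe.symm x)‖ = ‖x‖
    rw [← hnorm, ← hPe, LinearEquiv.apply_symm_apply]
  · change _ = S (Pe.symm (P (G.π b G.ζ)))
    rw [← hPe, LinearEquiv.symm_apply_apply, ← equiv_apply, hS, equiv_apply, map_star]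

/-- The modular conjugation `J_μ` of a faithful state. -/
noncomputable def J : L ≃ₗᵢ⋆[ℂ] L := G.exists_isModularConjugation.choose

theorem isModularConjugation_J : G.IsModularConjugation G.J :=
  G.exists_isModularConjugation.choose_spec

end GNS

end HopfBimodule

namespace HopfBimodule

namespace GNS

set_option linter.unusedSectionVars false

variable {N : Type*} [CStarAlgebra N] [FiniteDimensional ℂ N] {μ : FaithfulState N}
  {L : Type*} [NormedAddCommGroup L] [InnerProductSpace ℂ L] [CompleteSpace L]
  [FiniteDimensional ℂ L] (G : GNS μ L)

theorem inner_J_J (x y : L) : ⟪G.J x, G.J y⟫_ℂ = ⟪y, x⟫_ℂ := by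
  rw [← inner_conj_symm y x, inner_eq_sum_norm_sq_div_four, inner_eq_sum_norm_sq_div_four x y]
  have hI : (RCLike.I : ℂ) • G.J y = -G.J ((RCLike.I : ℂ) • y) := by
    rw [LinearIsometryEquiv.map_smulₛₗ]
    simp
  rw [hI, ← map_add, ← map_sub, ← sub_eq_add_neg, sub_neg_eq_add, ← map_add, ← map_sub]
  simp only [LinearIsometryEquiv.norm_map]
  simp only [map_div₀, map_add, map_sub, map_mul, map_pow, RCLike.conj_ofReal, RCLike.conj_I,
    map_ofNat]
  ring

/-- Eigenvectors of the positive part of the polar decomposition span, and their behaviour under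
products, adjoints and `J`. -/
theorem exists_eig : ∃ V : ℝ → Set N,
    Submodule.span ℂ {x | ∃ p, 0 < p ∧ x ∈ V p} = ⊤ ∧ (1 : N) ∈ V 1 ∧
    (∀ p q x y, 0 < p → 0 < q → x ∈ V p → y ∈ V q → x * y ∈ V (p * q)) ∧
    (∀ p x, 0 < p → x ∈ V p → star x ∈ V p⁻¹) ∧
    (∀ p x, 0 < p → x ∈ V p → G.J (G.equiv x) = ((p⁻¹ : ℝ) : ℂ) • G.equiv (star x)) := by
  obtain ⟨P, hP, hJ⟩ := G.isModularConjugation_J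
  have hJ' : ∀ b, G.J (P (G.equiv b)) = G.equiv (star b) := fun b => by
    rw [equiv_apply, ← hJ, ← map_star]; rfl
  have hsymm : (P : L →ₗ[ℂ] L).IsSymmetric := hP.isSymmetric
  have hPP : ∀ a b, ⟪P (G.equiv a), P (G.equiv b)⟫_ℂ = μ.toLinearMap (b * star a) := by
    intro a b
    rw [← G.inner_J_J, hJ', hJ', G.inner_equiv, star_star]
  have key : ∀ (p : ℝ) (x : N), 0 < p →
      ((∀ y, μ.toLinearMap (x * y) = (p : ℂ) ^ 2 * μ.toLinearMap (y * x)) ↔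
        P (G.equiv x) = (p : ℂ) • G.equiv x) := by
    intro p x hp
    constructor
    · intro h
      have h2 : P (P (G.equiv x)) = ((p : ℂ) ^ 2) • G.equiv x := by
        refine ext_inner_left ℂ fun w => ?_
        obtain ⟨z, rfl⟩ := G.equiv.surjective w
        rw [inner_smul_right, G.inner_equiv, ← h, ← hPP]
        exact (hsymm _ _).symm
      have hw : P (P (G.equiv x) - (p : ℂ) • G.equiv x)
          = -((p : ℂ) • (P (G.equiv x) - (p : ℂ) • G.equiv x)) := by
        rw [map_sub, h2, map_smul, smul_sub, smul_smul]
        module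
      have hnn := hP.inner_nonneg_left (P (G.equiv x) - (p : ℂ) • G.equiv x)
      rw [hw, inner_neg_left, inner_smul_left, inner_self_eq_norm_sq_to_K, Complex.conj_ofReal] at hnn
      have hnn' : 0 ≤ -(p * ‖P (G.equiv x) - (p : ℂ) • G.equiv x‖ ^ 2) := by
        rw [← Complex.zero_le_real]
        push_cast
        exact hnn
      have h0 : ‖P (G.equiv x) - (p : ℂ) • G.equiv x‖ ^ 2 = 0 := by
        have := sq_nonneg ‖P (G.equiv x) - (p : ℂ) • G.equiv x‖
        nlinarith
      exact sub_eq_zero.1 (norm_eq_zero.1 (pow_eq_zero_iff (two_ne_zero) |>.1 h0))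
    · intro h y
      have h1 := hPP (star y) x
      rw [star_star] at h1
      rw [← h1, h, inner_smul_right]
      have h2 : ⟪P (G.equiv (star y)), G.equiv x⟫_ℂ = ⟪G.equiv (star y), P (G.equiv x)⟫_ℂ :=
        hsymm _ _
      rw [h2, h, inner_smul_right, G.inner_equiv, star_star]
      ring
  refine ⟨fun p => {x | ∀ y, μ.toLinearMap (x * y) = (p : ℂ) ^ 2 * μ.toLinearMap (y * x)},
    ?_, ?_, ?_, ?_, ?_⟩
  · let b := hsymm.eigenvectorBasis rfl
    have hb : ∀ i, ∃ p : ℝ, 0 < p ∧ P (b i) = (p : ℂ) • b i := by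
      intro i
      have h1 : P (b i) = ((hsymm.eigenvalues rfl i : ℝ) : ℂ) • b i :=
        hsymm.apply_eigenvectorBasis rfl i
      refine ⟨_, ?_, h1⟩
      have h2 := hP.inner_nonneg_left (b i)
      rw [h1, inner_smul_left, inner_self_eq_norm_sq_to_K, b.norm_eq_one] at h2
      have h3 : 0 ≤ hsymm.eigenvalues rfl i := by
        rw [← Complex.zero_le_real]
        simpa using h2
      refine lt_of_le_of_ne h3 fun h0 => ?_
      rw [← h0] at h1
      obtain ⟨z, hz⟩ := G.equiv.surjective (b i)
      have h4 := hJ' z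
      rw [hz, h1] at h4
      simp only [Complex.ofReal_zero, zero_smul, map_zero] at h4
      have h5 : star z = 0 := G.equiv.map_eq_zero_iff.1 h4.symm
      have h6 : z = 0 := by simpa using h5
      have h7 : b i = 0 := by rw [← hz, h6, map_zero]
      have h8 := b.norm_eq_one i
      rw [h7, norm_zero] at h8
      exact zero_ne_one h8
    rw [eq_top_iff]
    intro x _
    have hx : x = ∑ i, b.repr (G.equiv x) i • G.equiv.symm (b i) := by
      apply G.equiv.injective
      rw [map_sum]
      simp only [map_smul, LinearEquiv.apply_symm_apply]
      exact (b.sum_repr _).symm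
    rw [hx]
    refine Submodule.sum_mem _ fun i _ => Submodule.smul_mem _ _ (Submodule.subset_span ?_)
    obtain ⟨p, hp, hpb⟩ := hb i
    refine ⟨p, hp, (key p _ hp).2 ?_⟩
    rw [LinearEquiv.apply_symm_apply, hpb]
  · intro y; simp
  · intro p q x y _ _ hx hy z
    rw [mul_assoc, hx, mul_assoc, hy, mul_assoc z x y]
    push_cast; ring
  · intro p x hp hx y
    have h1 := hx (star y)
    have h2 : μ.toLinearMap (star x * y) = conj (μ.toLinearMap (star y * x)) := by
      rw [← G.state_star, star_mul, star_star]
    have h3 : μ.toLinearMap (y * star x) = conj (μ.toLinearMap (x * star y)) := by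
      rw [← G.state_star, star_mul, star_star]
    rw [h2, h3, h1]
    simp only [map_mul, map_pow, Complex.conj_ofReal]
    have : (p : ℂ) ≠ 0 := by exact_mod_cast hp.ne'
    push_cast
    field_simp
  · intro p x hp hx
    have h1 := (key p x hp).1 hx
    have h2 := hJ' x
    rw [h1, LinearIsometryEquiv.map_smulₛₗ, Complex.conj_ofReal] at h2
    have : (p : ℂ) ≠ 0 := by exact_mod_cast hp.ne'
    rw [← h2, smul_smul]
    push_cast
    rw [inv_mul_cancel₀ this, one_smul]

theorem J_ζ : G.J G.ζ = G.ζ := by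
  obtain ⟨V, _, h1, _, _, hJ⟩ := G.exists_eig
  have := hJ 1 1 one_pos h1
  rw [star_one, equiv_one] at this
  simpa using this

theorem J_J (x : L) : G.J (G.J x) = x := by
  obtain ⟨V, hV, h1, hm, hs, hJ⟩ := G.exists_eig
  obtain ⟨z, rfl⟩ := G.equiv.surjective x
  have hz : z ∈ Submodule.span ℂ {x | ∃ p, 0 < p ∧ x ∈ V p} := by rw [hV]; trivial
  induction hz using Submodule.span_induction with
  | mem w hw =>
    obtain ⟨p, hp, hw⟩ := hw
    have : (p : ℂ) ≠ 0 := by exact_mod_cast hp.ne'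
    rw [hJ p w hp hw, LinearIsometryEquiv.map_smulₛₗ, hJ p⁻¹ _ (inv_pos.2 hp) (hs p w hp hw),
      star_star, smul_smul, Complex.conj_ofReal]
    push_cast
    rw [inv_inv, inv_mul_cancel₀ this, one_smul]
  | zero => simp
  | add u w _ _ hu hw => rw [map_add, map_add, map_add, hu, hw]
  | smul t u _ hu =>
    rw [map_smul, LinearIsometryEquiv.map_smulₛₗ, LinearIsometryEquiv.map_smulₛₗ, hu,
      Complex.conj_conj]

/-- The operator `J_μ π_μ(b)* J_μ`. -/
noncomputable def πopFun (b : Nᵐᵒᵖ) : L →L[ℂ] L :=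
  LinearMap.toContinuousLinearMap
    { toFun := fun x => G.J (star (G.π b.unop) (G.J x))
      map_add' := fun x y => by simp
      map_smul' := fun r x => by
        simp only [LinearIsometryEquiv.map_smulₛₗ, map_smul, RingHom.id_apply,
          Complex.conj_conj] }

theorem πopFun_apply (b : Nᵐᵒᵖ) (x : L) : G.πopFun b x = G.J (G.π (star b.unop) (G.J x)) := by
  rw [map_star]; rfl

theorem πopFun_star (a : Nᵐᵒᵖ) : G.πopFun (star a) = star (G.πopFun a) := by
  rw [ContinuousLinearMap.star_eq_adjoint, ContinuousLinearMap.eq_adjoint_iff]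
  intro x y
  have h : ∀ (c : N) (v w : L), ⟪G.π (star c) v, w⟫_ℂ = ⟪v, G.π c w⟫_ℂ := fun c v w => by
    rw [map_star, ContinuousLinearMap.star_eq_adjoint, ContinuousLinearMap.adjoint_inner_left]
  rw [πopFun_apply, πopFun_apply, MulOpposite.unop_star, star_star]
  conv_lhs => rw [← G.J_J y]
  conv_rhs => rw [← G.J_J x]
  rw [G.inner_J_J, G.inner_J_J, h]

/-- The representation `π_μ^op : N^op → 𝓛(H_μ)`, `b^op ↦ J_μ π_μ(b)* J_μ`. -/
noncomputable def πop : Nᵐᵒᵖ →⋆ₐ[ℂ] (L →L[ℂ] L) where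
  toFun := G.πopFun
  map_one' := by ext x; simp [πopFun_apply, G.J_J]
  map_mul' a b := by ext x; simp [πopFun_apply, G.J_J]
  map_zero' := by ext x; simp [πopFun_apply]
  map_add' a b := by ext x; simp [πopFun_apply]
  commutes' r := by
    ext x
    simp [πopFun_apply, Algebra.algebraMap_eq_smul_one, LinearIsometryEquiv.map_smulₛₗ, G.J_J]
  map_star' := G.πopFun_star

theorem πop_apply (b : Nᵐᵒᵖ) (x : L) : G.πop b x = G.J (star (G.π b.unop) (G.J x)) := rfl

theorem πop_equiv (b : Nᵐᵒᵖ) : ∃ r : N, ∀ x, G.πop b (G.equiv x) = G.equiv (x * r) := by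
  obtain ⟨V, hV, h1, hm, hs, hJ⟩ := G.exists_eig
  obtain ⟨a, rfl⟩ : ∃ a, MulOpposite.op (star a) = b := ⟨star b.unop, by simp⟩
  have hz : a ∈ Submodule.span ℂ {x | ∃ p, 0 < p ∧ x ∈ V p} := by rw [hV]; trivial
  induction hz using Submodule.span_induction with
  | mem a ha =>
    obtain ⟨q, hq, ha⟩ := ha
    refine ⟨((q⁻¹ : ℝ) : ℂ) • star a, fun x => ?_⟩
    have hx : x ∈ Submodule.span ℂ {x | ∃ p, 0 < p ∧ x ∈ V p} := by rw [hV]; trivial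
    induction hx using Submodule.span_induction with
    | mem x hx =>
      obtain ⟨p, hp, hx⟩ := hx
      have : (p : ℂ) ≠ 0 := by exact_mod_cast hp.ne'
      rw [πop_apply, hJ p x hp hx, MulOpposite.unop_op, ← map_star, star_star, map_smul, π_equiv,
        LinearIsometryEquiv.map_smulₛₗ,
        hJ (q * p⁻¹) _ (by positivity) (hm q p⁻¹ a (star x) hq (by positivity) ha (hs p x hp hx)),
        star_mul, star_star, smul_smul, mul_smul_comm, map_smul, Complex.conj_ofReal]
      congr 1
      push_cast
      field_simp
    | zero => simp
    | add u w _ _ hu hw => rw [map_add, map_add, hu, hw, add_mul, map_add]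
    | smul t u _ hu => rw [map_smul, map_smul, hu, smul_mul_assoc, map_smul]
  | zero => exact ⟨0, fun x => by simp⟩
  | add u w _ _ hu hw =>
    obtain ⟨r, hr⟩ := hu
    obtain ⟨s, hs⟩ := hw
    exact ⟨r + s, fun x => by
      rw [star_add, MulOpposite.op_add, map_add, mul_add, map_add, ← hr, ← hs]; rfl⟩
  | smul t u _ hu =>
    obtain ⟨r, hr⟩ := hu
    exact ⟨conj t • r, fun x => by
      rw [star_smul, MulOpposite.op_smul, map_smul, mul_smul_comm, map_smul, ← hr]; rfl⟩

/-- The ranges of `π_μ` and `π_μ^op` commute. -/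
theorem π_πop (a : N) (b : Nᵐᵒᵖ) (x : L) : G.π a (G.πop b x) = G.πop b (G.π a x) := by
  obtain ⟨r, hr⟩ := G.πop_equiv b
  obtain ⟨z, rfl⟩ := G.equiv.surjective x
  rw [hr, π_equiv, π_equiv, hr, mul_assoc]

/-- The map `b^op ↦ π_μ^op(b^op) ζ_μ` identifies `N^op` with `H_μ`. -/
noncomputable def equivOp : Nᵐᵒᵖ ≃ₗ[ℂ] L :=
  LinearEquiv.ofBijective
    { toFun := fun b => G.πop b G.ζ
      map_add' := fun a b => by simp
      map_smul' := fun r a => by simp }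
    (by
      have h : ∀ b : Nᵐᵒᵖ, G.πop b G.ζ = G.J (G.equiv (star b.unop)) := fun b => by
        rw [πop_apply, J_ζ, equiv_apply, map_star]
      constructor
      · intro a b hab
        change G.πop a G.ζ = G.πop b G.ζ at hab
        rw [h, h] at hab
        exact MulOpposite.unop_injective (star_injective (G.equiv.injective (G.J.injective hab)))
      · intro x
        refine ⟨MulOpposite.op (star (G.equiv.symm (G.J.symm x))), ?_⟩
        change G.πop _ G.ζ = x
        rw [h]
        simp)

theorem equivOp_apply (b : Nᵐᵒᵖ) : G.equivOp b = G.πop b G.ζ := rfl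

theorem πop_equivOp (a b : Nᵐᵒᵖ) : G.πop a (G.equivOp b) = G.equivOp (a * b) := by
  rw [equivOp_apply, equivOp_apply, map_mul]; rfl

theorem equivOp_one : G.equivOp 1 = G.ζ := by rw [equivOp_apply, map_one]; rfl

end GNS

end HopfBimodule

namespace HopfBimodule

namespace GNS

set_option linter.unusedSectionVars false

section

variable {N : Type*} [CStarAlgebra N] [FiniteDimensional ℂ N] {μ : FaithfulState N}
  {L : Type*} [NormedAddCommGroup L] [InnerProductSpace ℂ L] [CompleteSpace L]
  [FiniteDimensional ℂ L] (G : GNS μ L)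
  {H K : Type*}
  [NormedAddCommGroup H] [InnerProductSpace ℂ H] [CompleteSpace H] [FiniteDimensional ℂ H]
  [NormedAddCommGroup K] [InnerProductSpace ℂ K] [CompleteSpace K] [FiniteDimensional ℂ K]
  (ρ : Nᵐᵒᵖ →⋆ₐ[ℂ] (H →L[ℂ] H)) (σ : N →⋆ₐ[ℂ] (K →L[ℂ] K))

/-- The operator `R_{μ^op}^ρ(ξ) : H_μ → H`, `π_μ^op(b^op) ζ_μ ↦ ρ(b^op) ξ`. -/
noncomputable def Rop (ξ : H) : L →L[ℂ] H :=
  LinearMap.toContinuousLinearMap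
    { toFun := fun x => ρ (G.equivOp.symm x) ξ
      map_add' := fun x y => by simp
      map_smul' := fun r x => by simp }

/-- The operator `R_μ^σ(η) : H_μ → K`, `π_μ(b) ζ_μ ↦ σ(b) η`. -/
noncomputable def R (η : K) : L →L[ℂ] K :=
  LinearMap.toContinuousLinearMap
    { toFun := fun x => σ (G.equiv.symm x) η
      map_add' := fun x y => by simp
      map_smul' := fun r x => by simp }

theorem Rop_apply (ξ : H) (b : Nᵐᵒᵖ) : G.Rop ρ ξ (G.πop b G.ζ) = ρ b ξ := by
  rw [← equivOp_apply]
  change ρ (G.equivOp.symm (G.equivOp b)) ξ = _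
  rw [LinearEquiv.symm_apply_apply]

theorem R_apply (η : K) (b : N) : G.R σ η (G.π b G.ζ) = σ b η := by
  rw [← equiv_apply]
  change σ (G.equiv.symm (G.equiv b)) η = _
  rw [LinearEquiv.symm_apply_apply]

theorem Rop_πop (ξ : H) (b : Nᵐᵒᵖ) (x : L) :
    G.Rop ρ ξ (G.πop b x) = ρ b (G.Rop ρ ξ x) := by
  obtain ⟨c, rfl⟩ := G.equivOp.surjective x
  rw [πop_equivOp, equivOp_apply, equivOp_apply, Rop_apply, Rop_apply, map_mul]
  rfl

theorem R_π (η : K) (b : N) (x : L) : G.R σ η (G.π b x) = σ b (G.R σ η x) := by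
  obtain ⟨c, rfl⟩ := G.equiv.surjective x
  rw [π_equiv, equiv_apply, equiv_apply, R_apply, R_apply, map_mul]
  rfl

theorem Rop_ζ (ξ : H) : G.Rop ρ ξ G.ζ = ξ := by
  have := G.Rop_apply ρ ξ 1
  rwa [map_one, map_one] at this

theorem R_ζ (η : K) : G.R σ η G.ζ = η := by
  have := G.R_apply σ η 1
  rwa [map_one, map_one] at this

theorem Rop_unique (ξ : H) (T : L →L[ℂ] H) (hT : ∀ b x, T (G.πop b x) = ρ b (T x))
    (h : T G.ζ = ξ) : T = G.Rop ρ ξ := by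
  ext x
  obtain ⟨c, rfl⟩ := G.equivOp.surjective x
  rw [equivOp_apply, hT, h, Rop_apply]

theorem R_unique (η : K) (T : L →L[ℂ] K) (hT : ∀ b x, T (G.π b x) = σ b (T x))
    (h : T G.ζ = η) : T = G.R σ η := by
  ext x
  obtain ⟨c, rfl⟩ := G.equiv.surjective x
  rw [equiv_apply, hT, h, R_apply]

theorem Rop_add (ξ ξ' : H) : G.Rop ρ (ξ + ξ') = G.Rop ρ ξ + G.Rop ρ ξ' := by
  ext x; exact map_add (ρ (G.equivOp.symm x)) ξ ξ'

theorem Rop_smul (r : ℂ) (ξ : H) : G.Rop ρ (r • ξ) = r • G.Rop ρ ξ := by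
  ext x; exact map_smul (ρ (G.equivOp.symm x)) r ξ

theorem R_add (η η' : K) : G.R σ (η + η') = G.R σ η + G.R σ η' := by
  ext x; exact map_add (σ (G.equiv.symm x)) η η'

theorem R_smul (r : ℂ) (η : K) : G.R σ (r • η) = r • G.R σ η := by
  ext x; exact map_smul (σ (G.equiv.symm x)) r η

/-- `R_{μ^op}^ρ(ξ)* R_{μ^op}^ρ(ξ')` lies in `π_μ(N)`. -/
theorem exists_π (ξ ξ' : H) : ∃ n, (G.Rop ρ ξ).adjoint ∘L G.Rop ρ ξ' = G.π n := by
  have h1 : ∀ b h, (G.Rop ρ ξ).adjoint (ρ b h) = G.πop b ((G.Rop ρ ξ).adjoint h) := by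
    intro b h
    refine ext_inner_right ℂ fun y => ?_
    have hb : b = star (star b) := (star_star b).symm
    rw [hb, map_star ρ, map_star G.πop, ContinuousLinearMap.star_eq_adjoint,
      ContinuousLinearMap.star_eq_adjoint]
    simp only [ContinuousLinearMap.adjoint_inner_left]
    rw [Rop_πop]
  refine ⟨G.equiv.symm ((G.Rop ρ ξ).adjoint ξ'), ?_⟩
  ext x
  obtain ⟨c, rfl⟩ := G.equivOp.surjective x
  rw [equivOp_apply, π_πop, ← equiv_apply, LinearEquiv.apply_symm_apply,
    ContinuousLinearMap.comp_apply, Rop_apply, h1]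

/-- `R_μ^σ(η)* R_μ^σ(η')` lies in `π_μ^op(N^op)`. -/
theorem exists_πop (η η' : K) : ∃ n, (G.R σ η).adjoint ∘L G.R σ η' = G.πop n := by
  have h1 : ∀ b h, (G.R σ η).adjoint (σ b h) = G.π b ((G.R σ η).adjoint h) := by
    intro b h
    refine ext_inner_right ℂ fun y => ?_
    have hb : b = star (star b) := (star_star b).symm
    rw [hb, map_star σ, map_star G.π, ContinuousLinearMap.star_eq_adjoint,
      ContinuousLinearMap.star_eq_adjoint]
    simp only [ContinuousLinearMap.adjoint_inner_left]
    rw [R_π]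
  refine ⟨G.equivOp.symm ((G.R σ η).adjoint η'), ?_⟩
  ext x
  obtain ⟨c, rfl⟩ := G.equiv.surjective x
  rw [equiv_apply, ← π_πop, ← equivOp_apply, LinearEquiv.apply_symm_apply,
    ContinuousLinearMap.comp_apply, R_apply, h1]

theorem commute_R (ξ ξ' : H) (η η' : K) :
    Commute ((G.Rop ρ ξ).adjoint ∘L G.Rop ρ ξ') ((G.R σ η).adjoint ∘L G.R σ η') := by
  obtain ⟨n, hn⟩ := G.exists_π ρ ξ ξ'
  obtain ⟨m, hm⟩ := G.exists_πop σ η η'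
  rw [hn, hm]
  ext x
  exact G.π_πop n m x

/-- The sesquilinear form on the algebraic tensor product `H ⊗ K` that defines the relative tensor
product. -/
noncomputable def relForm : (H ⊗[ℂ] K) →ₗ⋆[ℂ] (H ⊗[ℂ] K) →ₗ[ℂ] ℂ :=
  TensorProduct.lift (LinearMap.mk₂'ₛₗ (starRingEnd ℂ) (starRingEnd ℂ)
    (fun ξ η => TensorProduct.lift (LinearMap.mk₂ ℂ
      (fun ξ' η' => ⟪(G.Rop ρ ξ').adjoint (G.Rop ρ ξ G.ζ), (G.R σ η).adjoint (G.R σ η' G.ζ)⟫_ℂ)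
      (fun a b c => by simp [Rop_add])
      (fun r a b => by simp [Rop_smul, LinearIsometryEquiv.map_smulₛₗ, mul_comm])
      (fun a b c => by simp [R_add])
      (fun r a b => by simp [R_smul])))
    (fun a b c => by ext; simp [Rop_add])
    (fun r a b => by ext; simp [Rop_smul, mul_comm])
    (fun a b c => by ext; simp [R_add])
    (fun r a b => by ext; simp [R_smul, LinearIsometryEquiv.map_smulₛₗ]))

theorem relForm_tmul (ξ ξ' : H) (η η' : K) :
    G.relForm ρ σ (ξ ⊗ₜ η) (ξ' ⊗ₜ η') =
      ⟪(G.Rop ρ ξ').adjoint (G.Rop ρ ξ G.ζ), (G.R σ η).adjoint (G.R σ η' G.ζ)⟫_ℂ := rfl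

theorem relForm_tmul' (ξ ξ' : H) (η η' : K) :
    G.relForm ρ σ (ξ ⊗ₜ η) (ξ' ⊗ₜ η') =
      ⟪G.ζ, (G.Rop ρ ξ).adjoint (G.Rop ρ ξ' ((G.R σ η).adjoint (G.R σ η' G.ζ)))⟫_ℂ := by
  rw [relForm_tmul, ContinuousLinearMap.adjoint_inner_left, ContinuousLinearMap.adjoint_inner_right]

theorem relForm_symm (x y : H ⊗[ℂ] K) : conj (G.relForm ρ σ y x) = G.relForm ρ σ x y := by
  induction x using TensorProduct.induction_on with
  | zero => simp
  | add u v hu hv => simp only [map_add, LinearMap.add_apply, hu, hv]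
  | tmul ξ η =>
    induction y using TensorProduct.induction_on with
    | zero => simp
    | add u v hu hv => simp only [map_add, LinearMap.add_apply, hu, hv]
    | tmul ξ' η' =>
      have h := DFunLike.congr_fun (G.commute_R ρ σ ξ ξ' η η') G.ζ
      change (G.Rop ρ ξ).adjoint (G.Rop ρ ξ' ((G.R σ η).adjoint (G.R σ η' G.ζ)))
        = (G.R σ η).adjoint (G.R σ η' ((G.Rop ρ ξ).adjoint (G.Rop ρ ξ' G.ζ))) at h
      rw [G.relForm_tmul ρ σ ξ', inner_conj_symm, relForm_tmul', h]
      simp only [ContinuousLinearMap.adjoint_inner_right]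
      rw [← ContinuousLinearMap.adjoint_inner_right (G.Rop ρ ξ),
        ContinuousLinearMap.adjoint_inner_left]

theorem relForm_nonneg (x : H ⊗[ℂ] K) : 0 ≤ G.relForm ρ σ x x := by
  obtain ⟨n, f, g, rfl⟩ := TensorProduct.exists_sum_tmul_eq x
  have := gram_nonneg (fun _ : Fin n => G.ζ) (fun i => G.Rop ρ (f i)) (fun i => G.R σ (g i))
    (fun i j k l => G.commute_R ρ σ _ _ _ _)
  simp only [map_sum, LinearMap.sum_apply, relForm_tmul']
  rw [Finset.sum_comm]
  exact this

/-- The relative tensor product `H ⊗ K` over `N` with respect to `μ`, `ρ`, `σ`. -/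
def RelTensor : Type _ :=
  HilbertQuotient (coreOfForm (G.relForm ρ σ) (G.relForm_symm ρ σ) (G.relForm_nonneg ρ σ))

noncomputable instance : NormedAddCommGroup (G.RelTensor ρ σ) :=
  inferInstanceAs (NormedAddCommGroup (HilbertQuotient _))

noncomputable instance : InnerProductSpace ℂ (G.RelTensor ρ σ) :=
  inferInstanceAs (InnerProductSpace ℂ (HilbertQuotient _))

instance : FiniteDimensional ℂ (G.RelTensor ρ σ) :=
  inferInstanceAs (FiniteDimensional ℂ (HilbertQuotient _))

instance : CompleteSpace (G.RelTensor ρ σ) :=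
  inferInstanceAs (CompleteSpace (HilbertQuotient _))

/-- The quotient map from the algebraic tensor product. -/
noncomputable def relMk : (H ⊗[ℂ] K) →ₗ[ℂ] G.RelTensor ρ σ := HilbertQuotient.mk _

theorem relMk_surjective : Function.Surjective (G.relMk ρ σ) := HilbertQuotient.mk_surjective _

theorem inner_relMk (x y : H ⊗[ℂ] K) :
    ⟪G.relMk ρ σ x, G.relMk ρ σ y⟫_ℂ = G.relForm ρ σ x y := rfl

/-- The image of `ξ ⊗ η` in the relative tensor product. -/
noncomputable def tmul (ξ : H) (η : K) : G.RelTensor ρ σ := G.relMk ρ σ (ξ ⊗ₜ η)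

theorem inner_tmul (ξ ξ' : H) (η η' : K) :
    ⟪G.tmul ρ σ ξ η, G.tmul ρ σ ξ' η'⟫_ℂ =
      ⟪(G.Rop ρ ξ').adjoint (G.Rop ρ ξ G.ζ), (G.R σ η).adjoint (G.R σ η' G.ζ)⟫_ℂ := rfl

theorem inner_tmul' (ξ ξ' : H) (η η' : K) :
    ⟪G.tmul ρ σ ξ η, G.tmul ρ σ ξ' η'⟫_ℂ =
      ⟪G.ζ, (G.Rop ρ ξ).adjoint (G.Rop ρ ξ' ((G.R σ η).adjoint (G.R σ η' G.ζ)))⟫_ℂ :=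
  G.relForm_tmul' ρ σ ξ ξ' η η'

theorem span_tmul :
    Submodule.span ℂ (Set.range fun p : H × K => G.tmul ρ σ p.1 p.2) = ⊤ := by
  rw [eq_top_iff]
  intro x _
  obtain ⟨t, rfl⟩ := G.relMk_surjective ρ σ x
  induction t using TensorProduct.induction_on with
  | zero => simp
  | add u v hu hv => rw [map_add]; exact Submodule.add_mem _ (hu trivial) (hv trivial)
  | tmul ξ η => exact Submodule.subset_span ⟨(ξ, η), rfl⟩

end

end GNS

end HopfBimodule

namespace HopfBimodule

namespace GNS

set_option linter.unusedSectionVars false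

section

variable {N : Type*} [CStarAlgebra N] [FiniteDimensional ℂ N] {μ : FaithfulState N}
  {L : Type*} [NormedAddCommGroup L] [InnerProductSpace ℂ L] [CompleteSpace L]
  [FiniteDimensional ℂ L] (G : GNS μ L)
  {H K H' K' M : Type*}
  [NormedAddCommGroup H] [InnerProductSpace ℂ H] [CompleteSpace H] [FiniteDimensional ℂ H]
  [NormedAddCommGroup K] [InnerProductSpace ℂ K] [CompleteSpace K] [FiniteDimensional ℂ K]
  [NormedAddCommGroup H'] [InnerProductSpace ℂ H'] [CompleteSpace H'] [FiniteDimensional ℂ H']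
  [NormedAddCommGroup K'] [InnerProductSpace ℂ K'] [CompleteSpace K'] [FiniteDimensional ℂ K']
  [NormedAddCommGroup M] [InnerProductSpace ℂ M] [CompleteSpace M] [FiniteDimensional ℂ M]
  {ρ : Nᵐᵒᵖ →⋆ₐ[ℂ] (H →L[ℂ] H)} {σ : N →⋆ₐ[ℂ] (K →L[ℂ] K)}
  {ρ' : Nᵐᵒᵖ →⋆ₐ[ℂ] (H' →L[ℂ] H')} {σ' : N →⋆ₐ[ℂ] (K' →L[ℂ] K')}

/-- The operator `X` intertwines the representations `f` and `g`. -/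
def Intertwines {R E F : Type*} [Semiring R] [Algebra ℂ R] [Star R]
    [NormedAddCommGroup E] [InnerProductSpace ℂ E] [CompleteSpace E]
    [NormedAddCommGroup F] [InnerProductSpace ℂ F] [CompleteSpace F]
    (f : R →⋆ₐ[ℂ] (E →L[ℂ] E)) (g : R →⋆ₐ[ℂ] (F →L[ℂ] F)) (X : E →L[ℂ] F) : Prop :=
  ∀ r, X ∘L f r = g r ∘L X

theorem Intertwines.adjoint {R E F : Type*} [Semiring R] [Algebra ℂ R] [StarRing R]
    [NormedAddCommGroup E] [InnerProductSpace ℂ E] [CompleteSpace E]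
    [NormedAddCommGroup F] [InnerProductSpace ℂ F] [CompleteSpace F]
    {f : R →⋆ₐ[ℂ] (E →L[ℂ] E)} {g : R →⋆ₐ[ℂ] (F →L[ℂ] F)} {X : E →L[ℂ] F}
    (h : Intertwines f g X) : Intertwines g f X.adjoint := by
  intro r
  have h1 := congrArg ContinuousLinearMap.adjoint (h (star r))
  rw [ContinuousLinearMap.adjoint_comp, ContinuousLinearMap.adjoint_comp,
    ← ContinuousLinearMap.star_eq_adjoint (f _), ← ContinuousLinearMap.star_eq_adjoint (g _),
    ← map_star, ← map_star, star_star] at h1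
  exact h1.symm

theorem Intertwines.Rop {X : H →L[ℂ] H'} (h : Intertwines ρ ρ' X) (ξ : H) :
    X ∘L G.Rop ρ ξ = G.Rop ρ' (X ξ) := by
  refine G.Rop_unique ρ' (X ξ) _ (fun b x => ?_) ?_
  · rw [ContinuousLinearMap.comp_apply, Rop_πop]
    exact DFunLike.congr_fun (h b) _
  · rw [ContinuousLinearMap.comp_apply, Rop_ζ]

theorem Intertwines.R {Y : K →L[ℂ] K'} (h : Intertwines σ σ' Y) (η : K) :
    Y ∘L G.R σ η = G.R σ' (Y η) := by
  refine G.R_unique σ' (Y η) _ (fun b x => ?_) ?_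
  · rw [ContinuousLinearMap.comp_apply, R_π]
    exact DFunLike.congr_fun (h b) _
  · rw [ContinuousLinearMap.comp_apply, R_ζ]

theorem exists_map {X : H →L[ℂ] H'} {Y : K →L[ℂ] K'} (hX : Intertwines ρ ρ' X)
    (hY : Intertwines σ σ' Y) : ∃ T : G.RelTensor ρ σ →L[ℂ] G.RelTensor ρ' σ',
      ∀ p : H × K, T (G.tmul ρ σ p.1 p.2) = G.tmul ρ' σ' (X p.1) (Y p.2) := by
  refine exists_operator _ (G.span_tmul ρ σ) _ _ (G.span_tmul ρ' σ')
    (fun q => G.tmul ρ σ (X.adjoint q.1) (Y.adjoint q.2)) ?_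
  rintro ⟨ξ, η⟩ ⟨ξ', η'⟩
  rw [inner_tmul', inner_tmul', ← hX.Rop, ← hY.R, ← hX.adjoint.Rop, ← hY.adjoint.R]
  simp only [ContinuousLinearMap.adjoint_comp, ContinuousLinearMap.adjoint_adjoint,
    ContinuousLinearMap.comp_apply]

/-- The operator `X ⊗ Y : ξ ⊗ η ↦ X ξ ⊗ Y η` between relative tensor products. -/
noncomputable def map {X : H →L[ℂ] H'} {Y : K →L[ℂ] K'} (hX : Intertwines ρ ρ' X)
    (hY : Intertwines σ σ' Y) : G.RelTensor ρ σ →L[ℂ] G.RelTensor ρ' σ' :=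
  (G.exists_map hX hY).choose

theorem map_tmul {X : H →L[ℂ] H'} {Y : K →L[ℂ] K'} (hX : Intertwines ρ ρ' X)
    (hY : Intertwines σ σ' Y) (ξ : H) (η : K) :
    G.map hX hY (G.tmul ρ σ ξ η) = G.tmul ρ' σ' (X ξ) (Y η) :=
  (G.exists_map hX hY).choose_spec (ξ, η)

theorem rel_ext {F : Type*} [NormedAddCommGroup F] [InnerProductSpace ℂ F] [CompleteSpace F]
    [FiniteDimensional ℂ F] {S T : G.RelTensor ρ σ →L[ℂ] F}
    (h : ∀ ξ η, S (G.tmul ρ σ ξ η) = T (G.tmul ρ σ ξ η)) : S = T :=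
  operator_ext (G.span_tmul ρ σ) fun p => h p.1 p.2

theorem tmul_add (ξ : H) (η η' : K) :
    G.tmul ρ σ ξ (η + η') = G.tmul ρ σ ξ η + G.tmul ρ σ ξ η' := by
  simp only [tmul, TensorProduct.tmul_add, map_add]

theorem add_tmul (ξ ξ' : H) (η : K) :
    G.tmul ρ σ (ξ + ξ') η = G.tmul ρ σ ξ η + G.tmul ρ σ ξ' η := by
  simp only [tmul, TensorProduct.add_tmul, map_add]

theorem tmul_smul (r : ℂ) (ξ : H) (η : K) :
    G.tmul ρ σ ξ (r • η) = r • G.tmul ρ σ ξ η := by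
  simp only [tmul, TensorProduct.tmul_smul, map_smul]

theorem smul_tmul (r : ℂ) (ξ : H) (η : K) :
    G.tmul ρ σ (r • ξ) η = r • G.tmul ρ σ ξ η := by
  simp only [tmul, ← TensorProduct.smul_tmul', map_smul]

theorem inner_tmul_left {ξ ξ' : H} {n : N}
    (hn : (G.Rop ρ ξ).adjoint ∘L G.Rop ρ ξ' = G.π n) (η η' : K) :
    ⟪G.tmul ρ σ ξ η, G.tmul ρ σ ξ' η'⟫_ℂ = ⟪η, σ n η'⟫_ℂ := by
  have h := DFunLike.congr_fun (G.commute_R ρ σ ξ ξ' η η') G.ζ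
  change (G.Rop ρ ξ).adjoint (G.Rop ρ ξ' ((G.R σ η).adjoint (G.R σ η' G.ζ)))
    = (G.R σ η).adjoint (G.R σ η' (((G.Rop ρ ξ).adjoint ∘L G.Rop ρ ξ') G.ζ)) at h
  rw [inner_tmul', h, hn, R_apply, ContinuousLinearMap.adjoint_inner_right, R_ζ]

theorem inner_tmul_right {η η' : K} {m : Nᵐᵒᵖ}
    (hm : (G.R σ η).adjoint ∘L G.R σ η' = G.πop m) (ξ ξ' : H) :
    ⟪G.tmul ρ σ ξ η, G.tmul ρ σ ξ' η'⟫_ℂ = ⟪ξ, ρ m ξ'⟫_ℂ := by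
  rw [inner_tmul']
  change ⟪G.ζ, (G.Rop ρ ξ).adjoint (G.Rop ρ ξ' (((G.R σ η).adjoint ∘L G.R σ η') G.ζ))⟫_ℂ = _
  rw [hm, Rop_apply, ContinuousLinearMap.adjoint_inner_right, Rop_ζ]

theorem map_adjoint {X : H →L[ℂ] H'} {Y : K →L[ℂ] K'} (hX : Intertwines ρ ρ' X)
    (hY : Intertwines σ σ' Y) :
    (G.map hX hY).adjoint = G.map hX.adjoint hY.adjoint := by
  symm
  rw [ContinuousLinearMap.eq_adjoint_iff]
  intro x y
  suffices h : ∀ y, ContinuousLinearMap.adjoint (G.map hX.adjoint hY.adjoint) y = G.map hX hY y by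
    rw [← h, ContinuousLinearMap.adjoint_inner_right]
  intro y
  congr 1
  refine G.rel_ext fun ξ η => ext_inner_left ℂ fun w => ?_
  rw [ContinuousLinearMap.adjoint_inner_right, map_tmul]
  have hw : w ∈ Submodule.span ℂ (Set.range fun p : H' × K' => G.tmul ρ' σ' p.1 p.2) := by
    rw [span_tmul]; trivial
  induction hw using Submodule.span_induction with
  | mem w hw =>
    obtain ⟨⟨ξ', η'⟩, rfl⟩ := hw
    dsimp only
    rw [map_tmul, inner_tmul', inner_tmul', ← hX.Rop, ← hY.R, ← hX.adjoint.Rop, ← hY.adjoint.R]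
    simp only [ContinuousLinearMap.adjoint_comp, ContinuousLinearMap.adjoint_adjoint,
      ContinuousLinearMap.comp_apply]
  | zero => simp
  | add u w _ _ hu hw => rw [map_add, inner_add_left, inner_add_left, hu, hw]
  | smul t u _ hu => rw [map_smul, inner_smul_left, inner_smul_left, hu]

theorem intertwines_one (f : Nᵐᵒᵖ →⋆ₐ[ℂ] (H →L[ℂ] H)) : Intertwines f f 1 := fun _ => rfl

theorem intertwines_one' (f : N →⋆ₐ[ℂ] (H →L[ℂ] H)) : Intertwines f f 1 := fun _ => rfl

/-- The representation `x ↦ 1 ⊗ τ(x)`. -/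
noncomputable def legTwo {R : Type*} [Semiring R] [Algebra ℂ R] [StarRing R]
    (ρ : Nᵐᵒᵖ →⋆ₐ[ℂ] (H →L[ℂ] H)) (τ : R →⋆ₐ[ℂ] (K →L[ℂ] K))
    (h : ∀ r, Intertwines σ σ (τ r)) :
    R →⋆ₐ[ℂ] (G.RelTensor ρ σ →L[ℂ] G.RelTensor ρ σ) where
  toFun r := G.map (intertwines_one ρ) (h r)
  map_one' := G.rel_ext fun ξ η => by rw [map_tmul, map_one]; rfl
  map_mul' a b := G.rel_ext fun ξ η => by
    rw [map_tmul, map_mul]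
    change G.tmul ρ σ ξ (τ a (τ b η)) = G.map (intertwines_one ρ) (h a)
      (G.map (intertwines_one ρ) (h b) (G.tmul ρ σ ξ η))
    rw [map_tmul, map_tmul]
    rfl
  map_zero' := G.rel_ext fun ξ η => by
    rw [map_tmul, map_zero]
    simpa using G.tmul_smul (ρ := ρ) (σ := σ) 0 ξ 0
  map_add' a b := G.rel_ext fun ξ η => by
    rw [map_tmul, map_add, add_apply, add_apply, tmul_add, map_tmul, map_tmul]
  commutes' r := G.rel_ext fun ξ η => by
    rw [map_tmul, Algebra.algebraMap_eq_smul_one, Algebra.algebraMap_eq_smul_one, map_smul, map_one]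
    exact G.tmul_smul r ξ η
  map_star' a := by
    rw [ContinuousLinearMap.star_eq_adjoint, map_adjoint]
    refine G.rel_ext fun ξ η => ?_
    rw [map_tmul, map_tmul, ← ContinuousLinearMap.star_eq_adjoint,
      ← ContinuousLinearMap.star_eq_adjoint, star_one, map_star]

theorem legTwo_tmul {R : Type*} [Semiring R] [Algebra ℂ R] [StarRing R]
    (τ : R →⋆ₐ[ℂ] (K →L[ℂ] K)) (h : ∀ r, Intertwines σ σ (τ r)) (r : R) (ξ : H) (η : K) :
    G.legTwo ρ τ h r (G.tmul ρ σ ξ η) = G.tmul ρ σ ξ (τ r η) :=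
  G.map_tmul (intertwines_one ρ) (h r) ξ η

/-- The representation `y ↦ τ(y) ⊗ 1`. -/
noncomputable def legOne {R : Type*} [Semiring R] [Algebra ℂ R] [StarRing R]
    (σ : N →⋆ₐ[ℂ] (K →L[ℂ] K)) (τ : R →⋆ₐ[ℂ] (H →L[ℂ] H))
    (h : ∀ r, Intertwines ρ ρ (τ r)) :
    R →⋆ₐ[ℂ] (G.RelTensor ρ σ →L[ℂ] G.RelTensor ρ σ) where
  toFun r := G.map (h r) (intertwines_one' σ)
  map_one' := G.rel_ext fun ξ η => by rw [map_tmul, map_one]; rfl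
  map_mul' a b := G.rel_ext fun ξ η => by
    rw [map_tmul, map_mul]
    change G.tmul ρ σ (τ a (τ b ξ)) η = G.map (h a) (intertwines_one' σ)
      (G.map (h b) (intertwines_one' σ) (G.tmul ρ σ ξ η))
    rw [map_tmul, map_tmul]
    rfl
  map_zero' := G.rel_ext fun ξ η => by
    rw [map_tmul, map_zero]
    simpa using G.smul_tmul (ρ := ρ) (σ := σ) 0 0 η
  map_add' a b := G.rel_ext fun ξ η => by
    rw [map_tmul, map_add, add_apply, add_apply, add_tmul, map_tmul, map_tmul]
  commutes' r := G.rel_ext fun ξ η => by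
    rw [map_tmul, Algebra.algebraMap_eq_smul_one, Algebra.algebraMap_eq_smul_one, map_smul, map_one]
    exact G.smul_tmul r ξ η
  map_star' a := by
    rw [ContinuousLinearMap.star_eq_adjoint, map_adjoint]
    refine G.rel_ext fun ξ η => ?_
    rw [map_tmul, map_tmul, ← ContinuousLinearMap.star_eq_adjoint,
      ← ContinuousLinearMap.star_eq_adjoint, star_one, map_star]

theorem legOne_tmul {R : Type*} [Semiring R] [Algebra ℂ R] [StarRing R]
    (τ : R →⋆ₐ[ℂ] (H →L[ℂ] H)) (h : ∀ r, Intertwines ρ ρ (τ r)) (r : R) (ξ : H) (η : K) :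
    G.legOne σ τ h r (G.tmul ρ σ ξ η) = G.tmul ρ σ (τ r ξ) η :=
  G.map_tmul (h r) (intertwines_one' σ) ξ η

/-! #### Associativity -/

theorem span_tmul_tmul {τ : Nᵐᵒᵖ →⋆ₐ[ℂ] (G.RelTensor ρ σ →L[ℂ] G.RelTensor ρ σ)}
    {ω : N →⋆ₐ[ℂ] (M →L[ℂ] M)} :
    Submodule.span ℂ (Set.range fun p : H × K × M =>
      G.tmul τ ω (G.tmul ρ σ p.1 p.2.1) p.2.2) = ⊤ := by
  rw [eq_top_iff, ← G.span_tmul τ ω, Submodule.span_le]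
  rintro _ ⟨⟨w, m⟩, rfl⟩
  have hw : w ∈ Submodule.span ℂ (Set.range fun p : H × K => G.tmul ρ σ p.1 p.2) := by
    rw [span_tmul]; trivial
  dsimp only
  induction hw using Submodule.span_induction with
  | mem w hw =>
    obtain ⟨⟨ξ, η⟩, rfl⟩ := hw
    exact Submodule.subset_span ⟨(ξ, η, m), rfl⟩
  | zero =>
    have := G.smul_tmul (ρ := τ) (σ := ω) 0 0 m
    rw [zero_smul, zero_smul] at this
    rw [this]; exact Submodule.zero_mem _
  | add u w _ _ hu hw => rw [add_tmul]; exact Submodule.add_mem _ hu hw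
  | smul t u _ hu => rw [smul_tmul]; exact Submodule.smul_mem _ _ hu

theorem span_tmul_tmul' {τ : Nᵐᵒᵖ →⋆ₐ[ℂ] (M →L[ℂ] M)}
    {ω : N →⋆ₐ[ℂ] (G.RelTensor ρ σ →L[ℂ] G.RelTensor ρ σ)} :
    Submodule.span ℂ (Set.range fun p : M × H × K =>
      G.tmul τ ω p.1 (G.tmul ρ σ p.2.1 p.2.2)) = ⊤ := by
  rw [eq_top_iff, ← G.span_tmul τ ω, Submodule.span_le]
  rintro _ ⟨⟨m, w⟩, rfl⟩
  have hw : w ∈ Submodule.span ℂ (Set.range fun p : H × K => G.tmul ρ σ p.1 p.2) := by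
    rw [span_tmul]; trivial
  dsimp only
  induction hw using Submodule.span_induction with
  | mem w hw =>
    obtain ⟨⟨ξ, η⟩, rfl⟩ := hw
    exact Submodule.subset_span ⟨(m, ξ, η), rfl⟩
  | zero =>
    have := G.tmul_smul (ρ := τ) (σ := ω) 0 m 0
    rw [zero_smul, zero_smul] at this
    rw [this]; exact Submodule.zero_mem _
  | add u w _ _ hu hw => rw [tmul_add]; exact Submodule.add_mem _ hu hw
  | smul t u _ hu => rw [tmul_smul]; exact Submodule.smul_mem _ _ hu

variable (ρ σ) in
theorem exists_assoc (τ : Nᵐᵒᵖ →⋆ₐ[ℂ] (K →L[ℂ] K)) (ω : N →⋆ₐ[ℂ] (M →L[ℂ] M))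
    (h : ∀ x, Intertwines σ σ (τ x)) (h' : ∀ y, Intertwines τ τ (σ y)) :
    ∃ W : G.RelTensor (G.legTwo ρ τ h) ω ≃ₗᵢ[ℂ] G.RelTensor ρ (G.legOne ω σ h'),
      ∀ p : H × K × M, W (G.tmul _ _ (G.tmul ρ σ p.1 p.2.1) p.2.2)
        = G.tmul _ _ p.1 (G.tmul τ ω p.2.1 p.2.2) := by
  refine exists_unitary _ G.span_tmul_tmul _ G.span_tmul_tmul' ?_
  rintro ⟨ξ, η, θ⟩ ⟨ξ', η', θ'⟩
  obtain ⟨n, hn⟩ := G.exists_π ρ ξ ξ'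
  obtain ⟨m, hm⟩ := G.exists_πop ω θ θ'
  dsimp only
  rw [G.inner_tmul_right hm, legTwo_tmul, G.inner_tmul_left hn, G.inner_tmul_left hn, legOne_tmul,
    G.inner_tmul_right hm]
  congr 1
  exact DFunLike.congr_fun (h m n).symm η'

/-- The associativity isomorphism `(ξ ⊗ η) ⊗ θ ↦ ξ ⊗ (η ⊗ θ)` of relative tensor products. -/
noncomputable def assoc (ρ : Nᵐᵒᵖ →⋆ₐ[ℂ] (H →L[ℂ] H)) (σ : N →⋆ₐ[ℂ] (K →L[ℂ] K))
    (τ : Nᵐᵒᵖ →⋆ₐ[ℂ] (K →L[ℂ] K)) (ω : N →⋆ₐ[ℂ] (M →L[ℂ] M))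
    (h : ∀ x, Intertwines σ σ (τ x)) (h' : ∀ y, Intertwines τ τ (σ y)) :
    G.RelTensor (G.legTwo ρ τ h) ω ≃ₗᵢ[ℂ] G.RelTensor ρ (G.legOne ω σ h') :=
  (G.exists_assoc ρ σ τ ω h h').choose

theorem assoc_tmul (τ : Nᵐᵒᵖ →⋆ₐ[ℂ] (K →L[ℂ] K)) (ω : N →⋆ₐ[ℂ] (M →L[ℂ] M))
    (h : ∀ x, Intertwines σ σ (τ x)) (h' : ∀ y, Intertwines τ τ (σ y)) (ξ : H) (η : K) (θ : M) :
    G.assoc ρ σ τ ω h h' (G.tmul _ _ (G.tmul ρ σ ξ η) θ) = G.tmul _ _ ξ (G.tmul τ ω η θ) :=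
  (G.exists_assoc ρ σ τ ω h h').choose_spec (ξ, η, θ)

end

end GNS

end HopfBimodule

namespace HopfBimodule

/-- `⋆`-homomorphisms (not assumed to be unital) between algebras of operators. -/
abbrev OpHom {H K : Type*}
    [NormedAddCommGroup H] [InnerProductSpace ℂ H] [CompleteSpace H]
    [NormedAddCommGroup K] [InnerProductSpace ℂ K] [CompleteSpace K]
    (A : StarSubalgebra ℂ (H →L[ℂ] H)) (B : StarSubalgebra ℂ (K →L[ℂ] K)) : Type _ :=
  A →⋆ₙₐ[ℂ] B

/-- The identity. -/
noncomputable abbrev OpHom.id {H : Type*} [NormedAddCommGroup H] [InnerProductSpace ℂ H] [CompleteSpace H]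
    (A : StarSubalgebra ℂ (H →L[ℂ] H)) : OpHom A A :=
  NonUnitalStarAlgHom.id ℂ A

/-- The operator `φ(a)`. -/
noncomputable abbrev OpHom.op {H K : Type*}
    [NormedAddCommGroup H] [InnerProductSpace ℂ H] [CompleteSpace H]
    [NormedAddCommGroup K] [InnerProductSpace ℂ K] [CompleteSpace K]
    {A : StarSubalgebra ℂ (H →L[ℂ] H)} {B : StarSubalgebra ℂ (K →L[ℂ] K)}
    (φ : OpHom A B) (a : A) : K →L[ℂ] K :=
  (φ a : K →L[ℂ] K)

namespace GNS

set_option linter.unusedSectionVars false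

section

variable {N : Type*} [CStarAlgebra N] [FiniteDimensional ℂ N] {μ : FaithfulState N}
  {L : Type*} [NormedAddCommGroup L] [InnerProductSpace ℂ L] [CompleteSpace L]
  [FiniteDimensional ℂ L] (G : GNS μ L)
  {H K H' K' : Type*}
  [NormedAddCommGroup H] [InnerProductSpace ℂ H] [CompleteSpace H] [FiniteDimensional ℂ H]
  [NormedAddCommGroup K] [InnerProductSpace ℂ K] [CompleteSpace K] [FiniteDimensional ℂ K]
  [NormedAddCommGroup H'] [InnerProductSpace ℂ H'] [CompleteSpace H'] [FiniteDimensional ℂ H']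
  [NormedAddCommGroup K'] [InnerProductSpace ℂ K'] [CompleteSpace K'] [FiniteDimensional ℂ K']
  {ρ : Nᵐᵒᵖ →⋆ₐ[ℂ] (H →L[ℂ] H)} {σ : N →⋆ₐ[ℂ] (K →L[ℂ] K)}
  {ρ' : Nᵐᵒᵖ →⋆ₐ[ℂ] (H' →L[ℂ] H')} {σ' : N →⋆ₐ[ℂ] (K' →L[ℂ] K')}

theorem intertwines_of_commutant {R E : Type*} [Semiring R] [Algebra ℂ R] [Star R]
    [NormedAddCommGroup E] [InnerProductSpace ℂ E] [CompleteSpace E]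
    {A : StarSubalgebra ℂ (E →L[ℂ] E)} {τ : R →⋆ₐ[ℂ] (E →L[ℂ] E)} (h : ∀ x, τ x ∈ A)
    {S : E →L[ℂ] E} (hS : ∀ a ∈ A, S * a = a * S) : Intertwines τ τ S :=
  fun x => hS _ (h x)

/-- The fibre product `A * B = (A' ⊗ B')'` of C⋆-subalgebras `A ⊆ 𝓛(H)` and `B ⊆ 𝓛(K)` that contain
`ρ(N^op)` and `σ(N)`, respectively. -/
noncomputable def fibre (A : StarSubalgebra ℂ (H →L[ℂ] H)) (B : StarSubalgebra ℂ (K →L[ℂ] K))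
    (hρ : ∀ x, ρ x ∈ A) (hσ : ∀ y, σ y ∈ B) :
    StarSubalgebra ℂ (G.RelTensor ρ σ →L[ℂ] G.RelTensor ρ σ) :=
  StarSubalgebra.centralizer ℂ
    {Z | ∃ (S : H →L[ℂ] H) (hS : ∀ a ∈ A, S * a = a * S) (T : K →L[ℂ] K)
      (hT : ∀ b ∈ B, T * b = b * T),
      Z = G.map (intertwines_of_commutant hρ hS) (intertwines_of_commutant hσ hT)}

theorem legTwo_mem_fibre {A : StarSubalgebra ℂ (H →L[ℂ] H)} {B : StarSubalgebra ℂ (K →L[ℂ] K)}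
    (hρ : ∀ x, ρ x ∈ A) (hσ : ∀ y, σ y ∈ B) {τ : Nᵐᵒᵖ →⋆ₐ[ℂ] (K →L[ℂ] K)}
    (h : ∀ r, Intertwines σ σ (τ r)) (hτ : ∀ x, τ x ∈ B) (x : Nᵐᵒᵖ) :
    G.legTwo ρ τ h x ∈ G.fibre A B hρ hσ := by
  have key : ∀ (x : Nᵐᵒᵖ) (S : H →L[ℂ] H) (hS : ∀ a ∈ A, S * a = a * S) (T : K →L[ℂ] K)
      (hT : ∀ b ∈ B, T * b = b * T),
      G.map (intertwines_of_commutant hρ hS) (intertwines_of_commutant hσ hT) * G.legTwo ρ τ h x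
      = G.legTwo ρ τ h x *
        G.map (intertwines_of_commutant hρ hS) (intertwines_of_commutant hσ hT) := by
    intro x S hS T hT
    refine G.rel_ext fun ξ η => ?_
    change G.map _ _ (G.legTwo ρ τ h x (G.tmul ρ σ ξ η))
      = G.legTwo ρ τ h x (G.map _ _ (G.tmul ρ σ ξ η))
    rw [legTwo_tmul, map_tmul, map_tmul, legTwo_tmul]
    congr 1
    exact DFunLike.congr_fun (hT _ (hτ x)) η
  rw [fibre, StarSubalgebra.mem_centralizer_iff]
  rintro _ ⟨S, hS, T, hT, rfl⟩
  refine ⟨key x S hS T hT, ?_⟩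
  have := congrArg star (key (star x) S hS T hT)
  rw [star_mul, star_mul, map_star, star_star] at this
  exact this.symm

theorem legOne_mem_fibre {A : StarSubalgebra ℂ (H →L[ℂ] H)} {B : StarSubalgebra ℂ (K →L[ℂ] K)}
    (hρ : ∀ x, ρ x ∈ A) (hσ : ∀ y, σ y ∈ B) {τ : N →⋆ₐ[ℂ] (H →L[ℂ] H)}
    (h : ∀ r, Intertwines ρ ρ (τ r)) (hτ : ∀ x, τ x ∈ A) (x : N) :
    G.legOne σ τ h x ∈ G.fibre A B hρ hσ := by
  have key : ∀ (x : N) (S : H →L[ℂ] H) (hS : ∀ a ∈ A, S * a = a * S) (T : K →L[ℂ] K)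
      (hT : ∀ b ∈ B, T * b = b * T),
      G.map (intertwines_of_commutant hρ hS) (intertwines_of_commutant hσ hT) * G.legOne σ τ h x
      = G.legOne σ τ h x *
        G.map (intertwines_of_commutant hρ hS) (intertwines_of_commutant hσ hT) := by
    intro x S hS T hT
    refine G.rel_ext fun ξ η => ?_
    change G.map _ _ (G.legOne σ τ h x (G.tmul ρ σ ξ η))
      = G.legOne σ τ h x (G.map _ _ (G.tmul ρ σ ξ η))
    rw [legOne_tmul, map_tmul, map_tmul, legOne_tmul]
    congr 1
    exact DFunLike.congr_fun (hS _ (hτ x)) ξ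
  rw [fibre, StarSubalgebra.mem_centralizer_iff]
  rintro _ ⟨S, hS, T, hT, rfl⟩
  refine ⟨key x S hS T hT, ?_⟩
  have := congrArg star (key (star x) S hS T hT)
  rw [star_mul, star_mul, map_star, star_star] at this
  exact this.symm

/-- `Γ` is the fibre product `φ * ψ : A * B → C * D` of the morphisms `φ` and `ψ`: it satisfies
`Γ(S) (X ⊗ Y) = (X ⊗ Y) S` for all `X ∈ 𝓛^φ(H, H')` and `Y ∈ 𝓛^ψ(K, K')`. If `φ` and `ψ` are
compatible with the given representations of `N^op` and `N`, then `X` and `Y` automatically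
intertwine these representations, and `Γ` exists and is unique. -/
def IsFibreMap {A : StarSubalgebra ℂ (H →L[ℂ] H)} {B : StarSubalgebra ℂ (K →L[ℂ] K)}
    {C : StarSubalgebra ℂ (H' →L[ℂ] H')} {D : StarSubalgebra ℂ (K' →L[ℂ] K')}
    {hρ : ∀ x, ρ x ∈ A} {hσ : ∀ y, σ y ∈ B} {hρ' : ∀ x, ρ' x ∈ C} {hσ' : ∀ y, σ' y ∈ D}
    (φ : OpHom A C) (ψ : OpHom B D) (Γ : OpHom (G.fibre A B hρ hσ) (G.fibre C D hρ' hσ')) : Prop :=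
  ∀ (X : H →L[ℂ] H') (Y : K →L[ℂ] K')
    (_ : ∀ a : A, X ∘L a.1 = φ.op a ∘L X) (_ : ∀ b : B, Y ∘L b.1 = ψ.op b ∘L Y)
    (hX : Intertwines ρ ρ' X) (hY : Intertwines σ σ' Y) (S : G.fibre A B hρ hσ),
    Γ.op S ∘L G.map hX hY = G.map hX hY ∘L S.1

/-- `(N, μ, A, ρ, σ, Δ)` is a finite-dimensional Hopf-von Neumann bimodule. Here `A ⊆ 𝓛(H)` is a
C⋆-subalgebra that contains the commuting images of `ρ : N^op → 𝓛(H)` and `σ : N → 𝓛(H)`. -/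
structure IsHopfVonNeumannBimodule (A : StarSubalgebra ℂ (H →L[ℂ] H))
    (ρ : Nᵐᵒᵖ →⋆ₐ[ℂ] (H →L[ℂ] H)) (σ : N →⋆ₐ[ℂ] (H →L[ℂ] H))
    (hρ : ∀ x, ρ x ∈ A) (hσ : ∀ y, σ y ∈ A) (hcomm : ∀ x y, ρ x * σ y = σ y * ρ x)
    (Δ : OpHom A (G.fibre A A hρ hσ)) : Prop where
  /-- `Δ(ρ(x)) = 1 ⊗ ρ(x)` -/
  map_ρ : ∀ x : Nᵐᵒᵖ, Δ.op ⟨ρ x, hρ x⟩ = G.legTwo ρ ρ hcomm x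
  /-- `Δ(σ(y)) = σ(y) ⊗ 1` -/
  map_σ : ∀ y : N, Δ.op ⟨σ y, hσ y⟩ = G.legOne σ σ (fun y x => (hcomm x y).symm) y
  /-- `(Δ * id) ∘ Δ = (id * Δ) ∘ Δ`, up to the associativity isomorphism of the threefold relative
  tensor product -/
  coassoc : ∃ (Γ₁ : OpHom (G.fibre A A hρ hσ) (G.fibre (G.fibre A A hρ hσ) A
        (G.legTwo_mem_fibre hρ hσ hcomm hρ) hσ))
      (Γ₂ : OpHom (G.fibre A A hρ hσ) (G.fibre A (G.fibre A A hρ hσ) hρ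
        (G.legOne_mem_fibre hρ hσ (fun y x => (hcomm x y).symm) hσ))),
      G.IsFibreMap Δ (OpHom.id A) Γ₁ ∧ G.IsFibreMap (OpHom.id A) Δ Γ₂ ∧
      ∀ (a : A) (w : G.RelTensor (G.legTwo ρ ρ hcomm) σ),
        G.assoc ρ σ ρ σ hcomm (fun y x => (hcomm x y).symm) (Γ₁.op (Δ a) w) =
          Γ₂.op (Δ a) (G.assoc ρ σ ρ σ hcomm (fun y x => (hcomm x y).symm) w)

end

end GNS

end HopfBimodule

namespace HopfBimodule

/-! ### C⋆-bases and C⋆-factorizations -/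

set_option linter.unusedSectionVars false

/-- A C⋆-base `(E, 𝔅, 𝔅†)` on a finite-dimensional Hilbert space `E`: a pair of commuting
nondegenerate C⋆-algebras of operators on `E`. In finite dimensions, the latter are the unital
`⋆`-subalgebras of `𝓛(E)`. -/
structure CStarBase (E : Type*) [NormedAddCommGroup E] [InnerProductSpace ℂ E]
    [CompleteSpace E] where
  /-- the algebra `𝔅` -/
  alg : StarSubalgebra ℂ (E →L[ℂ] E)
  /-- the algebra `𝔅†` -/
  dag : StarSubalgebra ℂ (E →L[ℂ] E)
  comm : ∀ a ∈ alg, ∀ b ∈ dag, a * b = b * a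

section

variable {E : Type*} [NormedAddCommGroup E] [InnerProductSpace ℂ E] [CompleteSpace E]
  [FiniteDimensional ℂ E]

/-- The opposite C⋆-base `(E, 𝔅†, 𝔅)`. -/
abbrev CStarBase.op (B : CStarBase E) : CStarBase E where
  alg := B.dag
  dag := B.alg
  comm a ha b hb := (B.comm b hb a ha).symm

/-- The vector `ζ` is cyclic for `𝔅` and for `𝔅†`. -/
structure CStarBase.IsBicyclic (B : CStarBase E) (ζ : E) : Prop where
  cyclic_alg : ∀ x : E, ∃ b ∈ B.alg, b ζ = x
  cyclic_dag : ∀ x : E, ∃ b ∈ B.dag, b ζ = x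

/-- A C⋆-factorization of the finite-dimensional Hilbert space `H` with respect to a C⋆-base. -/
structure CStarFact (B : CStarBase E) (H : Type*) [NormedAddCommGroup H] [InnerProductSpace ℂ H]
    [CompleteSpace H] where
  /-- the underlying space of operators -/
  carrier : Submodule ℂ (E →L[ℂ] H)
  /-- `[α* α] = 𝔅` -/
  span_adjoint_comp : Submodule.span ℂ {T : E →L[ℂ] E | ∃ ξ ∈ carrier, ∃ ξ' ∈ carrier,
    T = ξ.adjoint ∘L ξ'} = Subalgebra.toSubmodule B.alg.toSubalgebra
  /-- `[α 𝔅] = α` -/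
  span_comp : Submodule.span ℂ {T : E →L[ℂ] H | ∃ ξ ∈ carrier, ∃ b ∈ B.alg, T = ξ ∘L b} = carrier
  /-- `[α E] = H` -/
  span_apply : Submodule.span ℂ {x : H | ∃ ξ ∈ carrier, ∃ v : E, x = ξ v} = ⊤

namespace CStarFact

variable {B : CStarBase E} {H K : Type*}
  [NormedAddCommGroup H] [InnerProductSpace ℂ H] [CompleteSpace H] [FiniteDimensional ℂ H]
  [NormedAddCommGroup K] [InnerProductSpace ℂ K] [CompleteSpace K] [FiniteDimensional ℂ K]
  (α : CStarFact B H)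

theorem total : Submodule.span ℂ (Set.range fun p : α.carrier × E => p.1.1 p.2) = ⊤ := by
  rw [← α.span_apply]
  congr 1
  ext x
  constructor
  · rintro ⟨⟨ξ, v⟩, rfl⟩; exact ⟨ξ.1, ξ.2, v, rfl⟩
  · rintro ⟨ξ, hξ, v, rfl⟩; exact ⟨(⟨ξ, hξ⟩, v), rfl⟩

theorem ext_op {F : Type*} [NormedAddCommGroup F] [InnerProductSpace ℂ F] [CompleteSpace F]
    [FiniteDimensional ℂ F] {S T : H →L[ℂ] F} (h : ∀ ξ : α.carrier, ∀ v, S (ξ.1 v) = T (ξ.1 v)) :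
    S = T :=
  operator_ext α.total fun p => h p.1 p.2

theorem adjoint_comp_mem (ξ ξ' : α.carrier) : ξ.1.adjoint ∘L ξ'.1 ∈ B.alg := by
  have : ξ.1.adjoint ∘L ξ'.1 ∈ Subalgebra.toSubmodule B.alg.toSubalgebra := by
    rw [← α.span_adjoint_comp]
    exact Submodule.subset_span ⟨ξ.1, ξ.2, ξ'.1, ξ'.2, rfl⟩
  exact this

theorem comp_mem (ξ : α.carrier) {b : E →L[ℂ] E} (hb : b ∈ B.alg) : ξ.1 ∘L b ∈ α.carrier := by
  have h : ξ.1 ∘L b ∈ Submodule.span ℂ {T : E →L[ℂ] H | ∃ ξ ∈ α.carrier, ∃ b ∈ B.alg, T = ξ ∘L b} :=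
    Submodule.subset_span ⟨ξ.1, ξ.2, b, hb, rfl⟩
  rwa [α.span_comp] at h

theorem adjoint_comp_comm (ξ ξ' : α.carrier) {b : E →L[ℂ] E} (hb : b ∈ B.dag) (v : E) :
    ξ.1.adjoint (ξ'.1 (b v)) = b (ξ.1.adjoint (ξ'.1 v)) :=
  DFunLike.congr_fun (B.comm _ (α.adjoint_comp_mem ξ ξ') b hb) v

theorem exists_rep (b : B.dag) : ∃ T : H →L[ℂ] H, ∀ p : α.carrier × E,
    T (p.1.1 p.2) = p.1.1 (b.1 p.2) := by
  refine exists_operator _ α.total _ _ α.total (fun p => p.1.1 ((star b.1) p.2)) ?_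
  rintro ⟨ξ, v⟩ ⟨ξ', v'⟩
  dsimp only
  rw [← ContinuousLinearMap.adjoint_inner_right, α.adjoint_comp_comm ξ' ξ b.2,
    ← ContinuousLinearMap.adjoint_inner_right ξ'.1, ContinuousLinearMap.star_eq_adjoint,
    ContinuousLinearMap.adjoint_inner_left]

/-- The operator `ρ_α(b†)`. -/
noncomputable def repFun (b : B.dag) : H →L[ℂ] H := (α.exists_rep b).choose

theorem repFun_apply (b : B.dag) (ξ : α.carrier) (v : E) :
    α.repFun b (ξ.1 v) = ξ.1 (b.1 v) := (α.exists_rep b).choose_spec (ξ, v)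

/-- The representation `ρ_α : 𝔅† → 𝓛(H)` that is given by `ρ_α(b†) ξ v = ξ b† v` for `ξ ∈ α` and
`v ∈ E`. -/
noncomputable def rep : B.dag →⋆ₐ[ℂ] (H →L[ℂ] H) where
  toFun := α.repFun
  map_one' := α.ext_op fun ξ v => by rw [repFun_apply]; rfl
  map_mul' a b := α.ext_op fun ξ v => by
    change _ = α.repFun a (α.repFun b (ξ.1 v))
    rw [repFun_apply, repFun_apply]
    exact (α.repFun_apply a ξ (b.1 v)).symm
  map_zero' := α.ext_op fun ξ v => by
    rw [repFun_apply]
    exact map_zero ξ.1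
  map_add' a b := α.ext_op fun ξ v => by
    rw [add_apply, repFun_apply, repFun_apply, repFun_apply]
    exact map_add ξ.1 (a.1 v) (b.1 v)
  commutes' r := α.ext_op fun ξ v => by
    rw [repFun_apply, Algebra.algebraMap_eq_smul_one]
    exact map_smul ξ.1 r v
  map_star' b := by
    rw [ContinuousLinearMap.star_eq_adjoint]
    refine α.ext_op fun ξ v => ext_inner_left ℂ fun w => ?_
    rw [ContinuousLinearMap.adjoint_inner_right]
    have hw : w ∈ Submodule.span ℂ (Set.range fun p : α.carrier × E => p.1.1 p.2) := by
      rw [total]; trivial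
    induction hw using Submodule.span_induction with
    | mem w hw =>
      obtain ⟨⟨ξ', v'⟩, rfl⟩ := hw
      dsimp only
      rw [repFun_apply, repFun_apply, ← ContinuousLinearMap.adjoint_inner_right,
        α.adjoint_comp_comm ξ' ξ (star b).2, ← ContinuousLinearMap.adjoint_inner_right ξ'.1]
      change ⟪v', (star b.1) _⟫_ℂ = _
      rw [ContinuousLinearMap.star_eq_adjoint, ContinuousLinearMap.adjoint_inner_right]
    | zero => simp
    | add u w _ _ hu hw => rw [inner_add_left, map_add, inner_add_left, hu, hw]
    | smul t u _ hu => rw [inner_smul_left, map_smul, inner_smul_left, hu]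

theorem rep_apply (b : B.dag) (ξ : α.carrier) (v : E) : α.rep b (ξ.1 v) = ξ.1 (b.1 v) :=
  α.repFun_apply b ξ v

/-- Every operator that intertwines the action of `𝔅†` on `E` with `ρ_α` belongs to `α`. -/
theorem mem_of_intertwines {ζ : E} (hζ : B.IsBicyclic ζ) (T : E →L[ℂ] H)
    (hT : ∀ (b : B.dag) v, T (b.1 v) = α.rep b (T v)) : T ∈ α.carrier := by
  obtain ⟨ξ, hξ, h⟩ : ∃ ξ ∈ α.carrier, ξ ζ = T ζ := by
    have : T ζ ∈ Submodule.span ℂ (Set.range fun p : α.carrier × E => p.1.1 p.2) := by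
      rw [α.total]; trivial
    generalize T ζ = w at this
    induction this using Submodule.span_induction with
    | mem w hw =>
      obtain ⟨⟨ξ, v⟩, rfl⟩ := hw
      obtain ⟨b, hb, rfl⟩ := hζ.cyclic_alg v
      exact ⟨ξ.1 ∘L b, α.comp_mem ξ hb, rfl⟩
    | zero => exact ⟨0, zero_mem _, rfl⟩
    | add u w _ _ hu hw =>
      obtain ⟨ξ, hξ, rfl⟩ := hu
      obtain ⟨ξ', hξ', rfl⟩ := hw
      exact ⟨ξ + ξ', add_mem hξ hξ', rfl⟩
    | smul t u _ hu =>
      obtain ⟨ξ, hξ, rfl⟩ := hu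
      exact ⟨t • ξ, Submodule.smul_mem _ _ hξ, rfl⟩
  have : T = ξ := by
    ext v
    obtain ⟨b, hb, rfl⟩ := hζ.cyclic_dag v
    rw [hT ⟨b, hb⟩, ← h]
    exact α.rep_apply ⟨b, hb⟩ ⟨ξ, hξ⟩ ζ
  rw [this]; exact hξ

/-- Two C⋆-factorizations `α` and `β` of `H` with respect to C⋆-bases `(E, 𝔅, 𝔅†)` and
`(F, ℭ, ℭ†)` are compatible if `[ρ_α(𝔅†) β] = β` and `[ρ_β(ℭ†) α] = α`. -/
structure Compatible {F : Type*} [NormedAddCommGroup F] [InnerProductSpace ℂ F] [CompleteSpace F]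
    [FiniteDimensional ℂ F] {C : CStarBase F} (α : CStarFact B H) (β : CStarFact C H) : Prop where
  span_left : Submodule.span ℂ {T : F →L[ℂ] H | ∃ b : B.dag, ∃ η ∈ β.carrier,
    T = α.rep b ∘L η} = β.carrier
  span_right : Submodule.span ℂ {T : E →L[ℂ] H | ∃ c : C.dag, ∃ ξ ∈ α.carrier,
    T = β.rep c ∘L ξ} = α.carrier

section Compatible

variable {F : Type*} [NormedAddCommGroup F] [InnerProductSpace ℂ F] [CompleteSpace F]
    [FiniteDimensional ℂ F] {C : CStarBase F} {α : CStarFact B H} {β : CStarFact C H}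

theorem Compatible.symm (h : Compatible α β) : Compatible β α := ⟨h.span_right, h.span_left⟩

theorem Compatible.rep_comp_mem (h : Compatible α β) (b : B.dag) (η : β.carrier) :
    α.rep b ∘L η.1 ∈ β.carrier := by
  have h' : α.rep b ∘L η.1 ∈ Submodule.span ℂ {T : F →L[ℂ] H | ∃ b : B.dag, ∃ η ∈ β.carrier,
      T = α.rep b ∘L η} := Submodule.subset_span ⟨b, η.1, η.2, rfl⟩
  rwa [h.span_left] at h'

theorem Compatible.rep_rep (h : Compatible α β) (b : B.dag) (c : C.dag) (x : H) :
    α.rep b (β.rep c x) = β.rep c (α.rep b x) := by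
  refine DFunLike.congr_fun (f := α.rep b ∘L β.rep c) (g := β.rep c ∘L α.rep b)
    (β.ext_op fun η v => ?_) x
  change α.rep b (β.rep c (η.1 v)) = β.rep c (α.rep b (η.1 v))
  rw [rep_apply]
  exact (β.rep_apply c ⟨_, h.rep_comp_mem b η⟩ v).symm

end Compatible

end CStarFact

end

end HopfBimodule

namespace HopfBimodule

/-! ### The C⋆-relative tensor product -/

namespace CStarFact

set_option linter.unusedSectionVars false

section

variable {E : Type*} [NormedAddCommGroup E] [InnerProductSpace ℂ E] [CompleteSpace E]
  [FiniteDimensional ℂ E] {B : CStarBase E}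
  {H K : Type*}
  [NormedAddCommGroup H] [InnerProductSpace ℂ H] [CompleteSpace H] [FiniteDimensional ℂ H]
  [NormedAddCommGroup K] [InnerProductSpace ℂ K] [CompleteSpace K] [FiniteDimensional ℂ K]
  (α : CStarFact B H) (β : CStarFact B.op K)

instance : FiniteDimensional ℂ α.carrier :=
  FiniteDimensional.of_injective
    ((ContinuousLinearMap.coeLM ℂ : (E →L[ℂ] H) →ₗ[ℂ] (E →ₗ[ℂ] H)) ∘ₗ α.carrier.subtype)
    (fun _ _ h => Subtype.ext (ContinuousLinearMap.coe_injective h))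

theorem commute_comp (ξ ξ' : α.carrier) (η η' : β.carrier) :
    Commute (ξ.1.adjoint ∘L ξ'.1) (η.1.adjoint ∘L η'.1) :=
  B.comm _ (α.adjoint_comp_mem ξ ξ') _ (β.adjoint_comp_mem η η')

/-- The linear functional `ξ' ⊗ v' ⊗ η' ↦ ⟨v, ξ* ξ' η* η' v'⟩`. -/
noncomputable def relFun (ξ : α.carrier) (v : E) (η : β.carrier) :
    (α.carrier ⊗[ℂ] (E ⊗[ℂ] β.carrier)) →ₗ[ℂ] ℂ :=
  TensorProduct.lift (LinearMap.mk₂ ℂ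
    (fun ξ' t => ⟪ξ.1 v, ξ'.1 (TensorProduct.lift (LinearMap.mk₂ ℂ
      (fun v' η' => η.1.adjoint (η'.1 v'))
      (fun a b c => by simp) (fun r a b => by simp)
      (fun a b c => by simp) (fun r a b => by simp)) t)⟫_ℂ)
    (fun a b c => by simp) (fun r a b => by simp)
    (fun a b c => by simp) (fun r a b => by simp))

theorem relFun_tmul (ξ ξ' : α.carrier) (v v' : E) (η η' : β.carrier) :
    relFun α β ξ v η (ξ' ⊗ₜ (v' ⊗ₜ η')) = ⟪ξ.1 v, ξ'.1 (η.1.adjoint (η'.1 v'))⟫_ℂ := rfl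

theorem tensor_induction {p : (α.carrier ⊗[ℂ] (E ⊗[ℂ] β.carrier)) → Prop} (h0 : p 0)
    (ht : ∀ ξ v η, p (ξ ⊗ₜ (v ⊗ₜ η))) (ha : ∀ x y, p x → p y → p (x + y)) (x) : p x := by
  induction x using TensorProduct.induction_on with
  | zero => exact h0
  | add u v hu hv => exact ha _ _ hu hv
  | tmul ξ t =>
    induction t using TensorProduct.induction_on with
    | zero => rw [TensorProduct.tmul_zero]; exact h0
    | add u v hu hv => rw [TensorProduct.tmul_add]; exact ha _ _ hu hv
    | tmul v η => exact ht _ _ _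

theorem fun_ext {f g : (α.carrier ⊗[ℂ] (E ⊗[ℂ] β.carrier)) →ₗ[ℂ] ℂ}
    (h : ∀ ξ v η, f (ξ ⊗ₜ (v ⊗ₜ η)) = g (ξ ⊗ₜ (v ⊗ₜ η))) : f = g := by
  refine LinearMap.ext fun x => ?_
  induction x using tensor_induction with
  | h0 => rw [map_zero, map_zero]
  | ha x y hx hy => rw [map_add, map_add, hx, hy]
  | ht ξ v η => exact h ξ v η

/-- The functional `relFun`, as a function of `v ⊗ η`. -/
noncomputable def relRow (ξ : α.carrier) : (E ⊗[ℂ] β.carrier) →ₗ⋆[ℂ]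
    (α.carrier ⊗[ℂ] (E ⊗[ℂ] β.carrier)) →ₗ[ℂ] ℂ :=
  TensorProduct.lift (LinearMap.mk₂'ₛₗ (starRingEnd ℂ) (starRingEnd ℂ)
    (fun v η => relFun α β ξ v η)
    (fun a b c => fun_ext α β fun ξ v η => by simp [relFun_tmul])
    (fun r a b => fun_ext α β fun ξ v η => by simp [relFun_tmul, mul_comm])
    (fun a b c => fun_ext α β fun ξ v η => by simp [relFun_tmul])
    (fun r a b => fun_ext α β fun ξ v η => by
      simp [relFun_tmul, LinearIsometryEquiv.map_smulₛₗ]))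

theorem relRow_tmul (ξ ξ' : α.carrier) (v v' : E) (η η' : β.carrier) :
    relRow α β ξ (v ⊗ₜ η) (ξ' ⊗ₜ (v' ⊗ₜ η')) = ⟪ξ.1 v, ξ'.1 (η.1.adjoint (η'.1 v'))⟫_ℂ := rfl

theorem relRow_add (a b : α.carrier) (t : E ⊗[ℂ] β.carrier) :
    relRow α β (a + b) t = relRow α β a t + relRow α β b t := by
  induction t using TensorProduct.induction_on with
  | zero => rw [map_zero, map_zero, map_zero, add_zero]
  | add u v hu hv => rw [map_add, hu, hv, map_add, map_add]; abel
  | tmul v η =>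
    refine fun_ext α β fun ξ' v' η' => ?_
    rw [LinearMap.add_apply, relRow_tmul, relRow_tmul, relRow_tmul, ← inner_add_left]
    rfl

theorem relRow_smul (r : ℂ) (a : α.carrier) (t : E ⊗[ℂ] β.carrier) :
    relRow α β (r • a) t = (starRingEnd ℂ r) • relRow α β a t := by
  induction t using TensorProduct.induction_on with
  | zero => rw [map_zero, map_zero, smul_zero]
  | add u v hu hv => rw [map_add, hu, hv, map_add, smul_add]
  | tmul v η =>
    refine fun_ext α β fun ξ' v' η' => ?_
    rw [LinearMap.smul_apply, relRow_tmul, relRow_tmul, smul_eq_mul, ← inner_smul_left]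
    rfl

/-- The sesquilinear form on the algebraic tensor product `α ⊗ E ⊗ β` that defines the
C⋆-relative tensor product. -/
noncomputable def relForm : (α.carrier ⊗[ℂ] (E ⊗[ℂ] β.carrier)) →ₗ⋆[ℂ]
    (α.carrier ⊗[ℂ] (E ⊗[ℂ] β.carrier)) →ₗ[ℂ] ℂ :=
  TensorProduct.lift (LinearMap.mk₂'ₛₗ (starRingEnd ℂ) (starRingEnd ℂ)
    (fun ξ t => relRow α β ξ t)
    (relRow_add α β) (relRow_smul α β)
    (fun a b c => map_add (relRow α β a) b c)
    (fun r a b => LinearMap.map_smulₛₗ (relRow α β a) r b))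

theorem relForm_tmul (ξ ξ' : α.carrier) (v v' : E) (η η' : β.carrier) :
    relForm α β (ξ ⊗ₜ (v ⊗ₜ η)) (ξ' ⊗ₜ (v' ⊗ₜ η')) =
      ⟪ξ.1 v, ξ'.1 (η.1.adjoint (η'.1 v'))⟫_ℂ := rfl

theorem relForm_symm (x y : α.carrier ⊗[ℂ] (E ⊗[ℂ] β.carrier)) :
    conj (relForm α β y x) = relForm α β x y := by
  induction x using tensor_induction with
  | h0 => simp
  | ha u v hu hv => simp only [map_add, LinearMap.add_apply, hu, hv]
  | ht ξ v η =>
    induction y using tensor_induction with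
    | h0 => simp
    | ha u v hu hv => simp only [map_add, LinearMap.add_apply, hu, hv]
    | ht ξ' v' η' =>
      have h := DFunLike.congr_fun (commute_comp α β ξ ξ' η η') v'
      change ξ.1.adjoint (ξ'.1 (η.1.adjoint (η'.1 v'))) =
        η.1.adjoint (η'.1 (ξ.1.adjoint (ξ'.1 v'))) at h
      rw [relForm_tmul, relForm_tmul, inner_conj_symm,
        ← ContinuousLinearMap.adjoint_inner_right ξ.1 v, h,
        ContinuousLinearMap.adjoint_inner_right η.1, ← ContinuousLinearMap.adjoint_inner_left η'.1,
        ContinuousLinearMap.adjoint_inner_right ξ.1]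

theorem exists_sum (x : α.carrier ⊗[ℂ] (E ⊗[ℂ] β.carrier)) :
    ∃ (n : ℕ) (ξ : Fin n → α.carrier) (v : Fin n → E) (η : Fin n → β.carrier),
      x = ∑ i, ξ i ⊗ₜ (v i ⊗ₜ η i) := by
  obtain ⟨n, f, g, rfl⟩ := TensorProduct.exists_sum_tmul_eq x
  choose m a b h using fun i => TensorProduct.exists_sum_tmul_eq (g i)
  let e := Fintype.equivFin (Σ i, Fin (m i))
  refine ⟨_, fun j => f (e.symm j).1, fun j => a (e.symm j).1 (e.symm j).2,
    fun j => b (e.symm j).1 (e.symm j).2, ?_⟩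
  rw [Equiv.sum_comp e.symm (fun j : Σ i, Fin (m i) => f j.1 ⊗ₜ[ℂ] (a j.1 j.2 ⊗ₜ[ℂ] b j.1 j.2)),
    Fintype.sum_sigma]
  refine Finset.sum_congr rfl fun i _ => ?_
  conv_lhs => rw [h i]
  rw [TensorProduct.tmul_sum]

theorem relForm_nonneg (x : α.carrier ⊗[ℂ] (E ⊗[ℂ] β.carrier)) : 0 ≤ relForm α β x x := by
  obtain ⟨n, ξ, v, η, rfl⟩ := exists_sum α β x
  have := gram_nonneg v (fun i => (ξ i).1) (fun i => (η i).1)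
    (fun i j k l => commute_comp α β _ _ _ _)
  simp only [map_sum, LinearMap.sum_apply, relForm_tmul]
  simp only [ContinuousLinearMap.adjoint_inner_right] at this
  rw [Finset.sum_comm]
  exact this

/-- The C⋆-relative tensor product `H ⊗ K = α ⊗ E ⊗ β`, that is, the internal tensor product with
the inner product `⟨ξ ⊗ v ⊗ η, ξ' ⊗ v' ⊗ η'⟩ = ⟨v, ξ* ξ' η* η' v'⟩`. -/
def RelTensor : Type _ :=
  HilbertQuotient (V := α.carrier ⊗[ℂ] (E ⊗[ℂ] β.carrier))
    (coreOfForm (relForm α β) (relForm_symm α β) (relForm_nonneg α β))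

noncomputable instance : NormedAddCommGroup (RelTensor α β) :=
  inferInstanceAs (NormedAddCommGroup (HilbertQuotient _))

noncomputable instance : InnerProductSpace ℂ (RelTensor α β) :=
  inferInstanceAs (InnerProductSpace ℂ (HilbertQuotient _))

instance : FiniteDimensional ℂ (RelTensor α β) :=
  inferInstanceAs (FiniteDimensional ℂ (HilbertQuotient _))

instance : CompleteSpace (RelTensor α β) :=
  inferInstanceAs (CompleteSpace (HilbertQuotient _))

/-- The quotient map from the algebraic tensor product. -/
noncomputable def relMk : (α.carrier ⊗[ℂ] (E ⊗[ℂ] β.carrier)) →ₗ[ℂ] RelTensor α β :=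
  HilbertQuotient.mk _

theorem relMk_surjective : Function.Surjective (relMk α β) := HilbertQuotient.mk_surjective _

/-- The image of `ξ ⊗ v ⊗ η` in the C⋆-relative tensor product. -/
noncomputable def tmul (ξ : α.carrier) (v : E) (η : β.carrier) : RelTensor α β :=
  relMk α β (ξ ⊗ₜ (v ⊗ₜ η))

theorem inner_tmul (ξ ξ' : α.carrier) (v v' : E) (η η' : β.carrier) :
    ⟪tmul α β ξ v η, tmul α β ξ' v' η'⟫_ℂ = ⟪ξ.1 v, ξ'.1 (η.1.adjoint (η'.1 v'))⟫_ℂ := rfl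

theorem inner_tmul' (ξ ξ' : α.carrier) (v v' : E) (η η' : β.carrier) :
    ⟪tmul α β ξ v η, tmul α β ξ' v' η'⟫_ℂ = ⟪η.1 v, η'.1 (ξ.1.adjoint (ξ'.1 v'))⟫_ℂ := by
  have h := DFunLike.congr_fun (commute_comp α β ξ ξ' η η') v'
  change ξ.1.adjoint (ξ'.1 (η.1.adjoint (η'.1 v'))) =
        η.1.adjoint (η'.1 (ξ.1.adjoint (ξ'.1 v'))) at h
  rw [inner_tmul, ← ContinuousLinearMap.adjoint_inner_right ξ.1, h,
    ContinuousLinearMap.adjoint_inner_right]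

theorem span_tmul : Submodule.span ℂ
    (Set.range fun p : α.carrier × E × β.carrier => tmul α β p.1 p.2.1 p.2.2) = ⊤ := by
  rw [eq_top_iff]
  intro x _
  obtain ⟨t, rfl⟩ := relMk_surjective α β x
  induction t using tensor_induction with
  | h0 => rw [map_zero]; exact zero_mem _
  | ha u v hu hv => rw [map_add]; exact Submodule.add_mem _ (hu trivial) (hv trivial)
  | ht ξ v η => exact Submodule.subset_span ⟨(ξ, v, η), rfl⟩

theorem exists_ketOne (ξ : α.carrier) : ∃ T : K →L[ℂ] RelTensor α β,
    ∀ p : β.carrier × E, T (p.1.1 p.2) = tmul α β ξ p.2 p.1 := by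
  refine exists_operator _ β.total _ _ (span_tmul α β)
    (fun q => q.2.2.1 (ξ.1.adjoint (q.1.1 q.2.1))) ?_
  rintro ⟨η, v⟩ ⟨ξ', v', η'⟩
  dsimp only
  rw [inner_tmul, ← ContinuousLinearMap.adjoint_inner_left, ← ContinuousLinearMap.adjoint_inner_right η'.1]

theorem exists_ketTwo (η : β.carrier) : ∃ T : H →L[ℂ] RelTensor α β,
    ∀ p : α.carrier × E, T (p.1.1 p.2) = tmul α β p.1 p.2 η := by
  refine exists_operator _ α.total _ _ (span_tmul α β)
    (fun q => q.1.1 (η.1.adjoint (q.2.2.1 q.2.1))) ?_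
  rintro ⟨ξ, v⟩ ⟨ξ', v', η'⟩
  dsimp only
  rw [inner_tmul', ← ContinuousLinearMap.adjoint_inner_left, ← ContinuousLinearMap.adjoint_inner_right ξ'.1]

/-- The operator `|ξ⟩₁ : K → H ⊗ K`, `η v ↦ ξ ⊗ v ⊗ η`. -/
noncomputable def ketOne (ξ : α.carrier) : K →L[ℂ] RelTensor α β := (exists_ketOne α β ξ).choose

/-- The operator `|η⟩₂ : H → H ⊗ K`, `ξ v ↦ ξ ⊗ v ⊗ η`. -/
noncomputable def ketTwo (η : β.carrier) : H →L[ℂ] RelTensor α β := (exists_ketTwo α β η).choose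

theorem ketOne_apply (ξ : α.carrier) (η : β.carrier) (v : E) :
    ketOne α β ξ (η.1 v) = tmul α β ξ v η := (exists_ketOne α β ξ).choose_spec (η, v)

theorem ketTwo_apply (η : β.carrier) (ξ : α.carrier) (v : E) :
    ketTwo α β η (ξ.1 v) = tmul α β ξ v η := (exists_ketTwo α β η).choose_spec (ξ, v)

theorem inner_ext {ι : Type*} {x : ι → H} (hx : Submodule.span ℂ (Set.range x) = ⊤) {u w : H}
    (h : ∀ i, ⟪x i, u⟫_ℂ = ⟪x i, w⟫_ℂ) : u = w := by
  refine ext_inner_left ℂ fun y => ?_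
  have hy : y ∈ Submodule.span ℂ (Set.range x) := by rw [hx]; trivial
  induction hy using Submodule.span_induction with
  | mem w hw => obtain ⟨i, rfl⟩ := hw; exact h i
  | zero => simp
  | add a b _ _ ha hb => rw [inner_add_left, ha, hb, inner_add_left]
  | smul t a _ ha => rw [inner_smul_left, ha, inner_smul_left]

theorem adjoint_ketOne_ketOne (ξ ξ' : α.carrier) :
    (ketOne α β ξ).adjoint ∘L ketOne α β ξ' =
      β.rep ⟨ξ.1.adjoint ∘L ξ'.1, α.adjoint_comp_mem ξ ξ'⟩ := by
  refine β.ext_op fun η v => inner_ext β.total ?_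
  rintro ⟨η', v'⟩
  dsimp only
  rw [rep_apply, ContinuousLinearMap.comp_apply, ContinuousLinearMap.adjoint_inner_right,
    ketOne_apply, ketOne_apply, inner_tmul']
  rfl

theorem adjoint_ketTwo_ketTwo (η η' : β.carrier) :
    (ketTwo α β η).adjoint ∘L ketTwo α β η' =
      α.rep ⟨η.1.adjoint ∘L η'.1, β.adjoint_comp_mem η η'⟩ := by
  refine α.ext_op fun ξ v => inner_ext α.total ?_
  rintro ⟨ξ', v'⟩
  dsimp only
  rw [rep_apply, ContinuousLinearMap.comp_apply, ContinuousLinearMap.adjoint_inner_right,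
    ketTwo_apply, ketTwo_apply, inner_tmul]
  rfl

theorem tmul_add_left (ξ ξ' : α.carrier) (v : E) (η : β.carrier) :
    tmul α β (ξ + ξ') v η = tmul α β ξ v η + tmul α β ξ' v η := by
  simp only [tmul, TensorProduct.add_tmul, map_add]

theorem tmul_smul_left (r : ℂ) (ξ : α.carrier) (v : E) (η : β.carrier) :
    tmul α β (r • ξ) v η = r • tmul α β ξ v η := by
  simp only [tmul, ← TensorProduct.smul_tmul', map_smul]

theorem tmul_add_right (ξ : α.carrier) (v : E) (η η' : β.carrier) :
    tmul α β ξ v (η + η') = tmul α β ξ v η + tmul α β ξ v η' := by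
  simp only [tmul, TensorProduct.tmul_add, map_add]

theorem tmul_smul_right (r : ℂ) (ξ : α.carrier) (v : E) (η : β.carrier) :
    tmul α β ξ v (r • η) = r • tmul α β ξ v η := by
  simp only [tmul, TensorProduct.tmul_smul, map_smul]

/-- The linear map `ξ ↦ |ξ⟩₁`. -/
noncomputable def ketOneLin : α.carrier →ₗ[ℂ] (K →L[ℂ] RelTensor α β) where
  toFun := ketOne α β
  map_add' ξ ξ' := β.ext_op fun η v => by
    rw [add_apply, ketOne_apply, ketOne_apply, ketOne_apply, tmul_add_left]
  map_smul' r ξ := β.ext_op fun η v => by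
    change _ = r • ketOne α β ξ (η.1 v)
    rw [ketOne_apply, ketOne_apply, tmul_smul_left]

/-- The linear map `η ↦ |η⟩₂`. -/
noncomputable def ketTwoLin : β.carrier →ₗ[ℂ] (H →L[ℂ] RelTensor α β) where
  toFun := ketTwo α β
  map_add' ξ ξ' := α.ext_op fun η v => by
    rw [add_apply, ketTwo_apply, ketTwo_apply, ketTwo_apply, tmul_add_right]
  map_smul' r ξ := α.ext_op fun η v => by
    change _ = r • ketTwo α β ξ (η.1 v)
    rw [ketTwo_apply, ketTwo_apply, tmul_smul_right]

theorem span_ketOne : Submodule.span ℂ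
    (Set.range fun p : α.carrier × K => ketOne α β p.1 p.2) = ⊤ := by
  rw [eq_top_iff, ← span_tmul α β, Submodule.span_le]
  rintro _ ⟨⟨ξ, v, η⟩, rfl⟩
  exact Submodule.subset_span ⟨(ξ, η.1 v), ketOne_apply α β ξ η v⟩

theorem span_ketTwo : Submodule.span ℂ
    (Set.range fun p : β.carrier × H => ketTwo α β p.1 p.2) = ⊤ := by
  rw [eq_top_iff, ← span_tmul α β, Submodule.span_le]
  rintro _ ⟨⟨ξ, v, η⟩, rfl⟩
  exact Submodule.subset_span ⟨(η, ξ.1 v), ketTwo_apply α β η ξ v⟩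

end

end CStarFact

end HopfBimodule

namespace HopfBimodule

namespace CStarFact

set_option linter.unusedSectionVars false

section Ket

/-! ### Spaces of the form `[|ξ⟩ γ]` and C⋆-algebras that stabilize spaces `[|ξ⟩ B]` -/

variable {E F : Type*} [NormedAddCommGroup E] [InnerProductSpace ℂ E] [CompleteSpace E]
  [FiniteDimensional ℂ E]
  [NormedAddCommGroup F] [InnerProductSpace ℂ F] [CompleteSpace F]
  [FiniteDimensional ℂ F] {P : CStarBase E} {C : CStarBase F}
  {H K X : Type*}
  [NormedAddCommGroup H] [InnerProductSpace ℂ H] [CompleteSpace H] [FiniteDimensional ℂ H]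
  [NormedAddCommGroup K] [InnerProductSpace ℂ K] [CompleteSpace K] [FiniteDimensional ℂ K]
  [NormedAddCommGroup X] [InnerProductSpace ℂ X] [CompleteSpace X] [FiniteDimensional ℂ X]
  (a : CStarFact P H) (k : a.carrier →ₗ[ℂ] (K →L[ℂ] X))

/-- The space `[|ξ⟩ V]` of operators, where `ξ` runs through `a`. -/
def ketSpan (V : Submodule ℂ (F →L[ℂ] K)) : Submodule ℂ (F →L[ℂ] X) :=
  Submodule.span ℂ {T | ∃ ξ : a.carrier, ∃ θ ∈ V, T = k ξ ∘L θ}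

theorem mem_ketSpan {V : Submodule ℂ (F →L[ℂ] K)} (ξ : a.carrier) {θ : F →L[ℂ] K} (hθ : θ ∈ V) :
    k ξ ∘L θ ∈ a.ketSpan k V := Submodule.subset_span ⟨ξ, θ, hθ, rfl⟩

theorem ketSpan_comp {V : Submodule ℂ (F →L[ℂ] K)} {b : F →L[ℂ] F}
    (hb : ∀ θ ∈ V, θ ∘L b ∈ V) {T : F →L[ℂ] X} (hT : T ∈ a.ketSpan k V) :
    T ∘L b ∈ a.ketSpan k V := by
  induction hT using Submodule.span_induction with
  | mem T hT =>
    obtain ⟨ξ, θ, hθ, rfl⟩ := hT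
    exact a.mem_ketSpan k ξ (hb θ hθ)
  | zero => rw [ContinuousLinearMap.zero_comp]; exact zero_mem _
  | add S T _ _ hS hT => rw [ContinuousLinearMap.add_comp]; exact add_mem hS hT
  | smul t T _ hT => rw [ContinuousLinearMap.smul_comp]; exact Submodule.smul_mem _ _ hT

/-- The operators `T` such that `T |ξ⟩, T* |ξ⟩ ∈ [|a⟩ B]` for all `ξ ∈ a`. -/
def ketStabilizer (B : StarSubalgebra ℂ (K →L[ℂ] K)) : StarSubalgebra ℂ (X →L[ℂ] X) :=
  have hmul : ∀ S T : X →L[ℂ] X,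
      (∀ ξ, S ∘L k ξ ∈ a.ketSpan k (Subalgebra.toSubmodule B.toSubalgebra)) →
      (∀ ξ, T ∘L k ξ ∈ a.ketSpan k (Subalgebra.toSubmodule B.toSubalgebra)) →
      ∀ ξ, (S ∘L T) ∘L k ξ ∈ a.ketSpan k (Subalgebra.toSubmodule B.toSubalgebra) := by
    intro S T hS hT ξ
    rw [ContinuousLinearMap.comp_assoc]
    have h := hT ξ
    generalize T ∘L k ξ = R at h
    induction h using Submodule.span_induction with
    | mem R hR =>
      obtain ⟨ξ', b, hb, rfl⟩ := hR
      rw [← ContinuousLinearMap.comp_assoc]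
      exact a.ketSpan_comp k (fun θ hθ => mul_mem (S := StarSubalgebra ℂ (K →L[ℂ] K)) (s := B) hθ hb)
        (hS ξ')
    | zero => rw [ContinuousLinearMap.comp_zero]; exact zero_mem _
    | add R R' _ _ h h' => rw [ContinuousLinearMap.comp_add]; exact add_mem h h'
    | smul t R _ h => rw [ContinuousLinearMap.comp_smul]; exact Submodule.smul_mem _ _ h
  have halg : ∀ (r : ℂ) ξ, (algebraMap ℂ (X →L[ℂ] X) r) ∘L k ξ ∈
      a.ketSpan k (Subalgebra.toSubmodule B.toSubalgebra) := by
    intro r ξ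
    have : (algebraMap ℂ (X →L[ℂ] X) r) ∘L k ξ = r • (k ξ ∘L (1 : K →L[ℂ] K)) := by
      rw [Algebra.algebraMap_eq_smul_one]; rfl
    rw [this]
    exact Submodule.smul_mem _ _ (a.mem_ketSpan k ξ (one_mem B))
  { carrier := {T | ∀ ξ, T ∘L k ξ ∈ a.ketSpan k (Subalgebra.toSubmodule B.toSubalgebra) ∧
      T.adjoint ∘L k ξ ∈ a.ketSpan k (Subalgebra.toSubmodule B.toSubalgebra)}
    mul_mem' := fun {S T} hS hT ξ => ⟨hmul S T (fun ξ => (hS ξ).1) (fun ξ => (hT ξ).1) ξ, by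
      change (S ∘L T).adjoint ∘L _ ∈ _
      rw [ContinuousLinearMap.adjoint_comp]
      exact hmul _ _ (fun ξ => (hT ξ).2) (fun ξ => (hS ξ).2) ξ⟩
    add_mem' := fun {S T} hS hT ξ => ⟨by
      rw [ContinuousLinearMap.add_comp]; exact add_mem (hS ξ).1 (hT ξ).1, by
      rw [map_add, ContinuousLinearMap.add_comp]; exact add_mem (hS ξ).2 (hT ξ).2⟩
    algebraMap_mem' := fun r ξ => ⟨halg r ξ, by
      rw [← ContinuousLinearMap.star_eq_adjoint, ← algebraMap_star_comm]
      exact halg _ ξ⟩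
    star_mem' := fun {T} hT ξ => ⟨(hT ξ).2, by
      change T.adjoint.adjoint ∘L _ ∈ _
      rw [ContinuousLinearMap.adjoint_adjoint]
      exact (hT ξ).1⟩ }

theorem mem_ketStabilizer {B : StarSubalgebra ℂ (K →L[ℂ] K)} {T : X →L[ℂ] X} :
    T ∈ a.ketStabilizer k B ↔
      ∀ ξ, T ∘L k ξ ∈ a.ketSpan k (Subalgebra.toSubmodule B.toSubalgebra) ∧
        T.adjoint ∘L k ξ ∈ a.ketSpan k (Subalgebra.toSubmodule B.toSubalgebra) := Iff.rfl

theorem alg_induction {W : Type*} [AddCommGroup W] [Module ℂ W] (f : P.alg →ₗ[ℂ] W)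
    (S : Submodule ℂ W)
    (h : ∀ ξ ξ' : a.carrier, f ⟨ξ.1.adjoint ∘L ξ'.1, a.adjoint_comp_mem ξ ξ'⟩ ∈ S)
    (b : P.alg) : f b ∈ S := by
  obtain ⟨b, hb⟩ := b
  have hb' : b ∈ Submodule.span ℂ {T : E →L[ℂ] E | ∃ ξ ∈ a.carrier, ∃ ξ' ∈ a.carrier,
      T = ξ.adjoint ∘L ξ'} := by rw [a.span_adjoint_comp]; exact hb
  suffices hh : ∃ hb : b ∈ P.alg, f ⟨b, hb⟩ ∈ S from hh.choose_spec
  clear hb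
  induction hb' using Submodule.span_induction with
  | mem b hb =>
    obtain ⟨ξ, hξ, ξ', hξ', rfl⟩ := hb
    exact ⟨_, h ⟨ξ, hξ⟩ ⟨ξ', hξ'⟩⟩
  | zero => exact ⟨zero_mem _, by rw [show (⟨0, zero_mem _⟩ : P.alg) = 0 from rfl, map_zero]; exact zero_mem _⟩
  | add x y _ _ hx hy =>
    obtain ⟨h1, h2⟩ := hx
    obtain ⟨h3, h4⟩ := hy
    refine ⟨add_mem h1 h3, ?_⟩
    rw [show (⟨x + y, add_mem h1 h3⟩ : P.alg) = ⟨x, h1⟩ + ⟨y, h3⟩ from rfl, map_add]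
    exact add_mem h2 h4
  | smul t x _ hx =>
    obtain ⟨h1, h2⟩ := hx
    refine ⟨SMulMemClass.smul_mem t h1, ?_⟩
    rw [show (⟨t • x, SMulMemClass.smul_mem t h1⟩ : P.alg) = t • ⟨x, h1⟩ from rfl, map_smul]
    exact Submodule.smul_mem _ _ h2

theorem ketSpan_adjoint_comp (r : P.alg →⋆ₐ[ℂ] (K →L[ℂ] K))
    (hk : ∀ ξ ξ' : a.carrier, (k ξ).adjoint ∘L k ξ' =
      r ⟨ξ.1.adjoint ∘L ξ'.1, a.adjoint_comp_mem ξ ξ'⟩)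
    (γ : CStarFact C K) (hγ : ∀ b, ∀ θ ∈ γ.carrier, r b ∘L θ ∈ γ.carrier) :
    Submodule.span ℂ {T : F →L[ℂ] F |
    ∃ ξ ∈ a.ketSpan k γ.carrier, ∃ ξ' ∈ a.ketSpan k γ.carrier, T = ξ.adjoint ∘L ξ'} =
      Subalgebra.toSubmodule C.alg.toSubalgebra := by
  refine le_antisymm (Submodule.span_le.2 ?_) ?_
  · rintro _ ⟨S, hS, T, hT, rfl⟩
    induction hT using Submodule.span_induction with
    | mem T hT =>
      obtain ⟨ξ', θ', hθ', rfl⟩ := hT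
      induction hS using Submodule.span_induction with
      | mem S hS =>
        obtain ⟨ξ, θ, hθ, rfl⟩ := hS
        rw [ContinuousLinearMap.adjoint_comp, ContinuousLinearMap.comp_assoc,
          ← ContinuousLinearMap.comp_assoc (k ξ).adjoint, hk]
        exact γ.adjoint_comp_mem ⟨θ, hθ⟩ ⟨_, hγ _ θ' hθ'⟩
      | zero => rw [map_zero, ContinuousLinearMap.zero_comp]; exact zero_mem _
      | add S T _ _ hS hT => rw [map_add, ContinuousLinearMap.add_comp]; exact add_mem hS hT
      | smul t T _ hT =>
        rw [LinearIsometryEquiv.map_smulₛₗ, ContinuousLinearMap.smul_comp]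
        exact Submodule.smul_mem _ _ hT
    | zero => rw [ContinuousLinearMap.comp_zero]; exact zero_mem _
    | add S T _ _ hS hT => rw [ContinuousLinearMap.comp_add]; exact add_mem hS hT
    | smul t T _ hT =>
      rw [ContinuousLinearMap.comp_smul]
      exact Submodule.smul_mem _ _ hT
  · rw [← γ.span_adjoint_comp, Submodule.span_le]
    rintro _ ⟨θ, hθ, θ', hθ', rfl⟩
    have := a.alg_induction
      ({ toFun := fun b => θ.adjoint ∘L (r b ∘L θ')
         map_add' := fun b b' => by
           rw [map_add, ContinuousLinearMap.add_comp, ContinuousLinearMap.comp_add]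
         map_smul' := fun t b => by
           rw [map_smul, ContinuousLinearMap.smul_comp, ContinuousLinearMap.comp_smul]
           rfl } : P.alg →ₗ[ℂ] (F →L[ℂ] F))
      (Submodule.span ℂ {T : F →L[ℂ] F |
        ∃ ξ ∈ a.ketSpan k γ.carrier, ∃ ξ' ∈ a.ketSpan k γ.carrier, T = ξ.adjoint ∘L ξ'}) ?_ 1
    · have h1 : θ.adjoint ∘L (r 1 ∘L θ') = θ.adjoint ∘L θ' := by rw [map_one]; rfl
      rw [← h1]
      exact this
    · intro ξ ξ'
      change θ.adjoint ∘L (r _ ∘L θ') ∈ _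
      rw [← hk, ContinuousLinearMap.comp_assoc, ← ContinuousLinearMap.comp_assoc,
        ← ContinuousLinearMap.adjoint_comp]
      exact Submodule.subset_span ⟨_, a.mem_ketSpan k ξ hθ, _, a.mem_ketSpan k ξ' hθ', rfl⟩

/-- The C⋆-factorization `[|a⟩ γ]`. -/
def ketFact (r : P.alg →⋆ₐ[ℂ] (K →L[ℂ] K))
    (hk : ∀ ξ ξ' : a.carrier, (k ξ).adjoint ∘L k ξ' =
      r ⟨ξ.1.adjoint ∘L ξ'.1, a.adjoint_comp_mem ξ ξ'⟩)
    (hs : Submodule.span ℂ (Set.range fun p : a.carrier × K => k p.1 p.2) = ⊤)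
    (γ : CStarFact C K) (hγ : ∀ b, ∀ θ ∈ γ.carrier, r b ∘L θ ∈ γ.carrier) :
    CStarFact C X where
  carrier := a.ketSpan k γ.carrier
  span_adjoint_comp := a.ketSpan_adjoint_comp k r hk γ hγ
  span_comp := by
    refine le_antisymm (Submodule.span_le.2 ?_) ?_
    · rintro _ ⟨T, hT, b, hb, rfl⟩
      exact a.ketSpan_comp k (fun θ hθ => γ.comp_mem ⟨θ, hθ⟩ hb) hT
    · intro T hT
      exact Submodule.subset_span ⟨T, hT, 1, one_mem _, rfl⟩
  span_apply := by
    rw [eq_top_iff, ← hs, Submodule.span_le]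
    rintro _ ⟨⟨ξ, x⟩, rfl⟩
    have hx : x ∈ Submodule.span ℂ (Set.range fun p : γ.carrier × F => p.1.1 p.2) := by
      rw [γ.total]; trivial
    dsimp only
    induction hx using Submodule.span_induction with
    | mem x hx =>
      obtain ⟨⟨θ, v⟩, rfl⟩ := hx
      exact Submodule.subset_span ⟨_, a.mem_ketSpan k ξ θ.2, v, rfl⟩
    | zero => rw [map_zero]; exact zero_mem _
    | add x y _ _ hx hy => rw [map_add]; exact add_mem hx hy
    | smul t x _ hx => rw [map_smul]; exact Submodule.smul_mem _ _ hx

theorem ketFact_rep (r : P.alg →⋆ₐ[ℂ] (K →L[ℂ] K))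
    (hk : ∀ ξ ξ' : a.carrier, (k ξ).adjoint ∘L k ξ' =
      r ⟨ξ.1.adjoint ∘L ξ'.1, a.adjoint_comp_mem ξ ξ'⟩)
    (hs : Submodule.span ℂ (Set.range fun p : a.carrier × K => k p.1 p.2) = ⊤)
    (γ : CStarFact C K) (hγ : ∀ b, ∀ θ ∈ γ.carrier, r b ∘L θ ∈ γ.carrier)
    (c : C.dag) (ξ : a.carrier) (x : K) :
    (a.ketFact k r hk hs γ hγ).rep c (k ξ x) = k ξ (γ.rep c x) := by
  refine DFunLike.congr_fun (f := (a.ketFact k r hk hs γ hγ).rep c ∘L k ξ) (g := k ξ ∘L γ.rep c)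
    (γ.ext_op fun θ v => ?_) x
  change (a.ketFact k r hk hs γ hγ).rep c ((k ξ ∘L θ.1) v) = k ξ (γ.rep c (θ.1 v))
  rw [rep_apply]
  exact (a.ketFact k r hk hs γ hγ).rep_apply c ⟨_, a.mem_ketSpan k ξ θ.2⟩ v

end Ket

end CStarFact

end HopfBimodule

namespace HopfBimodule

namespace CStarFact

set_option linter.unusedSectionVars false

section

variable {E F : Type*} [NormedAddCommGroup E] [InnerProductSpace ℂ E] [CompleteSpace E]
  [FiniteDimensional ℂ E]
  [NormedAddCommGroup F] [InnerProductSpace ℂ F] [CompleteSpace F]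
  [FiniteDimensional ℂ F] {B : CStarBase E} {C : CStarBase F}
  {H K H' K' M : Type*}
  [NormedAddCommGroup H] [InnerProductSpace ℂ H] [CompleteSpace H] [FiniteDimensional ℂ H]
  [NormedAddCommGroup K] [InnerProductSpace ℂ K] [CompleteSpace K] [FiniteDimensional ℂ K]
  [NormedAddCommGroup H'] [InnerProductSpace ℂ H'] [CompleteSpace H'] [FiniteDimensional ℂ H']
  [NormedAddCommGroup K'] [InnerProductSpace ℂ K'] [CompleteSpace K'] [FiniteDimensional ℂ K']
  [NormedAddCommGroup M] [InnerProductSpace ℂ M] [CompleteSpace M] [FiniteDimensional ℂ M]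
  {α : CStarFact B H} {β : CStarFact B.op K} {α' : CStarFact B H'} {β' : CStarFact B.op K'}

variable (α β) in
/-- The spatial C⋆-fibre product of the C⋆-algebras `A₁ ⊆ 𝓛(H)` and `A₂ ⊆ 𝓛(K)`: all operators `T`
such that `T|α⟩₁, T*|α⟩₁ ⊆ [|α⟩₁ A₂]` and `T|β⟩₂, T*|β⟩₂ ⊆ [|β⟩₂ A₁]`. -/
noncomputable def fibre (A₁ : StarSubalgebra ℂ (H →L[ℂ] H)) (A₂ : StarSubalgebra ℂ (K →L[ℂ] K)) :
    StarSubalgebra ℂ (RelTensor α β →L[ℂ] RelTensor α β) :=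
  α.ketStabilizer (ketOneLin α β) A₂ ⊓ β.ketStabilizer (ketTwoLin α β) A₁

/-- The operator `X` satisfies `X α ⊆ β` and `X* β ⊆ α`. -/
def Preserves (α : CStarFact B H) (β : CStarFact B H') (X : H →L[ℂ] H') : Prop :=
  (∀ ξ ∈ α.carrier, X ∘L ξ ∈ β.carrier) ∧ ∀ η ∈ β.carrier, X.adjoint ∘L η ∈ α.carrier

theorem exists_map {X : H →L[ℂ] H'} {Y : K →L[ℂ] K'} (hX : Preserves α α' X)
    (hY : Preserves β β' Y) : ∃ T : RelTensor α β →L[ℂ] RelTensor α' β',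
      ∀ p : α.carrier × E × β.carrier, T (tmul α β p.1 p.2.1 p.2.2) =
        tmul α' β' ⟨X ∘L p.1.1, hX.1 _ p.1.2⟩ p.2.1 ⟨Y ∘L p.2.2.1, hY.1 _ p.2.2.2⟩ := by
  refine exists_operator _ (span_tmul α β) _ _ (span_tmul α' β')
    (fun q => tmul α β ⟨X.adjoint ∘L q.1.1, hX.2 _ q.1.2⟩ q.2.1
      ⟨Y.adjoint ∘L q.2.2.1, hY.2 _ q.2.2.2⟩) ?_
  rintro ⟨ξ, v, η⟩ ⟨ξ', v', η'⟩
  rw [inner_tmul, inner_tmul]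
  simp only [ContinuousLinearMap.adjoint_comp, ContinuousLinearMap.adjoint_adjoint,
    ContinuousLinearMap.comp_apply, ContinuousLinearMap.adjoint_inner_left]

/-- The operator `X ⊗ Y : ξ ⊗ v ⊗ η ↦ X ξ ⊗ v ⊗ Y η` between C⋆-relative tensor products. -/
noncomputable def map {X : H →L[ℂ] H'} {Y : K →L[ℂ] K'} (hX : Preserves α α' X)
    (hY : Preserves β β' Y) : RelTensor α β →L[ℂ] RelTensor α' β' :=
  (exists_map hX hY).choose

theorem map_tmul {X : H →L[ℂ] H'} {Y : K →L[ℂ] K'} (hX : Preserves α α' X)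
    (hY : Preserves β β' Y) (ξ : α.carrier) (v : E) (η : β.carrier) :
    map hX hY (tmul α β ξ v η) =
      tmul α' β' ⟨X ∘L ξ.1, hX.1 _ ξ.2⟩ v ⟨Y ∘L η.1, hY.1 _ η.2⟩ :=
  (exists_map hX hY).choose_spec (ξ, v, η)

/-- `Γ` is the fibre product `φ * ψ` of the morphisms `φ` and `ψ`: it satisfies
`Γ(S) (X ⊗ Y) = (X ⊗ Y) S` for all `X ∈ 𝓛^φ(H, H')` and `Y ∈ 𝓛^ψ(K, K')` for which `X ⊗ Y` is
defined. If `φ` and `ψ` are morphisms with respect to the given C⋆-factorizations (and the C⋆-base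
has a bicyclic vector), then this applies to all `X ∈ 𝓛^φ(H, H')` and `Y ∈ 𝓛^ψ(K, K')`, and `Γ`
exists and is unique. -/
def IsFibreMap {A₁ : StarSubalgebra ℂ (H →L[ℂ] H)} {A₂ : StarSubalgebra ℂ (K →L[ℂ] K)}
    {C₁ : StarSubalgebra ℂ (H' →L[ℂ] H')} {C₂ : StarSubalgebra ℂ (K' →L[ℂ] K')}
    (φ : OpHom A₁ C₁) (ψ : OpHom A₂ C₂) (Γ : OpHom (fibre α β A₁ A₂) (fibre α' β' C₁ C₂)) :
    Prop :=
  ∀ (X : H →L[ℂ] H') (Y : K →L[ℂ] K')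
    (_ : ∀ a : A₁, X ∘L a.1 = φ.op a ∘L X) (_ : ∀ b : A₂, Y ∘L b.1 = ψ.op b ∘L Y)
    (hX : Preserves α α' X) (hY : Preserves β β' Y) (S : fibre α β A₁ A₂),
    Γ.op S ∘L map hX hY = map hX hY ∘L S.1

/-- `π` is a morphism from `A_α` to `C_γ`: one has `γ = [I_π α]`, where `I_π` is the space of all
operators `V` such that `V a = π(a) V` for all `a ∈ A`, and `V α ⊆ γ`, `V* γ ⊆ α`. -/
def IsMorphism (A : StarSubalgebra ℂ (H →L[ℂ] H)) (α : CStarFact B H)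
    (A' : StarSubalgebra ℂ (H' →L[ℂ] H')) (γ : CStarFact B H') (π : OpHom A A') : Prop :=
  γ.carrier = Submodule.span ℂ {T : E →L[ℂ] H' | ∃ V : H →L[ℂ] H',
    (∀ a : A, V ∘L a.1 = π.op a ∘L V) ∧ Preserves α γ V ∧ ∃ ξ ∈ α.carrier, T = V ∘L ξ}

/-- The C⋆-factorization `α ▷ γ = [|α⟩₁ γ]` of `H ⊗ K`. -/
noncomputable def triRight (α : CStarFact B H) (β : CStarFact B.op K) (γ : CStarFact C K)
    (h : Compatible β γ) : CStarFact C (RelTensor α β) :=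
  α.ketFact (ketOneLin α β) β.rep (adjoint_ketOne_ketOne α β) (span_ketOne α β) γ
    (fun b θ hθ => h.rep_comp_mem b ⟨θ, hθ⟩)

/-- The C⋆-factorization `δ ◁ β = [|β⟩₂ δ]` of `H ⊗ K`. -/
noncomputable def triLeft (α : CStarFact B H) (β : CStarFact B.op K) (δ : CStarFact C H)
    (h : Compatible α δ) : CStarFact C (RelTensor α β) :=
  β.ketFact (ketTwoLin α β) α.rep (adjoint_ketTwo_ketTwo α β) (span_ketTwo α β) δ
    (fun b θ hθ => h.rep_comp_mem b ⟨θ, hθ⟩)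

theorem triRight_rep (γ : CStarFact C K) (h : Compatible β γ) (c : C.dag) (ξ : α.carrier) (x : K) :
    (triRight α β γ h).rep c (ketOne α β ξ x) = ketOne α β ξ (γ.rep c x) :=
  α.ketFact_rep (ketOneLin α β) β.rep (adjoint_ketOne_ketOne α β) (span_ketOne α β) γ
    (fun b θ hθ => h.rep_comp_mem b ⟨θ, hθ⟩) c ξ x

theorem triLeft_rep (δ : CStarFact C H) (h : Compatible α δ) (c : C.dag) (η : β.carrier) (x : H) :
    (triLeft α β δ h).rep c (ketTwo α β η x) = ketTwo α β η (δ.rep c x) :=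
  β.ketFact_rep (ketTwoLin α β) α.rep (adjoint_ketTwo_ketTwo α β) (span_ketTwo α β) δ
    (fun b θ hθ => h.rep_comp_mem b ⟨θ, hθ⟩) c η x

/-! #### Associativity -/

theorem span_comp_apply {ι κ V W : Type*} [NormedAddCommGroup V] [InnerProductSpace ℂ V]
    [NormedAddCommGroup W] [InnerProductSpace ℂ W] {x : κ → V}
    (hx : Submodule.span ℂ (Set.range x) = ⊤) {k : ι → (V →L[ℂ] W)}
    (hk : Submodule.span ℂ (Set.range fun p : ι × V => k p.1 p.2) = ⊤) :
    Submodule.span ℂ (Set.range fun p : ι × κ => k p.1 (x p.2)) = ⊤ := by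
  rw [eq_top_iff, ← hk, Submodule.span_le]
  rintro _ ⟨⟨i, v⟩, rfl⟩
  have hv : v ∈ Submodule.span ℂ (Set.range x) := by rw [hx]; trivial
  dsimp only
  induction hv using Submodule.span_induction with
  | mem v hv => obtain ⟨j, rfl⟩ := hv; exact Submodule.subset_span ⟨(i, j), rfl⟩
  | zero => rw [map_zero]; exact zero_mem _
  | add x y _ _ hx hy => rw [map_add]; exact add_mem hx hy
  | smul t x _ hx => rw [map_smul]; exact Submodule.smul_mem _ _ hx

theorem inner_ketOne (ξ ξ' : α.carrier) (x x' : K) :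
    ⟪ketOne α β ξ x, ketOne α β ξ' x'⟫_ℂ =
      ⟪x, β.rep ⟨ξ.1.adjoint ∘L ξ'.1, α.adjoint_comp_mem ξ ξ'⟩ x'⟫_ℂ := by
  rw [← ContinuousLinearMap.adjoint_inner_right, ← adjoint_ketOne_ketOne]
  rfl

theorem inner_ketTwo (η η' : β.carrier) (x x' : H) :
    ⟪ketTwo α β η x, ketTwo α β η' x'⟫_ℂ =
      ⟪x, α.rep ⟨η.1.adjoint ∘L η'.1, β.adjoint_comp_mem η η'⟩ x'⟫_ℂ := by
  rw [← ContinuousLinearMap.adjoint_inner_right, ← adjoint_ketTwo_ketTwo]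
  rfl

theorem exists_assoc (α : CStarFact B H) (β : CStarFact B.op K) (γ : CStarFact C K)
    (δ : CStarFact C.op M) (h : Compatible β γ) :
    ∃ W : RelTensor (triRight α β γ h) δ ≃ₗᵢ[ℂ] RelTensor α (triLeft γ δ β h.symm),
      ∀ p : δ.carrier × α.carrier × K,
        W (ketTwo (triRight α β γ h) δ p.1 (ketOne α β p.2.1 p.2.2)) =
          ketOne α (triLeft γ δ β h.symm) p.2.1 (ketTwo γ δ p.1 p.2.2) := by
  refine exists_unitary _ (span_comp_apply (span_ketOne α β) (span_ketTwo (triRight α β γ h) δ))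
    _ ?_ ?_
  · have := span_comp_apply (span_ketTwo γ δ) (span_ketOne α (triLeft γ δ β h.symm))
    rw [eq_top_iff, ← this]
    refine Submodule.span_mono ?_
    rintro _ ⟨⟨ξ, η, x⟩, rfl⟩
    exact ⟨(η, ξ, x), rfl⟩
  · rintro ⟨η, ξ, x⟩ ⟨η', ξ', x'⟩
    dsimp only
    rw [inner_ketTwo, triRight_rep, inner_ketOne, inner_ketOne, triLeft_rep, inner_ketTwo,
      h.rep_rep]

/-- The associativity isomorphism of C⋆-relative tensor products, which identifies
`|η⟩ |ξ⟩ x` with `|ξ⟩ |η⟩ x` for `ξ ∈ α`, `η ∈ δ`, `x ∈ K`. -/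
noncomputable def assoc (α : CStarFact B H) (β : CStarFact B.op K) (γ : CStarFact C K)
    (δ : CStarFact C.op M) (h : Compatible β γ) :
    RelTensor (triRight α β γ h) δ ≃ₗᵢ[ℂ] RelTensor α (triLeft γ δ β h.symm) :=
  (exists_assoc α β γ δ h).choose

theorem assoc_apply (α : CStarFact B H) (β : CStarFact B.op K) (γ : CStarFact C K)
    (δ : CStarFact C.op M) (h : Compatible β γ) (η : δ.carrier) (ξ : α.carrier) (x : K) :
    assoc α β γ δ h (ketTwo (triRight α β γ h) δ η (ketOne α β ξ x)) =
      ketOne α (triLeft γ δ β h.symm) ξ (ketTwo γ δ η x) :=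
  (exists_assoc α β γ δ h).choose_spec (η, ξ, x)

/-- `((E, 𝔅, 𝔅†), H, A, α, β, Δ)` is a finite-dimensional concrete Hopf C⋆-bimodule. Here
`A ⊆ 𝓛(H)` is a C⋆-algebra and `α`, `β` are compatible C⋆-factorizations of `H` with
`ρ_α(𝔅†) ⊆ A` and `ρ_β(𝔅) ⊆ A`. -/
structure IsConcreteHopfCStarBimodule (A : StarSubalgebra ℂ (H →L[ℂ] H)) (α : CStarFact B H)
    (β : CStarFact B.op H) (h : Compatible α β) (Δ : OpHom A (fibre α β A A)) : Prop where
  /-- `Δ` is a morphism from `A_α` to `(A * A)_{α ▷ α}` -/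
  morphism_left : IsMorphism A α (fibre α β A A) (triRight α β α h.symm) Δ
  /-- `Δ` is a morphism from `A_β` to `(A * A)_{β ◁ β}` -/
  morphism_right : IsMorphism A β (fibre α β A A) (triLeft α β β h) Δ
  /-- `(Δ * id) ∘ Δ = (id * Δ) ∘ Δ`, up to the associativity isomorphism of the threefold
  C⋆-relative tensor product -/
  coassoc : ∃ (Γ₁ : OpHom (fibre α β A A) (fibre (triRight α β α h.symm) β (fibre α β A A) A))
      (Γ₂ : OpHom (fibre α β A A) (fibre α (triLeft α β β h) A (fibre α β A A))),
      IsFibreMap Δ (OpHom.id A) Γ₁ ∧ IsFibreMap (OpHom.id A) Δ Γ₂ ∧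
      ∀ (a : A) (w : RelTensor (triRight α β α h.symm) β),
        assoc α β α β h.symm (Γ₁.op (Δ a) w) = Γ₂.op (Δ a) (assoc α β α β h.symm w)

end

end CStarFact

end HopfBimodule

namespace HopfBimodule

/-! ### The comparison of the two relative tensor products -/

set_option linter.unusedSectionVars false

section

variable {N : Type*} [CStarAlgebra N] [FiniteDimensional ℂ N] {μ : FaithfulState N}
  {L : Type*} [NormedAddCommGroup L] [InnerProductSpace ℂ L] [CompleteSpace L]
  [FiniteDimensional ℂ L] {G : GNS μ L}
  {E : Type*} [NormedAddCommGroup E] [InnerProductSpace ℂ E] [CompleteSpace E]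
  [FiniteDimensional ℂ E] {B : CStarBase E} {ζ : E}
  {H K : Type*}
  [NormedAddCommGroup H] [InnerProductSpace ℂ H] [CompleteSpace H] [FiniteDimensional ℂ H]
  [NormedAddCommGroup K] [InnerProductSpace ℂ K] [CompleteSpace K] [FiniteDimensional ℂ K]
  {ρ : Nᵐᵒᵖ →⋆ₐ[ℂ] (H →L[ℂ] H)} {σ : N →⋆ₐ[ℂ] (K →L[ℂ] K)}
  {α : CStarFact B H} {β : CStarFact B.op K} {U : E ≃ₗᵢ[ℂ] L}

variable (G B ζ ρ σ α β U) in
/-- The unitary `U : E → H_μ` identifies `(E, 𝔅, 𝔅†)` and `ζ` with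
`(H_μ, π_μ(N), π_μ^op(N^op))` and `ζ_μ` in such a way that `ρ = ρ_α ∘ Ad_{U*} ∘ π_μ^op` and
`σ = ρ_β ∘ Ad_{U*} ∘ π_μ`. -/
structure IsIdentification : Prop where
  /-- `Ad_U(𝔅) = π_μ(N)` -/
  map_alg : U.conjStarAlgEquiv '' (B.alg : Set (E →L[ℂ] E)) = Set.range G.π
  /-- `Ad_U(𝔅†) = π_μ^op(N^op)` -/
  map_dag : U.conjStarAlgEquiv '' (B.dag : Set (E →L[ℂ] E)) = Set.range G.πop
  map_ζ : U ζ = G.ζ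
  ρ_eq : ∀ (x : Nᵐᵒᵖ) (h : U.symm.conjStarAlgEquiv (G.πop x) ∈ B.dag),
    ρ x = α.rep ⟨U.symm.conjStarAlgEquiv (G.πop x), h⟩
  σ_eq : ∀ (y : N) (h : U.symm.conjStarAlgEquiv (G.π y) ∈ B.alg),
    σ y = β.rep ⟨U.symm.conjStarAlgEquiv (G.π y), h⟩

namespace IsIdentification

theorem exists_dag (I : IsIdentification G B ζ ρ σ α β U) (b : B.dag) :
    ∃ x : Nᵐᵒᵖ, (∀ v, U (b.1 v) = G.πop x (U v)) ∧ ρ x = α.rep b := by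
  have h1 : U.conjStarAlgEquiv b.1 ∈ Set.range G.πop := by
    rw [← I.map_dag]; exact ⟨b.1, b.2, rfl⟩
  obtain ⟨x, hx⟩ := h1
  have hx' : G.πop x = U.conjStarAlgEquiv b.1 := hx
  have h2 : U.symm.conjStarAlgEquiv (G.πop x) = b.1 := by
    rw [hx']; ext v; simp
  refine ⟨x, fun v => ?_, ?_⟩
  · rw [hx']; simp
  · rw [I.ρ_eq x (by rw [h2]; exact b.2)]
    congr 1
    exact Subtype.ext h2

theorem exists_alg (I : IsIdentification G B ζ ρ σ α β U) (b : B.alg) :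
    ∃ y : N, (∀ v, U (b.1 v) = G.π y (U v)) ∧ σ y = β.rep b := by
  have h1 : U.conjStarAlgEquiv b.1 ∈ Set.range G.π := by
    rw [← I.map_alg]; exact ⟨b.1, b.2, rfl⟩
  obtain ⟨x, hx⟩ := h1
  have hx' : G.π x = U.conjStarAlgEquiv b.1 := hx
  have h2 : U.symm.conjStarAlgEquiv (G.π x) = b.1 := by
    rw [hx']; ext v; simp
  refine ⟨x, fun v => ?_, ?_⟩
  · rw [hx']; simp
  · rw [I.σ_eq x (by rw [h2]; exact b.2)]
    congr 1
    exact Subtype.ext h2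

/-- `R_{μ^op}^ρ(ξ) U`, as an element of `α`. -/
noncomputable def left (I : IsIdentification G B ζ ρ σ α β U) (hζ : B.IsBicyclic ζ) (ξ : H) :
    α.carrier :=
  ⟨G.Rop ρ ξ ∘L (U : E →L[ℂ] L), α.mem_of_intertwines hζ _ fun b v => by
    obtain ⟨x, h1, h2⟩ := I.exists_dag b
    change G.Rop ρ ξ (U (b.1 v)) = α.rep b (G.Rop ρ ξ (U v))
    rw [h1, GNS.Rop_πop, h2]⟩

/-- `R_μ^σ(η) U`, as an element of `β`. -/
noncomputable def right (I : IsIdentification G B ζ ρ σ α β U) (hζ : B.IsBicyclic ζ) (η : K) :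
    β.carrier :=
  ⟨G.R σ η ∘L (U : E →L[ℂ] L), β.mem_of_intertwines ⟨hζ.cyclic_dag, hζ.cyclic_alg⟩ _ fun b v => by
    obtain ⟨y, h1, h2⟩ := I.exists_alg b
    change G.R σ η (U (b.1 v)) = β.rep b (G.R σ η (U v))
    rw [h1, GNS.R_π, h2]⟩

theorem left_apply (I : IsIdentification G B ζ ρ σ α β U) (hζ : B.IsBicyclic ζ) (ξ : H) (v : E) :
    (I.left hζ ξ).1 v = G.Rop ρ ξ (U v) := rfl

theorem right_apply (I : IsIdentification G B ζ ρ σ α β U) (hζ : B.IsBicyclic ζ) (η : K) (v : E) :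
    (I.right hζ η).1 v = G.R σ η (U v) := rfl

theorem left_surjective (I : IsIdentification G B ζ ρ σ α β U) (hζ : B.IsBicyclic ζ)
    (ξ : α.carrier) : I.left hζ (ξ.1 ζ) = ξ := by
  refine Subtype.ext ?_
  ext v
  obtain ⟨b, hb, rfl⟩ := hζ.cyclic_dag v
  obtain ⟨x, h1, h2⟩ := I.exists_dag ⟨b, hb⟩
  rw [left_apply, h1, GNS.Rop_πop, I.map_ζ, GNS.Rop_ζ, h2]
  exact α.rep_apply ⟨b, hb⟩ ξ ζ

theorem right_surjective (I : IsIdentification G B ζ ρ σ α β U) (hζ : B.IsBicyclic ζ)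
    (η : β.carrier) : I.right hζ (η.1 ζ) = η := by
  refine Subtype.ext ?_
  ext v
  obtain ⟨b, hb, rfl⟩ := hζ.cyclic_alg v
  obtain ⟨x, h1, h2⟩ := I.exists_alg ⟨b, hb⟩
  rw [right_apply, h1, GNS.R_π, I.map_ζ, GNS.R_ζ, h2]
  exact β.rep_apply ⟨b, hb⟩ η ζ

theorem exists_Φ (I : IsIdentification G B ζ ρ σ α β U) (hζ : B.IsBicyclic ζ) :
    ∃ Φ : G.RelTensor ρ σ ≃ₗᵢ[ℂ] CStarFact.RelTensor α β, ∀ p : H × K,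
      Φ (G.tmul ρ σ p.1 p.2) = CStarFact.tmul α β (I.left hζ p.1) ζ (I.right hζ p.2) := by
  refine exists_unitary _ (G.span_tmul ρ σ) _ ?_ ?_
  · rw [eq_top_iff, ← CStarFact.span_tmul α β, Submodule.span_le]
    rintro _ ⟨⟨ξ, v, η⟩, rfl⟩
    obtain ⟨b, hb, rfl⟩ := hζ.cyclic_alg v
    refine Submodule.subset_span ⟨((ξ.1 ∘L b) ζ, η.1 ζ), ?_⟩
    dsimp only
    rw [I.left_surjective hζ ⟨ξ.1 ∘L b, α.comp_mem ξ hb⟩, I.right_surjective hζ η,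
      ← CStarFact.ketTwo_apply, ← CStarFact.ketTwo_apply]
    rfl
  · rintro ⟨ξ, η⟩ ⟨ξ', η'⟩
    have h : ∀ z, (I.right hζ η).1.adjoint z = U.symm ((G.R σ η).adjoint z) := by
      intro z
      refine ext_inner_right ℂ fun v => ?_
      rw [ContinuousLinearMap.adjoint_inner_left, right_apply, ← U.inner_map_map,
        LinearIsometryEquiv.apply_symm_apply, ContinuousLinearMap.adjoint_inner_left]
    rw [CStarFact.inner_tmul, h, left_apply, left_apply, right_apply,
      LinearIsometryEquiv.apply_symm_apply, I.map_ζ, GNS.inner_tmul',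
      ContinuousLinearMap.adjoint_inner_right]

/-- The unitary `Φ` from the relative tensor product over `μ` to the C⋆-relative tensor product,
`ξ ⊗ η ↦ R_{μ^op}^ρ(ξ) U ⊗ ζ ⊗ R_μ^σ(η) U`. -/
noncomputable def Φ (I : IsIdentification G B ζ ρ σ α β U) (hζ : B.IsBicyclic ζ) :
    G.RelTensor ρ σ ≃ₗᵢ[ℂ] CStarFact.RelTensor α β :=
  (I.exists_Φ hζ).choose

theorem Φ_tmul (I : IsIdentification G B ζ ρ σ α β U) (hζ : B.IsBicyclic ζ) (ξ : H) (η : K) :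
    I.Φ hζ (G.tmul ρ σ ξ η) = CStarFact.tmul α β (I.left hζ ξ) ζ (I.right hζ η) :=
  (I.exists_Φ hζ).choose_spec (ξ, η)

end IsIdentification

end

end HopfBimodule

namespace HopfBimodule

/-! ### Finite-dimensional operator algebras -/

section OperatorAlgebra

set_option linter.unusedSectionVars false

variable {H K : Type*}
  [NormedAddCommGroup H] [InnerProductSpace ℂ H] [CompleteSpace H] [FiniteDimensional ℂ H]
  [NormedAddCommGroup K] [InnerProductSpace ℂ K] [CompleteSpace K] [FiniteDimensional ℂ K]

/-! The two notions describe the same structure, once in terms of representations and commutants and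
once in terms of spaces of operators, and `Φ` translates between them. Three translations are
needed: of the fibre products, of the conditions on `Δ`, and of coassociativity. All of them rest on
the bicyclic vector ζ. Because ζ is cyclic for 𝔅† and for 𝔅, the map ξ ↦ ξζ is a bijection from α
onto H, and α consists of all operators that intertwine the action of 𝔅† on E with ρ_α. Hence an
operator X preserves C⋆-factorizations, in the sense Xα ⊆ α' and X*α' ⊆ α, exactly when it
intertwines ρ_α and ρ_α' (`preserves_iff`). So X ⊗ Y is defined for the same X and Y in both
settings.

The tool from finite-dimensional operator algebra is a projection P of 𝓛(H) onto A that is linear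
for left multiplication by A (`exists_leftLinear_projection`); its kernel is the orthogonal
complement of A for the form tr(ST). For a fixed vector y, the operators P(|h⟩⟨y|) depend linearly
on h and turn the action of A on H into left multiplication. This yields the bicommutant theorem
(`mem_of_commute_commutant`), and it shows that the values of the intertwiners of a ⋆-homomorphism π
span the range of π(1) (`mem_span_intertwiners`).

Fibre products: by the bicommutant theorem, [|α⟩₁ A] is the space of all operators that intertwine
each R in A' with 1 ⊗ R. Therefore T and T* map |α⟩₁ into [|α⟩₁ A] if and only if T commutes with 1
⊗ A' (`mem_ketStabilizer_iff_commute`). With the same statement for the other leg, the C⋆-fibre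
product becomes the commutant of A' ⊗ A', which is the definition of the fibre product over μ
(`IsComparison.mem_fibre_iff`).

Conditions on `Δ`: a ⋆-homomorphism is a morphism of C⋆-factorizations if and only if it carries ρ_γ
to ρ_γ' (`isMorphism_iff`); one direction needs the supply of intertwiners above. For α and α ▷ α
this says Δ(ρ(x)) = 1 ⊗ ρ(x), and for β and β ◁ β it says Δ(σ(y)) = σ(y) ⊗ 1.

Coassociativity: the threefold products have H ⊗_μ H or H ⊗_𝔥 H as a leg, which are different
spaces. Comparison unitaries are therefore built relative to given unitaries V and W between the
legs (`IsComparison`), with `Φ` as the case V = W = 1. The legs 1 ⊗ ρ and σ ⊗ 1 correspond to α ▷ α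
and β ◁ β, so the construction can be repeated with `Φ` on a leg. The comparison unitaries are
natural and respect associativity (`IsComparison.map`, `comparison_assoc`), so conjugation turns
fibre products of morphisms into fibre products of morphisms (`IsComparison.isFibreMap_iff`). -/

theorem finiteDimensional_operators : FiniteDimensional ℂ (H →L[ℂ] K) :=
  FiniteDimensional.of_injective (ContinuousLinearMap.coeLM ℂ : (H →L[ℂ] K) →ₗ[ℂ] (H →ₗ[ℂ] K))
    ContinuousLinearMap.coe_injective

/-- The bilinear form `(S, T) ↦ tr(S T)`. -/
noncomputable def traceMulForm (H : Type*) [NormedAddCommGroup H] [InnerProductSpace ℂ H] :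
    LinearMap.BilinForm ℂ (H →L[ℂ] H) :=
  LinearMap.mk₂ ℂ (fun S T => LinearMap.trace ℂ H ((S : H →ₗ[ℂ] H) * (T : H →ₗ[ℂ] H)))
    (fun a b c => by
      rw [← map_add]; rfl)
    (fun r a b => by
      rw [← map_smul]; rfl)
    (fun a b c => by
      rw [← map_add]; congr 1; ext x; exact map_add a _ _)
    (fun r a b => by
      rw [← map_smul]; congr 1; ext x; exact map_smul a _ _)

theorem traceMulForm_apply (S T : H →L[ℂ] H) : traceMulForm H S T =
    LinearMap.trace ℂ H ((S : H →ₗ[ℂ] H) * (T : H →ₗ[ℂ] H)) := rfl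

/-- Moving a factor across the form makes the orthogonal complement of a subalgebra stable under
left multiplication by that subalgebra. -/
theorem traceMulForm_mul_left (R S T : H →L[ℂ] H) :
    traceMulForm H (R * S) T = traceMulForm H R (S * T) := by
  rw [traceMulForm_apply, traceMulForm_apply]
  rfl

/-- In an orthonormal basis, tr(S*S) = ∑ᵢ ‖S eᵢ‖². It follows that the bilinear trace form is
nondegenerate on every ⋆-closed subspace. -/
theorem eq_zero_of_traceMulForm_star {S : H →L[ℂ] H} (h : traceMulForm H (star S) S = 0) :
    S = 0 := by
  let e := stdOrthonormalBasis ℂ H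
  rw [traceMulForm_apply, LinearMap.trace_eq_sum_inner _ e] at h
  have h1 : ∀ i, ⟪e i, ((star S : H →L[ℂ] H) : H →ₗ[ℂ] H) ((S : H →ₗ[ℂ] H) (e i))⟫_ℂ
      = ((‖S (e i)‖ ^ 2 : ℝ) : ℂ) := by
    intro i
    change ⟪e i, (star S) (S (e i))⟫_ℂ = _
    rw [ContinuousLinearMap.star_eq_adjoint, ContinuousLinearMap.adjoint_inner_right,
      inner_self_eq_norm_sq_to_K]
    norm_cast
  have h2 : ∑ i, ‖S (e i)‖ ^ 2 = 0 := by
    have : ((∑ i, ‖S (e i)‖ ^ 2 : ℝ) : ℂ) = 0 := by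
      rw [← h, Complex.ofReal_sum]
      exact Finset.sum_congr rfl fun i _ => (h1 i).symm
    exact_mod_cast this
  rw [Finset.sum_eq_zero_iff_of_nonneg fun i _ => sq_nonneg _] at h2
  apply ContinuousLinearMap.coe_injective
  refine e.toBasis.ext fun i => ?_
  have := h2 i (Finset.mem_univ i)
  simpa using this

/-- A unital `⋆`-subalgebra `A ⊆ 𝓛(H)` has a complement in `𝓛(H)` that is stable under
multiplication by elements of `A` from the left. -/
theorem exists_leftLinear_projection (A : StarSubalgebra ℂ (H →L[ℂ] H)) :
    ∃ P : (H →L[ℂ] H) →ₗ[ℂ] A, (∀ a : A, P a.1 = a) ∧ ∀ (a : A) T, P (a.1 * T) = a * P T := by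
  have := finiteDimensional_operators (H := H) (K := H)
  let W : Submodule ℂ (H →L[ℂ] H) := Subalgebra.toSubmodule A.toSubalgebra
  have hrefl : (traceMulForm H).IsRefl := by
    intro S T h
    rw [traceMulForm_apply, LinearMap.trace_mul_comm]
    exact h
  -- The form is bilinear, so `A ∩ A^⊥ = 0` depends on `A` being closed under adjoints: an element S
  -- of the intersection is orthogonal to S*, which lies in `A`.
  have hW : IsCompl W ((traceMulForm H).orthogonal W) := by
    rw [LinearMap.BilinForm.isCompl_orthogonal_iff_disjoint hrefl, Submodule.disjoint_def]
    intro S hS hS'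
    exact eq_zero_of_traceMulForm_star (hS' (star S) (star_mem (S := StarSubalgebra ℂ _) (s := A) hS))
  refine ⟨W.projectionOnto _ hW, fun a => W.projectionOnto_apply_left hW a, fun a T => ?_⟩
  have hT := Submodule.projection_add_projection_eq_self hW T
  -- Left multiplication by `a` preserves both summands of the decomposition of 𝓛(H), so it commutes
  -- with the projection.
  have h1 : a.1 * T = a.1 * W.projection _ hW T
      + a.1 * ((traceMulForm H).orthogonal W).projection _ hW.symm T := by
    rw [← mul_add, hT]
  have h2 : a.1 * ((traceMulForm H).orthogonal W).projection _ hW.symm T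
      ∈ (traceMulForm H).orthogonal W := by
    intro b hb
    change traceMulForm H b _ = 0
    rw [← traceMulForm_mul_left]
    exact Submodule.projection_apply_mem hW.symm T _
      (mul_mem (S := StarSubalgebra ℂ _) (s := A) hb a.2)
  rw [h1, map_add, Submodule.projectionOnto_apply_of_mem_right hW h2, add_zero]
  exact W.projectionOnto_apply_left hW (a * W.projectionOnto _ hW T)

theorem sum_rankOne_stdOrthonormalBasis :
    ∑ i, InnerProductSpace.rankOne ℂ (stdOrthonormalBasis ℂ H i) (stdOrthonormalBasis ℂ H i)
      = (1 : H →L[ℂ] H) :=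
  (stdOrthonormalBasis ℂ H).sum_rankOne_eq_id

/-- For fixed y, x ↦ |x⟩⟨y| is a map of left 𝓛(H)-modules from H to 𝓛(H). Through it, a left-linear
projection of 𝓛(H) acts on vectors. -/
theorem mul_rankOne (T : H →L[ℂ] H) (x y : H) :
    T * InnerProductSpace.rankOne ℂ x y = InnerProductSpace.rankOne ℂ (T x) y := by
  ext z
  change T (InnerProductSpace.rankOne ℂ x y z) = _
  rw [InnerProductSpace.rankOne_apply, InnerProductSpace.rankOne_apply, map_smul]

/-- The bicommutant theorem in finite dimensions. -/
theorem mem_of_commute_commutant (A : StarSubalgebra ℂ (H →L[ℂ] H)) {T : H →L[ℂ] H}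
    (hT : ∀ S : H →L[ℂ] H, (∀ a ∈ A, S * a = a * S) → T * S = S * T) : T ∈ A := by
  obtain ⟨P, hP, hPm⟩ := exists_leftLinear_projection A
  have key : ∀ x y w : H, T ((P (InnerProductSpace.rankOne ℂ x y)).1 w)
      = (P (T * InnerProductSpace.rankOne ℂ x y)).1 w := by
    intro x y w
    -- For fixed y and w, the operator h ↦ P(|h⟩⟨y|) w commutes with `A` because P is left
    -- `A`-linear, so `T` commutes with it. Evaluation at x gives the claim.
    let S : H →L[ℂ] H := LinearMap.toContinuousLinearMap
      { toFun := fun h => (P (InnerProductSpace.rankOne ℂ h y)).1 w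
        map_add' := fun h h' => by
          rw [map_add, add_apply, map_add]; rfl
        map_smul' := fun r h => by
          rw [map_smul, smul_apply, map_smul]; rfl }
    have hS : ∀ a ∈ A, S * a = a * S := by
      intro a ha
      ext h
      change (P (InnerProductSpace.rankOne ℂ (a h) y)).1 w
        = a ((P (InnerProductSpace.rankOne ℂ h y)).1 w)
      rw [← mul_rankOne, hPm ⟨a, ha⟩]
      rfl
    rw [mul_rankOne]
    exact DFunLike.congr_fun (hT S hS) x
  -- Summing `key` over x = y = eᵢ replaces the rank-one operators by 1 and gives T P(1) = P(T),
  -- where P(1) = 1.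
  have h1 : T = (P T).1 := by
    ext w
    have h2 : T = ∑ i, T * InnerProductSpace.rankOne ℂ (stdOrthonormalBasis ℂ H i)
        (stdOrthonormalBasis ℂ H i) := by
      rw [← Finset.mul_sum, sum_rankOne_stdOrthonormalBasis, mul_one]
    have h3 : (1 : H →L[ℂ] H) = (P 1).1 := by rw [← OneMemClass.coe_one A, hP 1]
    calc T w = T ((P 1).1 w) := by rw [← h3]; rfl
      _ = ∑ i, T ((P (InnerProductSpace.rankOne ℂ (stdOrthonormalBasis ℂ H i)
            (stdOrthonormalBasis ℂ H i))).1 w) := by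
        rw [← sum_rankOne_stdOrthonormalBasis, map_sum P, AddSubmonoidClass.coe_finsetSum,
          sum_apply, map_sum]
      _ = (P T).1 w := by
        conv_rhs => rw [h2]
        rw [map_sum, AddSubmonoidClass.coe_finsetSum, sum_apply]
        exact Finset.sum_congr rfl fun i _ => key _ _ _
  rw [h1]
  exact (P T).2

/-- Every vector in the range of `π(1)`, for a `⋆`-homomorphism `π : A → A'`, is a sum of values of
operators that intertwine the identity representation of `A` with `π`. -/
theorem mem_span_intertwiners {A : StarSubalgebra ℂ (H →L[ℂ] H)}
    {A' : StarSubalgebra ℂ (K →L[ℂ] K)} (π : OpHom A A') (k : K) :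
    π.op 1 k ∈ Submodule.span ℂ {x : K | ∃ V : H →L[ℂ] K, (∀ a : A, V ∘L a.1 = π.op a ∘L V) ∧
      ∃ h, x = V h} := by
  obtain ⟨P, hP, hPm⟩ := exists_leftLinear_projection A
  -- Since 1 = P(1) = ∑ᵢ P(|eᵢ⟩⟨eᵢ|), the vector π(1)k splits into the values at eᵢ of the maps h ↦
  -- π(P(|h⟩⟨eᵢ|))k. These are intertwiners because P(a|h⟩⟨eᵢ|) = a P(|h⟩⟨eᵢ|) and π is
  -- multiplicative. As π need not be unital, k itself need not be reached.
  have h1 : π.op 1 k = ∑ i, π.op (P (InnerProductSpace.rankOne ℂ (stdOrthonormalBasis ℂ H i)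
      (stdOrthonormalBasis ℂ H i))) k := by
    conv_lhs => rw [← hP 1, OneMemClass.coe_one, ← sum_rankOne_stdOrthonormalBasis, map_sum]
    rw [OpHom.op, map_sum, AddSubmonoidClass.coe_finsetSum, sum_apply]
  rw [h1]
  refine Submodule.sum_mem _ fun i _ => Submodule.subset_span ⟨LinearMap.toContinuousLinearMap
    { toFun := fun h => π.op (P (InnerProductSpace.rankOne ℂ h (stdOrthonormalBasis ℂ H i))) k
      map_add' := fun h h' => by
        rw [map_add, add_apply, map_add, OpHom.op, map_add]; rfl
      map_smul' := fun r h => by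
        rw [map_smul, smul_apply, map_smul, OpHom.op, map_smul]; rfl },
    fun a => ?_, stdOrthonormalBasis ℂ H i, rfl⟩
  ext h
  change π.op (P (InnerProductSpace.rankOne ℂ (a.1 h) _)) k = π.op a (π.op (P _) k)
  rw [← mul_rankOne, hPm, OpHom.op, map_mul]
  rfl

end OperatorAlgebra

end HopfBimodule

namespace HopfBimodule

set_option linter.unusedSectionVars false

/-! ### Morphisms of C⋆-factorizations and intertwiners -/

namespace CStarFact

section

variable {E : Type*} [NormedAddCommGroup E] [InnerProductSpace ℂ E] [CompleteSpace E]
  [FiniteDimensional ℂ E] {C : CStarBase E} {ζ : E}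
  {H H' : Type*}
  [NormedAddCommGroup H] [InnerProductSpace ℂ H] [CompleteSpace H] [FiniteDimensional ℂ H]
  [NormedAddCommGroup H'] [InnerProductSpace ℂ H'] [CompleteSpace H'] [FiniteDimensional ℂ H']
  {γ : CStarFact C H} {γ' : CStarFact C H'}

/-- Vectors ξv span H, and v = bζ with b in the algebra of the base gives ξv = (ξb)ζ with ξb ∈ γ.
This is how arbitrary vectors are traded for elements of a C⋆-factorization. -/
theorem exists_apply_eq (hζ : C.IsBicyclic ζ) (γ : CStarFact C H) (h : H) :
    ∃ ξ : γ.carrier, ξ.1 ζ = h := by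
  have : h ∈ Submodule.span ℂ (Set.range fun p : γ.carrier × E => p.1.1 p.2) := by
    rw [γ.total]; trivial
  induction this using Submodule.span_induction with
  | mem w hw =>
    obtain ⟨⟨ξ, v⟩, rfl⟩ := hw
    obtain ⟨b, hb, rfl⟩ := hζ.cyclic_alg v
    exact ⟨⟨ξ.1 ∘L b, γ.comp_mem ξ hb⟩, rfl⟩
  | zero => exact ⟨0, rfl⟩
  | add u w _ _ hu hw =>
    obtain ⟨ξ, rfl⟩ := hu
    obtain ⟨ξ', rfl⟩ := hw
    exact ⟨ξ + ξ', rfl⟩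
  | smul t u _ hu =>
    obtain ⟨ξ, rfl⟩ := hu
    exact ⟨t • ξ, rfl⟩

theorem Preserves.rep {X : H →L[ℂ] H'} (hX : Preserves γ γ' X) (b : C.dag) :
    X ∘L γ.rep b = γ'.rep b ∘L X := by
  refine γ.ext_op fun ξ v => ?_
  change X (γ.rep b (ξ.1 v)) = γ'.rep b (X (ξ.1 v))
  rw [rep_apply]
  exact (γ'.rep_apply b ⟨_, hX.1 ξ.1 ξ.2⟩ v).symm

/-- Cyclicity makes γ the space of all operators that intertwine the action of `C.dag` with ρ_γ
(`mem_of_intertwines`). Composition with an intertwiner X, or with its adjoint, therefore leads from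
one factorization into the other. -/
theorem preserves_iff (hζ : C.IsBicyclic ζ) {X : H →L[ℂ] H'} :
    Preserves γ γ' X ↔ GNS.Intertwines γ.rep γ'.rep X := by
  refine ⟨fun h b => h.rep b, fun h => ⟨fun ξ hξ => ?_, fun ξ hξ => ?_⟩⟩
  · refine γ'.mem_of_intertwines hζ _ fun b v => ?_
    change X (ξ (b.1 v)) = γ'.rep b (X (ξ v))
    rw [← γ.rep_apply b ⟨ξ, hξ⟩]
    exact DFunLike.congr_fun (h b) _
  · refine γ.mem_of_intertwines hζ _ fun b v => ?_
    change X.adjoint (ξ (b.1 v)) = γ.rep b (X.adjoint (ξ v))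
    rw [← γ'.rep_apply b ⟨ξ, hξ⟩]
    exact DFunLike.congr_fun (h.adjoint b) _

/-- If the C⋆-base has a bicyclic vector, then a `⋆`-homomorphism is a morphism if and only if it
intertwines the representations `ρ_γ` and `ρ_γ'`. -/
theorem isMorphism_iff (hζ : C.IsBicyclic ζ) {A : StarSubalgebra ℂ (H →L[ℂ] H)}
    {A' : StarSubalgebra ℂ (H' →L[ℂ] H')} (hγ : ∀ b, γ.rep b ∈ A) (π : OpHom A A') :
    IsMorphism A γ A' γ' π ↔ ∀ b, π.op ⟨γ.rep b, hγ b⟩ = γ'.rep b := by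
  constructor
  -- Elements of γ' are combinations of operators Vξ with ξ ∈ γ and V an intertwiner for π. For
  -- these, π(ρ_γ(b)) V ξ v = V ρ_γ(b) ξ v = V ξ b v.
  · intro h b
    refine γ'.ext_op fun ξ v => ?_
    rw [rep_apply]
    obtain ⟨ξ, hξ⟩ := ξ
    rw [IsMorphism] at h
    have hξ' := hξ
    rw [h] at hξ'
    dsimp only
    clear hξ
    induction hξ' using Submodule.span_induction with
    | mem T hT =>
      obtain ⟨V, hV, hV', ξ, hξ, rfl⟩ := hT
      change π.op _ (V (ξ v)) = V (ξ (b.1 v))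
      rw [← γ.rep_apply b ⟨ξ, hξ⟩]
      exact (DFunLike.congr_fun (hV ⟨γ.rep b, hγ b⟩) _).symm
    | zero => simp
    | add S T _ _ hS hT => rw [add_apply, add_apply, map_add, hS, hT]
    | smul t T _ hT => rw [smul_apply, smul_apply, map_smul, hT]
  · intro h
    -- An intertwiner for π intertwines ρ_γ and ρ_γ' in particular, so the requirement to preserve
    -- the factorizations holds automatically.
    have hpres : ∀ V : H →L[ℂ] H', (∀ a : A, V ∘L a.1 = π.op a ∘L V) → Preserves γ γ' V := by
      intro V hV
      rw [preserves_iff hζ]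
      intro b
      rw [hV ⟨γ.rep b, hγ b⟩, h]
    refine le_antisymm ?_ (Submodule.span_le.2 ?_)
    · intro ξ hξ
      obtain ⟨I, hI⟩ : ∃ I : Submodule ℂ (E →L[ℂ] H'), I = Submodule.span ℂ
          {T : E →L[ℂ] H' | ∃ V : H →L[ℂ] H', (∀ a : A, V ∘L a.1 = π.op a ∘L V) ∧
            Preserves γ γ' V ∧ ∃ ξ ∈ γ.carrier, T = V ∘L ξ} := ⟨_, rfl⟩
      rw [← hI]
      have hle : I ≤ γ'.carrier := by
        rw [hI, Submodule.span_le]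
        rintro _ ⟨V, _, hV, ξ, hξ, rfl⟩
        exact hV.1 ξ hξ
      -- Although π is not assumed unital, π(1) = π(ρ_γ(1)) = ρ_γ'(1) = 1. So the intertwiners for π
      -- reach every vector of `H'`, in particular ξζ.
      have h1 : π.op 1 (ξ ζ) = ξ ζ := by
        have h2 : (1 : A) = ⟨γ.rep 1, hγ 1⟩ := Subtype.ext (map_one γ.rep).symm
        rw [h2, h, map_one]
        rfl
      have h3 := mem_span_intertwiners π (ξ ζ)
      rw [h1] at h3
      have h4 : ∃ η ∈ I, η ζ = ξ ζ := by
        generalize ξ ζ = w at h3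
        induction h3 using Submodule.span_induction with
        | mem w hw =>
          obtain ⟨V, hV, h, rfl⟩ := hw
          obtain ⟨θ, rfl⟩ := exists_apply_eq hζ γ h
          refine ⟨V ∘L θ.1, ?_, rfl⟩
          rw [hI]
          exact Submodule.subset_span ⟨V, hV, hpres V hV, θ.1, θ.2, rfl⟩
        | zero => exact ⟨0, zero_mem _, rfl⟩
        | add u w _ _ hu hw =>
          obtain ⟨θ, h1, rfl⟩ := hu
          obtain ⟨θ', h2, rfl⟩ := hw
          exact ⟨θ + θ', add_mem h1 h2, rfl⟩
        | smul t u _ hu =>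
          obtain ⟨θ, h1, rfl⟩ := hu
          exact ⟨t • θ, Submodule.smul_mem _ _ h1, rfl⟩
      obtain ⟨η, hη, h5⟩ := h4
      -- An element of γ' is determined by its value at ζ, because it intertwines `C.dag` with ρ_γ'
      -- and ζ is cyclic for `C.dag`.
      have : ξ = η := by
        ext v
        obtain ⟨b, hb, rfl⟩ := hζ.cyclic_dag v
        have e1 := γ'.rep_apply ⟨b, hb⟩ ⟨ξ, hξ⟩ ζ
        have e2 := γ'.rep_apply ⟨b, hb⟩ ⟨η, hle hη⟩ ζ
        rw [← e1, ← e2, h5]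
      rw [this]
      exact hη
    · rintro _ ⟨V, _, hV, ξ, hξ, rfl⟩
      exact hV.1 ξ hξ

end

end CStarFact

theorem CStarBase.IsBicyclic.op {E : Type*} [NormedAddCommGroup E] [InnerProductSpace ℂ E]
    [CompleteSpace E] [FiniteDimensional ℂ E] {B : CStarBase E} {ζ : E} (h : B.IsBicyclic ζ) :
    B.op.IsBicyclic ζ := ⟨h.cyclic_dag, h.cyclic_alg⟩

/-! ### Commutants of amplifications -/

namespace CStarFact

section

variable {E : Type*} [NormedAddCommGroup E] [InnerProductSpace ℂ E] [CompleteSpace E]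
  [FiniteDimensional ℂ E] {P : CStarBase E}
  {H K X : Type*}
  [NormedAddCommGroup H] [InnerProductSpace ℂ H] [CompleteSpace H] [FiniteDimensional ℂ H]
  [NormedAddCommGroup K] [InnerProductSpace ℂ K] [CompleteSpace K] [FiniteDimensional ℂ K]
  [NormedAddCommGroup X] [InnerProductSpace ℂ X] [CompleteSpace X] [FiniteDimensional ℂ X]

/-- If the images of the operators `|ξ⟩` span, then every operator that intertwines the commutant
of `A` with its amplification lies in `[|a⟩ A]`. -/
theorem mem_ketSpan_of_commute (a : CStarFact P H) (k : a.carrier →ₗ[ℂ] (K →L[ℂ] X))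
    (hs : Submodule.span ℂ (Set.range fun p : a.carrier × K => k p.1 p.2) = ⊤)
    (A : StarSubalgebra ℂ (K →L[ℂ] K)) (Y : K →L[ℂ] X)
    (hY : ∀ R : K →L[ℂ] K, (∀ b ∈ A, R * b = b * R) → ∃ S : X →L[ℂ] X,
      (∀ ξ, S ∘L k ξ = k ξ ∘L R) ∧ (∀ ξ, S.adjoint ∘L k ξ = k ξ ∘L R.adjoint) ∧
      S ∘L Y = Y ∘L R) :
    Y ∈ a.ketSpan k (Subalgebra.toSubmodule A.toSubalgebra) := by
  let e := Module.finBasis ℂ a.carrier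
  -- This positive operator is invertible: a vector in its kernel is orthogonal to the range of
  -- every |ξ⟩, and these ranges span the finite-dimensional space `X`.
  let Z : X →L[ℂ] X := ∑ i, k (e i) ∘L (k (e i)).adjoint
  have hZ : ∀ x, ⟪x, Z x⟫_ℂ = ((∑ i, ‖(k (e i)).adjoint x‖ ^ 2 : ℝ) : ℂ) := by
    intro x
    simp only [Z, sum_apply, inner_sum, ContinuousLinearMap.comp_apply]
    rw [Complex.ofReal_sum]
    refine Finset.sum_congr rfl fun i _ => ?_
    rw [← ContinuousLinearMap.adjoint_inner_left, inner_self_eq_norm_sq_to_K]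
    norm_cast
  have hinj : Function.Injective Z := by
    rw [injective_iff_map_eq_zero]
    intro x hx
    have h1 := hZ x
    rw [hx, inner_zero_right] at h1
    have h2 : ∑ i, ‖(k (e i)).adjoint x‖ ^ 2 = 0 := by exact_mod_cast h1.symm
    rw [Finset.sum_eq_zero_iff_of_nonneg fun i _ => sq_nonneg _] at h2
    have h3 : ∀ i, (k (e i)).adjoint x = 0 := fun i => by simpa using h2 i (Finset.mem_univ i)
    refine inner_ext hs fun p => ?_
    rw [inner_zero_right, ← ContinuousLinearMap.adjoint_inner_right, ← e.sum_repr p.1]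
    simp only [map_sum, LinearMap.map_smul, LinearIsometryEquiv.map_smulₛₗ, sum_apply, smul_apply,
      h3, smul_zero, Finset.sum_const_zero, inner_zero_right]
  let Ze : X ≃ₗ[ℂ] X := LinearEquiv.ofInjectiveEndo (Z : X →ₗ[ℂ] X) hinj
  have hZe : ∀ x, Z (Ze.symm x) = x := fun x => Ze.apply_symm_apply x
  let Zi : X →L[ℂ] X := LinearMap.toContinuousLinearMap (Ze.symm : X →ₗ[ℂ] X)
  have hZi : ∀ x, Z (Zi x) = x := hZe
  -- Writing Y = Z Z⁻¹ Y gives an expansion in the operators |eᵢ⟩ whose coefficients ⟨eᵢ| Z⁻¹ Y are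
  -- operators on `K`. It remains to see that these coefficients commute with the commutant of `A`.
  have hsum : Y = ∑ i, k (e i) ∘L ((k (e i)).adjoint ∘L Zi ∘L Y) := by
    ext x
    rw [sum_apply]
    conv_lhs => rw [← hZi (Y x)]
    simp only [Z, sum_apply, ContinuousLinearMap.comp_apply]
  rw [hsum]
  refine Submodule.sum_mem _ fun i _ => a.mem_ketSpan k _ ?_
  refine mem_of_commute_commutant A fun R hR => ?_
  obtain ⟨S, hS, hS', hSY⟩ := hY R hR
  -- The adjoint of S*|ξ⟩ = |ξ⟩R* is ⟨ξ|S = R⟨ξ|. Together with S|ξ⟩ = |ξ⟩R it makes S commute with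
  -- Z, hence with Z⁻¹.
  have hS2 : ∀ ξ x, (k ξ).adjoint (S x) = R ((k ξ).adjoint x) := by
    intro ξ x
    refine ext_inner_left ℂ fun y => ?_
    rw [ContinuousLinearMap.adjoint_inner_right, ← ContinuousLinearMap.adjoint_inner_left,
      ← ContinuousLinearMap.adjoint_inner_left R, ContinuousLinearMap.adjoint_inner_right]
    congr 1
    exact DFunLike.congr_fun (hS' ξ) y
  have hSZ : ∀ x, S (Z x) = Z (S x) := by
    intro x
    simp only [Z, sum_apply, ContinuousLinearMap.comp_apply, map_sum, hS2]
    exact Finset.sum_congr rfl fun i _ => DFunLike.congr_fun (hS (e i)) _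
  have hSZi : ∀ x, S (Zi x) = Zi (S x) := by
    intro x
    apply hinj
    rw [← hSZ, hZi, hZi]
  ext x
  change (k (e i)).adjoint (Zi (Y (R x))) = R ((k (e i)).adjoint (Zi (Y x)))
  rw [← hS2, hSZi]
  congr 2
  exact (DFunLike.congr_fun hSY x).symm

/-- The easy converse of `mem_ketSpan_of_commute`: on a generator |ξ⟩b, S passes |ξ⟩ and becomes R,
which passes b ∈ `A`. -/
theorem commute_of_mem_ketSpan (a : CStarFact P H) (k : a.carrier →ₗ[ℂ] (K →L[ℂ] X))
    (A : StarSubalgebra ℂ (K →L[ℂ] K)) {Y : K →L[ℂ] X} {R : K →L[ℂ] K}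
    (hR : ∀ b ∈ A, R * b = b * R) {S : X →L[ℂ] X} (hS : ∀ ξ, S ∘L k ξ = k ξ ∘L R)
    (hY : Y ∈ a.ketSpan k (Subalgebra.toSubmodule A.toSubalgebra)) : S ∘L Y = Y ∘L R := by
  induction hY using Submodule.span_induction with
  | mem Y hY =>
    obtain ⟨ξ, b, hb, rfl⟩ := hY
    rw [← ContinuousLinearMap.comp_assoc, hS, ContinuousLinearMap.comp_assoc,
      ContinuousLinearMap.comp_assoc]
    congr 1
    exact hR b hb
  | zero => rw [ContinuousLinearMap.comp_zero, ContinuousLinearMap.zero_comp]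
  | add Y Y' _ _ h h' => rw [ContinuousLinearMap.comp_add, ContinuousLinearMap.add_comp, h, h']
  | smul t Y _ h => rw [ContinuousLinearMap.comp_smul, ContinuousLinearMap.smul_comp, h]

theorem adjoint_mul_comm {A : StarSubalgebra ℂ (K →L[ℂ] K)} {R : K →L[ℂ] K}
    (hR : ∀ b ∈ A, R * b = b * R) : ∀ b ∈ A, R.adjoint * b = b * R.adjoint := by
  intro b hb
  have := congrArg star (hR (star b) (star_mem hb))
  rw [star_mul, star_mul, star_star] at this
  exact this.symm

/-- The stabilizer of `[|a⟩ A]` is the commutant of the amplification of the commutant of `A`. -/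
theorem mem_ketStabilizer_iff_commute (a : CStarFact P H) (k : a.carrier →ₗ[ℂ] (K →L[ℂ] X))
    (hs : Submodule.span ℂ (Set.range fun p : a.carrier × K => k p.1 p.2) = ⊤)
    (A : StarSubalgebra ℂ (K →L[ℂ] K))
    (amp : (R : K →L[ℂ] K) → (∀ b ∈ A, R * b = b * R) → (X →L[ℂ] X))
    (hamp : ∀ R hR ξ, amp R hR ∘L k ξ = k ξ ∘L R)
    (hadj : ∀ R hR, (amp R hR).adjoint = amp R.adjoint (adjoint_mul_comm hR)) {T : X →L[ℂ] X} :
    T ∈ a.ketStabilizer k A ↔ ∀ R hR, amp R hR * T = T * amp R hR := by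
  -- If T commutes with the amplifications, then T|ξ⟩ intertwines each R with its amplification and
  -- so lies in [|a⟩ A]. The amplification is an abstract parameter, so that one argument covers
  -- both legs and any model of 1 ⊗ R or R ⊗ 1.
  have hcomm : ∀ {T : X →L[ℂ] X}, (∀ R hR, amp R hR * T = T * amp R hR) → ∀ ξ, T ∘L k ξ ∈
      a.ketSpan k (Subalgebra.toSubmodule A.toSubalgebra) := by
    intro T hT ξ
    refine a.mem_ketSpan_of_commute k hs A _ fun R hR => ⟨amp R hR, hamp R hR, ?_, ?_⟩
    · rw [hadj]
      exact hamp _ _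
    · have h1 : amp R hR ∘L T = T ∘L amp R hR := hT R hR
      rw [← ContinuousLinearMap.comp_assoc, h1, ContinuousLinearMap.comp_assoc,
        ContinuousLinearMap.comp_assoc, hamp R hR]
  rw [mem_ketStabilizer]
  constructor
  · intro hT R hR
    -- Both products are compared on vectors |ξ⟩x, which span: T|ξ⟩ ∈ [|a⟩ A] intertwines R with its
    -- amplification, and so does |ξ⟩.
    refine operator_ext hs fun p => ?_
    have h1 := a.commute_of_mem_ketSpan k A hR (hamp R hR) (hT p.1).1
    have h2 := DFunLike.congr_fun h1 p.2
    have h3 := DFunLike.congr_fun (hamp R hR p.1) p.2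
    change amp R hR (T (k p.1 p.2)) = T (k p.1 (R p.2)) at h2
    change amp R hR (k p.1 p.2) = k p.1 (R p.2) at h3
    change amp R hR (T (k p.1 p.2)) = T (amp R hR (k p.1 p.2))
    rw [h2, h3]
  · intro hT ξ
    refine ⟨hcomm hT ξ, hcomm (fun R hR => ?_) ξ⟩
    -- The commutant and its amplification are closed under adjoints, so T* commutes with the
    -- amplifications as soon as T does.
    have h1 := congrArg ContinuousLinearMap.adjoint (hT _ (adjoint_mul_comm hR))
    simp only [ContinuousLinearMap.mul_def, ContinuousLinearMap.adjoint_comp] at h1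
    rw [hadj] at h1
    simp only [ContinuousLinearMap.adjoint_adjoint] at h1
    exact h1.symm

end

end CStarFact

end HopfBimodule

namespace HopfBimodule

set_option linter.unusedSectionVars false

/-! ### Comparison of relative tensor products along unitaries -/

section

variable {N : Type*} [CStarAlgebra N] [FiniteDimensional ℂ N] {μ : FaithfulState N}
  {L : Type*} [NormedAddCommGroup L] [InnerProductSpace ℂ L] [CompleteSpace L]
  [FiniteDimensional ℂ L] {G : GNS μ L}
  {E : Type*} [NormedAddCommGroup E] [InnerProductSpace ℂ E] [CompleteSpace E]
  [FiniteDimensional ℂ E] {B : CStarBase E} {ζ : E} {U : E ≃ₗᵢ[ℂ] L}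
  {H K H₁ K₁ H' K' H₁' K₁' : Type*}
  [NormedAddCommGroup H] [InnerProductSpace ℂ H] [CompleteSpace H] [FiniteDimensional ℂ H]
  [NormedAddCommGroup K] [InnerProductSpace ℂ K] [CompleteSpace K] [FiniteDimensional ℂ K]
  [NormedAddCommGroup H₁] [InnerProductSpace ℂ H₁] [CompleteSpace H₁] [FiniteDimensional ℂ H₁]
  [NormedAddCommGroup K₁] [InnerProductSpace ℂ K₁] [CompleteSpace K₁] [FiniteDimensional ℂ K₁]
  [NormedAddCommGroup H'] [InnerProductSpace ℂ H'] [CompleteSpace H'] [FiniteDimensional ℂ H']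
  [NormedAddCommGroup K'] [InnerProductSpace ℂ K'] [CompleteSpace K'] [FiniteDimensional ℂ K']
  [NormedAddCommGroup H₁'] [InnerProductSpace ℂ H₁'] [CompleteSpace H₁']
  [FiniteDimensional ℂ H₁']
  [NormedAddCommGroup K₁'] [InnerProductSpace ℂ K₁'] [CompleteSpace K₁']
  [FiniteDimensional ℂ K₁']
  {ρ : Nᵐᵒᵖ →⋆ₐ[ℂ] (H →L[ℂ] H)} {σ : N →⋆ₐ[ℂ] (K →L[ℂ] K)}
  {ρ' : Nᵐᵒᵖ →⋆ₐ[ℂ] (H' →L[ℂ] H')} {σ' : N →⋆ₐ[ℂ] (K' →L[ℂ] K')}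
  {α : CStarFact B H₁} {β : CStarFact B.op K₁} {α' : CStarFact B H₁'} {β' : CStarFact B.op K₁'}
  {V : H ≃ₗᵢ[ℂ] H₁} {W : K ≃ₗᵢ[ℂ] K₁} {V' : H' ≃ₗᵢ[ℂ] H₁'} {W' : K' ≃ₗᵢ[ℂ] K₁'}
  {Ψ : G.RelTensor ρ σ ≃ₗᵢ[ℂ] CStarFact.RelTensor α β}
  {Ψ' : G.RelTensor ρ' σ' ≃ₗᵢ[ℂ] CStarFact.RelTensor α' β'}

/-! ### Representations matched through the unitary `U` -/

section Carries

variable {R : Type*} [Ring R] [Algebra ℂ R] [StarRing R]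
  {C : CStarBase E} {γ : CStarFact C H₁} {γ' : CStarFact C H₁'}
  {τ : R →⋆ₐ[ℂ] (H →L[ℂ] H)} {τ' : R →⋆ₐ[ℂ] (H' →L[ℂ] H')}

/-- The unitary `U` carries the operator `b` to `r(x)`. -/
def Matches (r : R →⋆ₐ[ℂ] (L →L[ℂ] L)) (U : E ≃ₗᵢ[ℂ] L) (x : R) (b : E →L[ℂ] E) : Prop :=
  ∀ v, U (b v) = r x (U v)

/-- The unitary `U` carries `ℭ†` onto the image of `r`. -/
structure BaseMatches (r : R →⋆ₐ[ℂ] (L →L[ℂ] L)) (U : E ≃ₗᵢ[ℂ] L) (C : CStarBase E) : Prop where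
  exists_left : ∀ b : C.dag, ∃ x, Matches r U x b.1
  exists_right : ∀ x, ∃ b : C.dag, Matches r U x b.1

/-- The unitary `V` carries the representation `τ` to `ρ_γ`, where `R` and `ℭ†` are identified
through `r` and `U`. -/
def Carries (r : R →⋆ₐ[ℂ] (L →L[ℂ] L)) (U : E ≃ₗᵢ[ℂ] L) (τ : R →⋆ₐ[ℂ] (H →L[ℂ] H))
    (γ : CStarFact C H₁) (V : H ≃ₗᵢ[ℂ] H₁) : Prop :=
  ∀ x (b : C.dag), Matches r U x b.1 → ∀ h, V (τ x h) = γ.rep b (V h)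

/-- By `preserves_iff` both sides are intertwining conditions, one indexed by R and the other by
`C.dag`. Matched elements give conjugate conditions; each direction uses one half of the matching.
-/
theorem Carries.intertwines_iff {r : R →⋆ₐ[ℂ] (L →L[ℂ] L)} (hr : BaseMatches r U C)
    (hζ : C.IsBicyclic ζ) (hV : Carries r U τ γ V) (hV' : Carries r U τ' γ' V')
    {X : H →L[ℂ] H'} {X₁ : H₁ →L[ℂ] H₁'} (hX : ∀ h, V' (X h) = X₁ (V h)) :
    GNS.Intertwines τ τ' X ↔ CStarFact.Preserves γ γ' X₁ := by
  rw [CStarFact.preserves_iff hζ]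
  constructor
  · intro h b
    obtain ⟨x, hx⟩ := hr.exists_left b
    ext w
    obtain ⟨w, rfl⟩ := V.surjective w
    change X₁ (γ.rep b (V w)) = γ'.rep b (X₁ (V w))
    rw [← hV x b hx, ← hX, ← hX, ← hV' x b hx]
    congr 1
    exact DFunLike.congr_fun (h x) w
  · intro h x
    obtain ⟨b, hx⟩ := hr.exists_right x
    ext w
    apply V'.injective
    change V' (X (τ x w)) = V' (τ' x (X w))
    rw [hV' x b hx, hX, hX, hV x b hx]
    exact DFunLike.congr_fun (h b) _

end Carries

/-- `U` identifies the C⋆-base `(E, 𝔅, 𝔅†)` and its bicyclic vector `ζ` with the GNS-data. -/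
structure IsBaseIdentification (G : GNS μ L) (B : CStarBase E) (ζ : E) (U : E ≃ₗᵢ[ℂ] L) :
    Prop where
  dag : BaseMatches G.πop U B
  alg : BaseMatches G.π U B.op
  map_ζ : U ζ = G.ζ
  bicyclic : B.IsBicyclic ζ

/-- `Ψ` is the unitary between relative tensor products that is induced by unitaries `V` and `W`. -/
structure IsComparison (U : E ≃ₗᵢ[ℂ] L) (ζ : E) (V : H ≃ₗᵢ[ℂ] H₁) (W : K ≃ₗᵢ[ℂ] K₁)
    (Ψ : G.RelTensor ρ σ ≃ₗᵢ[ℂ] CStarFact.RelTensor α β) : Prop where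
  left : Carries G.πop U ρ α V
  right : Carries G.π U σ β W
  tmul : ∀ (ξ : α.carrier) (η : β.carrier),
    Ψ (G.tmul ρ σ (V.symm (ξ.1 ζ)) (W.symm (η.1 ζ))) = CStarFact.tmul α β ξ ζ η

namespace IsBaseIdentification

/-- Both sides intertwine the action of 𝔅† with ρ_α and agree at ζ, which is cyclic for 𝔅†. Up to U
and V, the operator R(V*ξζ) is thus ξ itself. -/
theorem Rop_apply (I : IsBaseIdentification G B ζ U) (h : Carries G.πop U ρ α V) (ξ : α.carrier)
    (v : E) : V (G.Rop ρ (V.symm (ξ.1 ζ)) (U v)) = ξ.1 v := by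
  obtain ⟨b, hb, rfl⟩ := I.bicyclic.cyclic_dag v
  obtain ⟨x, hx⟩ := I.dag.exists_left ⟨b, hb⟩
  have hx' := hx ζ
  dsimp only at hx'
  rw [hx', I.map_ζ, GNS.Rop_apply, h x ⟨b, hb⟩ hx, LinearIsometryEquiv.apply_symm_apply,
    CStarFact.rep_apply]

theorem R_apply (I : IsBaseIdentification G B ζ U) (h : Carries G.π U σ β W) (η : β.carrier)
    (v : E) : W (G.R σ (W.symm (η.1 ζ)) (U v)) = η.1 v := by
  obtain ⟨b, hb, rfl⟩ := I.bicyclic.cyclic_alg v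
  obtain ⟨x, hx⟩ := I.alg.exists_left ⟨b, hb⟩
  have hx' := hx ζ
  dsimp only at hx'
  rw [hx', I.map_ζ, GNS.R_apply, h x ⟨b, hb⟩ hx, LinearIsometryEquiv.apply_symm_apply,
    CStarFact.rep_apply]

/-- Every vector of H has the form V*ξζ with ξ ∈ α, and likewise for K and β. Elementary tensors
over μ can therefore be labelled by α × β, and this total family serves to prescribe comparison
unitaries. -/
theorem span_tmul (I : IsBaseIdentification G B ζ U) (V : H ≃ₗᵢ[ℂ] H₁) (W : K ≃ₗᵢ[ℂ] K₁)
    (ρ : Nᵐᵒᵖ →⋆ₐ[ℂ] (H →L[ℂ] H)) (σ : N →⋆ₐ[ℂ] (K →L[ℂ] K))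
    (α : CStarFact B H₁) (β : CStarFact B.op K₁) :
    Submodule.span ℂ (Set.range fun p : α.carrier × β.carrier =>
      G.tmul ρ σ (V.symm (p.1.1 ζ)) (W.symm (p.2.1 ζ))) = ⊤ := by
  rw [eq_top_iff, ← G.span_tmul ρ σ, Submodule.span_le]
  rintro _ ⟨⟨h, k⟩, rfl⟩
  obtain ⟨ξ, hξ⟩ := CStarFact.exists_apply_eq I.bicyclic α (V h)
  obtain ⟨η, hη⟩ := CStarFact.exists_apply_eq I.bicyclic.op β (W k)
  refine Submodule.subset_span ⟨(ξ, η), ?_⟩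
  dsimp only
  rw [hξ, hη, LinearIsometryEquiv.symm_apply_apply, LinearIsometryEquiv.symm_apply_apply]

/-- The two families of tensors have the same Gram matrix: after the operators R are replaced by ξ
and η, both inner products read ⟨ξζ, ξ'η*η'ζ⟩. The tensors ξ ⊗ ζ ⊗ η with ζ in the middle already
span, since ξ ⊗ bζ ⊗ η = ξb ⊗ ζ ⊗ η for b ∈ 𝔅. -/
theorem exists_comparison (I : IsBaseIdentification G B ζ U) (hV : Carries G.πop U ρ α V)
    (hW : Carries G.π U σ β W) :
    ∃ Ψ : G.RelTensor ρ σ ≃ₗᵢ[ℂ] CStarFact.RelTensor α β, IsComparison U ζ V W Ψ := by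
  obtain ⟨Ψ, hΨ⟩ : ∃ Ψ : G.RelTensor ρ σ ≃ₗᵢ[ℂ] CStarFact.RelTensor α β,
      ∀ p : α.carrier × β.carrier, Ψ (G.tmul ρ σ (V.symm (p.1.1 ζ)) (W.symm (p.2.1 ζ)))
        = CStarFact.tmul α β p.1 ζ p.2 := by
    refine exists_unitary _ (I.span_tmul V W ρ σ α β) _ ?_ ?_
    · rw [eq_top_iff, ← CStarFact.span_tmul α β, Submodule.span_le]
      rintro _ ⟨⟨ξ, v, η⟩, rfl⟩
      obtain ⟨b, hb, rfl⟩ := I.bicyclic.cyclic_alg v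
      refine Submodule.subset_span ⟨(⟨ξ.1 ∘L b, α.comp_mem ξ hb⟩, η), ?_⟩
      dsimp only
      rw [← CStarFact.ketTwo_apply, ← CStarFact.ketTwo_apply]
      rfl
    · rintro ⟨ξ, η⟩ ⟨ξ', η'⟩
      dsimp only
      -- This is the adjoint of the identity W R(W*ηζ) U = η.
      have h1 : ∀ z, (G.R σ (W.symm (η.1 ζ))).adjoint z = U (η.1.adjoint (W z)) := by
        intro z
        refine ext_inner_right ℂ fun v => ?_
        obtain ⟨v, rfl⟩ := U.surjective v
        rw [ContinuousLinearMap.adjoint_inner_left, U.inner_map_map,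
          ContinuousLinearMap.adjoint_inner_left, ← I.R_apply hW η v, W.inner_map_map]
      rw [GNS.inner_tmul', CStarFact.inner_tmul, ContinuousLinearMap.adjoint_inner_right, h1,
        ← I.map_ζ, I.R_apply hW, ← V.inner_map_map, I.Rop_apply hV, I.Rop_apply hV]
  exact ⟨Ψ, hV, hW, fun ξ η => hΨ (ξ, η)⟩

end IsBaseIdentification

namespace IsComparison

/-- The defining property of Ψ involves elements of α and β; choosing ξ with ξζ = V h frees the
first leg. Thus Ψ carries the operator h ↦ h ⊗ W*ηζ to |η⟩₂. -/
theorem ketTwo (hΨ : IsComparison U ζ V W Ψ) (I : IsBaseIdentification G B ζ U) (h : H)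
    (η : β.carrier) :
    Ψ (G.tmul ρ σ h (W.symm (η.1 ζ))) = CStarFact.ketTwo α β η (V h) := by
  obtain ⟨ξ, hξ⟩ := CStarFact.exists_apply_eq I.bicyclic α (V h)
  rw [← hξ, CStarFact.ketTwo_apply, ← hΨ.tmul, hξ, LinearIsometryEquiv.symm_apply_apply]

theorem ketOne (hΨ : IsComparison U ζ V W Ψ) (I : IsBaseIdentification G B ζ U) (ξ : α.carrier)
    (k : K) :
    Ψ (G.tmul ρ σ (V.symm (ξ.1 ζ)) k) = CStarFact.ketOne α β ξ (W k) := by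
  obtain ⟨η, hη⟩ := CStarFact.exists_apply_eq I.bicyclic.op β (W k)
  rw [← hη, CStarFact.ketOne_apply, ← hΨ.tmul, hη, LinearIsometryEquiv.symm_apply_apply]

/-- Naturality of the comparison unitaries. -/
theorem map (hΨ : IsComparison U ζ V W Ψ) (hΨ' : IsComparison U ζ V' W' Ψ')
    (I : IsBaseIdentification G B ζ U)
    {X : H →L[ℂ] H'} {X₁ : H₁ →L[ℂ] H₁'} (hVX : ∀ h, V' (X h) = X₁ (V h))
    {Y : K →L[ℂ] K'} {Y₁ : K₁ →L[ℂ] K₁'} (hWY : ∀ k, W' (Y k) = Y₁ (W k))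
    (hX : GNS.Intertwines ρ ρ' X) (hY : GNS.Intertwines σ σ' Y)
    (hX₁ : CStarFact.Preserves α α' X₁) (hY₁ : CStarFact.Preserves β β' Y₁)
    (w : G.RelTensor ρ σ) : Ψ' (G.map hX hY w) = CStarFact.map hX₁ hY₁ (Ψ w) := by
  refine DFunLike.congr_fun (f := (Ψ' : G.RelTensor ρ' σ' →L[ℂ] _) ∘L G.map hX hY)
    (g := CStarFact.map hX₁ hY₁ ∘L (Ψ : G.RelTensor ρ σ →L[ℂ] _))
    (operator_ext (I.span_tmul V W ρ σ α β) ?_) w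
  rintro ⟨ξ, η⟩
  change Ψ' (G.map hX hY (G.tmul ρ σ (V.symm (ξ.1 ζ)) (W.symm (η.1 ζ)))) =
    CStarFact.map hX₁ hY₁ (Ψ (G.tmul ρ σ (V.symm (ξ.1 ζ)) (W.symm (η.1 ζ))))
  rw [hΨ.tmul, CStarFact.map_tmul, GNS.map_tmul, ← hΨ'.tmul]
  congr 2
  · apply V'.injective
    rw [hVX, LinearIsometryEquiv.apply_symm_apply, LinearIsometryEquiv.apply_symm_apply]
    rfl
  · apply W'.injective
    rw [hWY, LinearIsometryEquiv.apply_symm_apply, LinearIsometryEquiv.apply_symm_apply]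
    rfl

end IsComparison

end

end HopfBimodule

namespace HopfBimodule

set_option linter.unusedSectionVars false

/-! ### Comparison of fibre products -/

section

variable {N : Type*} [CStarAlgebra N] [FiniteDimensional ℂ N] {μ : FaithfulState N}
  {L : Type*} [NormedAddCommGroup L] [InnerProductSpace ℂ L] [CompleteSpace L]
  [FiniteDimensional ℂ L] {G : GNS μ L}
  {E : Type*} [NormedAddCommGroup E] [InnerProductSpace ℂ E] [CompleteSpace E]
  [FiniteDimensional ℂ E] {B : CStarBase E} {ζ : E} {U : E ≃ₗᵢ[ℂ] L}
  {H K H₁ K₁ : Type*}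
  [NormedAddCommGroup H] [InnerProductSpace ℂ H] [CompleteSpace H] [FiniteDimensional ℂ H]
  [NormedAddCommGroup K] [InnerProductSpace ℂ K] [CompleteSpace K] [FiniteDimensional ℂ K]
  [NormedAddCommGroup H₁] [InnerProductSpace ℂ H₁] [CompleteSpace H₁] [FiniteDimensional ℂ H₁]
  [NormedAddCommGroup K₁] [InnerProductSpace ℂ K₁] [CompleteSpace K₁] [FiniteDimensional ℂ K₁]
  {ρ : Nᵐᵒᵖ →⋆ₐ[ℂ] (H →L[ℂ] H)} {σ : N →⋆ₐ[ℂ] (K →L[ℂ] K)}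
  {α : CStarFact B H₁} {β : CStarFact B.op K₁}
  {V : H ≃ₗᵢ[ℂ] H₁} {W : K ≃ₗᵢ[ℂ] K₁}
  {Ψ : G.RelTensor ρ σ ≃ₗᵢ[ℂ] CStarFact.RelTensor α β}
  {A : StarSubalgebra ℂ (H →L[ℂ] H)} {C : StarSubalgebra ℂ (K →L[ℂ] K)}
  {A₁ : StarSubalgebra ℂ (H₁ →L[ℂ] H₁)} {C₁ : StarSubalgebra ℂ (K₁ →L[ℂ] K₁)}

theorem one_mul_comm_of_mem (A : StarSubalgebra ℂ (H →L[ℂ] H)) :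
    ∀ a ∈ A, (1 : H →L[ℂ] H) * a = a * 1 := fun a _ => by rw [one_mul, mul_one]

theorem adjoint_conjStarAlgEquiv (V : H ≃ₗᵢ[ℂ] H₁) (T : H →L[ℂ] H) :
    (V.conjStarAlgEquiv T).adjoint = V.conjStarAlgEquiv T.adjoint :=
  (map_star V.conjStarAlgEquiv T).symm

/-- Since S ⊗ R = (S ⊗ 1)(1 ⊗ R), commutation can be tested on one leg at a time; adjoints add
nothing because commutants of ⋆-algebras are ⋆-closed. The two conditions match, in this order, the
two stabilizer conditions that define the C⋆-fibre product. -/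
theorem GNS.mem_fibre_iff (hρ : ∀ x, ρ x ∈ A) (hσ : ∀ y, σ y ∈ C)
    {T : G.RelTensor ρ σ →L[ℂ] G.RelTensor ρ σ} :
    T ∈ G.fibre A C hρ hσ ↔
      (∀ (R : K →L[ℂ] K) (hR : ∀ b ∈ C, R * b = b * R),
        G.map (GNS.intertwines_one ρ) (GNS.intertwines_of_commutant hσ hR) * T =
          T * G.map (GNS.intertwines_one ρ) (GNS.intertwines_of_commutant hσ hR)) ∧
      (∀ (S : H →L[ℂ] H) (hS : ∀ a ∈ A, S * a = a * S),
        G.map (GNS.intertwines_of_commutant hρ hS) (GNS.intertwines_one' σ) * T =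
          T * G.map (GNS.intertwines_of_commutant hρ hS) (GNS.intertwines_one' σ)) := by
  rw [GNS.fibre, StarSubalgebra.mem_centralizer_iff]
  constructor
  · intro h
    exact ⟨fun R hR => (h _ ⟨1, one_mul_comm_of_mem A, R, hR, rfl⟩).1,
      fun S hS => (h _ ⟨S, hS, 1, one_mul_comm_of_mem C, rfl⟩).1⟩
  · rintro ⟨h1, h2⟩
    have key : ∀ (S : H →L[ℂ] H) (hS : ∀ a ∈ A, S * a = a * S) (R : K →L[ℂ] K)
        (hR : ∀ b ∈ C, R * b = b * R),
        G.map (GNS.intertwines_of_commutant hρ hS) (GNS.intertwines_of_commutant hσ hR) * T =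
          T * G.map (GNS.intertwines_of_commutant hρ hS) (GNS.intertwines_of_commutant hσ hR) := by
      intro S hS R hR
      have h3 : G.map (GNS.intertwines_of_commutant hρ hS) (GNS.intertwines_of_commutant hσ hR) =
          G.map (GNS.intertwines_of_commutant hρ hS) (GNS.intertwines_one' σ) *
            G.map (GNS.intertwines_one ρ) (GNS.intertwines_of_commutant hσ hR) := by
        refine G.rel_ext fun ξ η => ?_
        change _ = G.map (GNS.intertwines_of_commutant hρ hS) (GNS.intertwines_one' σ)
          (G.map (GNS.intertwines_one ρ) (GNS.intertwines_of_commutant hσ hR) (G.tmul ρ σ ξ η))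
        rw [GNS.map_tmul, GNS.map_tmul, GNS.map_tmul]
        rfl
      rw [h3, mul_assoc, h1 R hR, ← mul_assoc, h2 S hS, mul_assoc]
    rintro _ ⟨S, hS, R, hR, rfl⟩
    refine ⟨key S hS R hR, ?_⟩
    rw [ContinuousLinearMap.star_eq_adjoint, GNS.map_adjoint]
    exact key _ (CStarFact.adjoint_mul_comm hS) _ (CStarFact.adjoint_mul_comm hR)

theorem commutant_conj {V : H ≃ₗᵢ[ℂ] H₁} (hA : ∀ T, V.conjStarAlgEquiv T ∈ A₁ ↔ T ∈ A)
    {S : H₁ →L[ℂ] H₁} (hS : ∀ a ∈ A₁, S * a = a * S) :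
    ∀ a ∈ A, V.symm.conjStarAlgEquiv S * a = a * V.symm.conjStarAlgEquiv S := by
  intro a ha
  have h1 := hS _ ((hA a).2 ha)
  ext x
  have h2 := DFunLike.congr_fun h1 (V x)
  apply V.injective
  change S (V (a (V.symm (V x)))) = V (a (V.symm (S (V x)))) at h2
  change V (V.symm (S (V (a x)))) = V (a (V.symm (S (V x))))
  rw [← h2, LinearIsometryEquiv.apply_symm_apply, LinearIsometryEquiv.symm_apply_apply]

theorem commutant_conj' {V : H ≃ₗᵢ[ℂ] H₁} (hA : ∀ T, V.conjStarAlgEquiv T ∈ A₁ ↔ T ∈ A)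
    {S : H →L[ℂ] H} (hS : ∀ a ∈ A, S * a = a * S) :
    ∀ a ∈ A₁, V.conjStarAlgEquiv S * a = a * V.conjStarAlgEquiv S := by
  refine commutant_conj (V := V.symm) (fun T => ?_) hS
  rw [← hA]
  have : V.conjStarAlgEquiv (V.symm.conjStarAlgEquiv T) = T := by ext x; simp
  rw [this]

/-- The comparison unitary identifies the two fibre products. -/
theorem IsComparison.mem_fibre_iff (hΨ : IsComparison U ζ V W Ψ)
    (I : IsBaseIdentification G B ζ U) (hρ : ∀ x, ρ x ∈ A) (hσ : ∀ y, σ y ∈ C)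
    (hA : ∀ T, V.conjStarAlgEquiv T ∈ A₁ ↔ T ∈ A) (hC : ∀ T, W.conjStarAlgEquiv T ∈ C₁ ↔ T ∈ C)
    (T : G.RelTensor ρ σ →L[ℂ] G.RelTensor ρ σ) :
    Ψ.conjStarAlgEquiv T ∈ CStarFact.fibre α β A₁ C₁ ↔ T ∈ G.fibre A C hρ hσ := by
  rw [GNS.mem_fibre_iff, CStarFact.fibre, StarSubalgebra.mem_inf]
  refine and_congr ?_ ?_
  -- The amplification of R on the C⋆-side is the conjugate by Ψ of 1 ⊗ W*RW. It satisfies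
  -- amp(R)|ξ⟩₁ = |ξ⟩₁R because Ψ carries k ↦ V*ξζ ⊗ k to |ξ⟩₁W.
  · rw [CStarFact.mem_ketStabilizer_iff_commute α (CStarFact.ketOneLin α β)
      (CStarFact.span_ketOne α β) C₁
      (fun R hR => Ψ.conjStarAlgEquiv (G.map (GNS.intertwines_one ρ)
        (GNS.intertwines_of_commutant hσ (commutant_conj hC hR))))
      (fun R hR ξ => ?_) (fun R hR => ?_)]
    -- Conjugation by Ψ cancels, and R ↦ W*RW is a bijection from the commutant of `C₁` onto that of
    -- `C`.
    · simp only [← map_mul, EmbeddingLike.apply_eq_iff_eq]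
      refine ⟨fun h R hR => ?_, fun h R hR => h _ (commutant_conj hC hR)⟩
      have h1 := h _ (commutant_conj' hC hR)
      have h2 : W.symm.conjStarAlgEquiv (W.conjStarAlgEquiv R) = R := by ext x; simp
      simp only [h2] at h1
      exact h1
    · ext k
      obtain ⟨k, rfl⟩ := W.surjective k
      change Ψ (G.map _ _ (Ψ.symm (CStarFact.ketOne α β ξ (W k)))) =
        CStarFact.ketOne α β ξ (R (W k))
      rw [← hΨ.ketOne I, LinearIsometryEquiv.symm_apply_apply, GNS.map_tmul]
      change Ψ (G.tmul ρ σ (V.symm (ξ.1 ζ)) (W.symm (R (W k)))) = _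
      rw [hΨ.ketOne I, LinearIsometryEquiv.apply_symm_apply]
    · rw [adjoint_conjStarAlgEquiv, GNS.map_adjoint]
      congr 1
      refine G.rel_ext fun ξ η => ?_
      rw [GNS.map_tmul, GNS.map_tmul, adjoint_conjStarAlgEquiv, ContinuousLinearMap.adjoint_one]
  -- On the first leg the amplification of R is the conjugate by Ψ of V*RV ⊗ 1.
  · rw [CStarFact.mem_ketStabilizer_iff_commute β (CStarFact.ketTwoLin α β)
      (CStarFact.span_ketTwo α β) A₁
      (fun R hR => Ψ.conjStarAlgEquiv (G.map
        (GNS.intertwines_of_commutant hρ (commutant_conj hA hR)) (GNS.intertwines_one' σ)))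
      (fun R hR ξ => ?_) (fun R hR => ?_)]
    · simp only [← map_mul, EmbeddingLike.apply_eq_iff_eq]
      refine ⟨fun h R hR => ?_, fun h R hR => h _ (commutant_conj hA hR)⟩
      have h1 := h _ (commutant_conj' hA hR)
      have h2 : V.symm.conjStarAlgEquiv (V.conjStarAlgEquiv R) = R := by ext x; simp
      simp only [h2] at h1
      exact h1
    · ext k
      obtain ⟨k, rfl⟩ := V.surjective k
      change Ψ (G.map _ _ (Ψ.symm (CStarFact.ketTwo α β ξ (V k)))) =
        CStarFact.ketTwo α β ξ (R (V k))
      rw [← hΨ.ketTwo I, LinearIsometryEquiv.symm_apply_apply, GNS.map_tmul]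
      change Ψ (G.tmul ρ σ (V.symm (R (V k))) (W.symm (ξ.1 ζ))) = _
      rw [hΨ.ketTwo I, LinearIsometryEquiv.apply_symm_apply]
    · rw [adjoint_conjStarAlgEquiv, GNS.map_adjoint]
      congr 1
      refine G.rel_ext fun ξ η => ?_
      rw [GNS.map_tmul, GNS.map_tmul, adjoint_conjStarAlgEquiv, ContinuousLinearMap.adjoint_one]

end

end HopfBimodule

namespace HopfBimodule

set_option linter.unusedSectionVars false

/-! ### Comparison of fibre products of morphisms -/

/-! ### Transport of homomorphisms and intertwiners along unitaries -/

section Conjugation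

variable {H H₁ H' H₁' : Type*}
  [NormedAddCommGroup H] [InnerProductSpace ℂ H] [CompleteSpace H]
  [NormedAddCommGroup H₁] [InnerProductSpace ℂ H₁] [CompleteSpace H₁]
  [NormedAddCommGroup H'] [InnerProductSpace ℂ H'] [CompleteSpace H']
  [NormedAddCommGroup H₁'] [InnerProductSpace ℂ H₁'] [CompleteSpace H₁']
  {A : StarSubalgebra ℂ (H →L[ℂ] H)} {A₁ : StarSubalgebra ℂ (H₁ →L[ℂ] H₁)}
  {A' : StarSubalgebra ℂ (H' →L[ℂ] H')} {A₁' : StarSubalgebra ℂ (H₁' →L[ℂ] H₁')}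

/-- The `⋆`-homomorphism `T ↦ V T V*`. -/
noncomputable def OpHom.conj (V : H ≃ₗᵢ[ℂ] H₁) (h : ∀ T ∈ A, V.conjStarAlgEquiv T ∈ A₁) :
    OpHom A A₁ where
  toFun a := ⟨V.conjStarAlgEquiv a.1, h _ a.2⟩
  map_smul' r a := Subtype.ext (map_smul V.conjStarAlgEquiv r a.1)
  map_zero' := Subtype.ext (map_zero V.conjStarAlgEquiv)
  map_add' a b := Subtype.ext (map_add V.conjStarAlgEquiv a.1 b.1)
  map_mul' a b := Subtype.ext (map_mul V.conjStarAlgEquiv a.1 b.1)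
  map_star' a := Subtype.ext (map_star V.conjStarAlgEquiv a.1)

/-- The unitaries `V` and `V'` carry `φ` to `φ₁`. -/
def OpHom.IsConj (V : H ≃ₗᵢ[ℂ] H₁) (V' : H' ≃ₗᵢ[ℂ] H₁') (φ : OpHom A A') (φ₁ : OpHom A₁ A₁') :
    Prop :=
  ∀ (a : A) (a₁ : A₁), (∀ x, V (a.1 x) = a₁.1 (V x)) → ∀ x, V' (φ.op a x) = φ₁.op a₁ (V' x)

theorem conj_conj_symm (V : H ≃ₗᵢ[ℂ] H₁) (T : H₁ →L[ℂ] H₁) :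
    V.conjStarAlgEquiv (V.symm.conjStarAlgEquiv T) = T := by
  ext x; simp

theorem symm_conj_mem {V : H ≃ₗᵢ[ℂ] H₁} (hA : ∀ T, V.conjStarAlgEquiv T ∈ A₁ ↔ T ∈ A) :
    ∀ T ∈ A₁, V.symm.conjStarAlgEquiv T ∈ A := by
  intro T hT
  rwa [← hA, conj_conj_symm]

theorem exists_conj_right {V : H ≃ₗᵢ[ℂ] H₁} (hA : ∀ T, V.conjStarAlgEquiv T ∈ A₁ ↔ T ∈ A) (a : A) :
    ∃ a₁ : A₁, ∀ x, V (a.1 x) = a₁.1 (V x) :=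
  ⟨⟨V.conjStarAlgEquiv a.1, (hA _).2 a.2⟩, fun x => by simp⟩

theorem exists_conj_left {V : H ≃ₗᵢ[ℂ] H₁} (hA : ∀ T, V.conjStarAlgEquiv T ∈ A₁ ↔ T ∈ A) (a₁ : A₁) :
    ∃ a : A, ∀ x, V (a.1 x) = a₁.1 (V x) :=
  ⟨⟨V.symm.conjStarAlgEquiv a₁.1, symm_conj_mem hA _ a₁.2⟩, fun x => by simp⟩

/-- The transported homomorphism is T ↦ V' φ(V*TV) V'*. Applied to fibre products, this transports
the witnesses in the coassociativity condition. -/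
theorem OpHom.exists_isConj_right {V : H ≃ₗᵢ[ℂ] H₁} {V' : H' ≃ₗᵢ[ℂ] H₁'}
    (hA : ∀ T, V.conjStarAlgEquiv T ∈ A₁ ↔ T ∈ A)
    (hA' : ∀ T, V'.conjStarAlgEquiv T ∈ A₁' ↔ T ∈ A') (φ : OpHom A A') :
    ∃ φ₁ : OpHom A₁ A₁', OpHom.IsConj V V' φ φ₁ := by
  refine ⟨((OpHom.conj V' fun T => (hA' T).2).comp φ).comp (OpHom.conj V.symm (symm_conj_mem hA)),
    fun a a₁ h x => ?_⟩
  have h1 : OpHom.conj V.symm (symm_conj_mem hA) a₁ = a := by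
    refine Subtype.ext ?_
    ext y
    change V.symm (a₁.1 (V y)) = a.1 y
    rw [← h, LinearIsometryEquiv.symm_apply_apply]
  change _ = V' ((φ (OpHom.conj V.symm (symm_conj_mem hA) a₁)).1 (V'.symm (V' x)))
  rw [h1, LinearIsometryEquiv.symm_apply_apply]

theorem OpHom.exists_isConj_left {V : H ≃ₗᵢ[ℂ] H₁} {V' : H' ≃ₗᵢ[ℂ] H₁'}
    (hA : ∀ T, V.conjStarAlgEquiv T ∈ A₁ ↔ T ∈ A)
    (hA' : ∀ T, V'.conjStarAlgEquiv T ∈ A₁' ↔ T ∈ A') (φ₁ : OpHom A₁ A₁') :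
    ∃ φ : OpHom A A', OpHom.IsConj V V' φ φ₁ := by
  refine ⟨((OpHom.conj V'.symm (symm_conj_mem hA')).comp φ₁).comp
    (OpHom.conj V fun T => (hA T).2), fun a a₁ h x => ?_⟩
  have h1 : OpHom.conj V (fun T => (hA T).2) a = a₁ := by
    refine Subtype.ext ?_
    ext y
    change V (a.1 (V.symm y)) = a₁.1 y
    rw [h, LinearIsometryEquiv.apply_symm_apply]
  change V' (V'.symm ((φ₁ (OpHom.conj V (fun T => (hA T).2) a)).1 (V' x))) = _
  rw [h1, LinearIsometryEquiv.apply_symm_apply]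

/-- The elements of `A` and `A₁` correspond under conjugation by V, so X ↦ V'XV* matches the
intertwiner spaces of φ and φ₁. -/
theorem OpHom.IsConj.intertwiner_iff {V : H ≃ₗᵢ[ℂ] H₁} {V' : H' ≃ₗᵢ[ℂ] H₁'}
    (hA : ∀ T, V.conjStarAlgEquiv T ∈ A₁ ↔ T ∈ A) {φ : OpHom A A'} {φ₁ : OpHom A₁ A₁'}
    (h : OpHom.IsConj V V' φ φ₁) {X : H →L[ℂ] H'} {X₁ : H₁ →L[ℂ] H₁'}
    (hX : ∀ x, V' (X x) = X₁ (V x)) :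
    (∀ a : A, X ∘L a.1 = φ.op a ∘L X) ↔ ∀ a : A₁, X₁ ∘L a.1 = φ₁.op a ∘L X₁ := by
  constructor
  · intro hφ a₁
    obtain ⟨a, ha⟩ := exists_conj_left hA a₁
    ext y
    obtain ⟨y, rfl⟩ := V.surjective y
    change X₁ (a₁.1 (V y)) = φ₁.op a₁ (X₁ (V y))
    rw [← ha, ← hX, ← hX, ← h a a₁ ha]
    congr 1
    exact DFunLike.congr_fun (hφ a) y
  · intro hφ a
    obtain ⟨a₁, ha⟩ := exists_conj_right hA a
    ext y
    apply V'.injective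
    change V' (X (a.1 y)) = V' (φ.op a (X y))
    rw [h a a₁ ha, hX, hX, ha]
    exact DFunLike.congr_fun (hφ a₁) (V y)

theorem exists_intertwiner_left (V : H ≃ₗᵢ[ℂ] H₁) (V' : H' ≃ₗᵢ[ℂ] H₁') (X₁ : H₁ →L[ℂ] H₁') :
    ∃ X : H →L[ℂ] H', ∀ x, V' (X x) = X₁ (V x) :=
  ⟨(V'.symm : H₁' →L[ℂ] H') ∘L X₁ ∘L (V : H →L[ℂ] H₁), fun _ => V'.apply_symm_apply _⟩

theorem exists_intertwiner_right (V : H ≃ₗᵢ[ℂ] H₁) (V' : H' ≃ₗᵢ[ℂ] H₁') (X : H →L[ℂ] H') :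
    ∃ X₁ : H₁ →L[ℂ] H₁', ∀ x, V' (X x) = X₁ (V x) :=
  ⟨(V' : H' →L[ℂ] H₁') ∘L X ∘L (V.symm : H₁ →L[ℂ] H), fun x => by simp⟩

end Conjugation

/-! ### Fibre products of morphisms and one-leg representations under comparison unitaries -/

section

variable {N : Type*} [CStarAlgebra N] [FiniteDimensional ℂ N] {μ : FaithfulState N}
  {L : Type*} [NormedAddCommGroup L] [InnerProductSpace ℂ L] [CompleteSpace L]
  [FiniteDimensional ℂ L] {G : GNS μ L}
  {E : Type*} [NormedAddCommGroup E] [InnerProductSpace ℂ E] [CompleteSpace E]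
  [FiniteDimensional ℂ E] {B : CStarBase E} {ζ : E} {U : E ≃ₗᵢ[ℂ] L}
  {H K H₁ K₁ H' K' H₁' K₁' : Type*}
  [NormedAddCommGroup H] [InnerProductSpace ℂ H] [CompleteSpace H] [FiniteDimensional ℂ H]
  [NormedAddCommGroup K] [InnerProductSpace ℂ K] [CompleteSpace K] [FiniteDimensional ℂ K]
  [NormedAddCommGroup H₁] [InnerProductSpace ℂ H₁] [CompleteSpace H₁] [FiniteDimensional ℂ H₁]
  [NormedAddCommGroup K₁] [InnerProductSpace ℂ K₁] [CompleteSpace K₁] [FiniteDimensional ℂ K₁]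
  [NormedAddCommGroup H'] [InnerProductSpace ℂ H'] [CompleteSpace H'] [FiniteDimensional ℂ H']
  [NormedAddCommGroup K'] [InnerProductSpace ℂ K'] [CompleteSpace K'] [FiniteDimensional ℂ K']
  [NormedAddCommGroup H₁'] [InnerProductSpace ℂ H₁'] [CompleteSpace H₁']
  [FiniteDimensional ℂ H₁']
  [NormedAddCommGroup K₁'] [InnerProductSpace ℂ K₁'] [CompleteSpace K₁']
  [FiniteDimensional ℂ K₁']
  {ρ : Nᵐᵒᵖ →⋆ₐ[ℂ] (H →L[ℂ] H)} {σ : N →⋆ₐ[ℂ] (K →L[ℂ] K)}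
  {ρ' : Nᵐᵒᵖ →⋆ₐ[ℂ] (H' →L[ℂ] H')} {σ' : N →⋆ₐ[ℂ] (K' →L[ℂ] K')}
  {α : CStarFact B H₁} {β : CStarFact B.op K₁} {α' : CStarFact B H₁'} {β' : CStarFact B.op K₁'}
  {V : H ≃ₗᵢ[ℂ] H₁} {W : K ≃ₗᵢ[ℂ] K₁} {V' : H' ≃ₗᵢ[ℂ] H₁'} {W' : K' ≃ₗᵢ[ℂ] K₁'}
  {Ψ : G.RelTensor ρ σ ≃ₗᵢ[ℂ] CStarFact.RelTensor α β}
  {Ψ' : G.RelTensor ρ' σ' ≃ₗᵢ[ℂ] CStarFact.RelTensor α' β'}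

/-- The comparison unitaries carry fibre products of morphisms to fibre products of morphisms. -/
theorem IsComparison.isFibreMap_iff (hΨ : IsComparison U ζ V W Ψ)
    (hΨ' : IsComparison U ζ V' W' Ψ') (I : IsBaseIdentification G B ζ U)
    {A : StarSubalgebra ℂ (H →L[ℂ] H)} {C : StarSubalgebra ℂ (K →L[ℂ] K)}
    {A₁ : StarSubalgebra ℂ (H₁ →L[ℂ] H₁)} {C₁ : StarSubalgebra ℂ (K₁ →L[ℂ] K₁)}
    {A' : StarSubalgebra ℂ (H' →L[ℂ] H')} {C' : StarSubalgebra ℂ (K' →L[ℂ] K')}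
    {A₁' : StarSubalgebra ℂ (H₁' →L[ℂ] H₁')} {C₁' : StarSubalgebra ℂ (K₁' →L[ℂ] K₁')}
    {hρ : ∀ x, ρ x ∈ A} {hσ : ∀ y, σ y ∈ C} {hρ' : ∀ x, ρ' x ∈ A'} {hσ' : ∀ y, σ' y ∈ C'}
    (hA : ∀ T, V.conjStarAlgEquiv T ∈ A₁ ↔ T ∈ A) (hC : ∀ T, W.conjStarAlgEquiv T ∈ C₁ ↔ T ∈ C)
    {φ : OpHom A A'} {ψ : OpHom C C'} {φ₁ : OpHom A₁ A₁'} {ψ₁ : OpHom C₁ C₁'}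
    (hφ : OpHom.IsConj V V' φ φ₁) (hψ : OpHom.IsConj W W' ψ ψ₁)
    {Γ : OpHom (G.fibre A C hρ hσ) (G.fibre A' C' hρ' hσ')}
    {Γ₁ : OpHom (CStarFact.fibre α β A₁ C₁) (CStarFact.fibre α' β' A₁' C₁')}
    (hΓ : OpHom.IsConj Ψ Ψ' Γ Γ₁) :
    G.IsFibreMap φ ψ Γ ↔ CStarFact.IsFibreMap φ₁ ψ₁ Γ₁ := by
  have hfib := hΨ.mem_fibre_iff I hρ hσ hA hC
  constructor
  -- All ingredients pull back: X₁ and Y₁ come from X = V'*X₁V and Y = W'*Y₁W, which intertwine the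
  -- representations of N^op and N because X₁ and Y₁ preserve the factorizations. By naturality Ψ
  -- and Ψ' carry X ⊗ Y to X₁ ⊗ Y₁, so the two defining identities are conjugate.
  · intro h X₁ Y₁ hX₁ hY₁ hpX hpY S₁
    obtain ⟨X, hX⟩ := exists_intertwiner_left V V' X₁
    obtain ⟨Y, hY⟩ := exists_intertwiner_left W W' Y₁
    obtain ⟨S, hS⟩ := exists_conj_left hfib S₁
    have hiX := (hΨ.left.intertwines_iff I.dag I.bicyclic hΨ'.left hX).2 hpX
    have hiY := (hΨ.right.intertwines_iff I.alg I.bicyclic.op hΨ'.right hY).2 hpY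
    have key := h X Y ((hφ.intertwiner_iff hA hX).2 hX₁) ((hψ.intertwiner_iff hC hY).2 hY₁)
      hiX hiY S
    have hmap := hΨ.map hΨ' I hX hY hiX hiY hpX hpY
    ext w
    obtain ⟨w, rfl⟩ := Ψ.surjective w
    change Γ₁.op S₁ (CStarFact.map hpX hpY (Ψ w)) = CStarFact.map hpX hpY (S₁.1 (Ψ w))
    rw [← hS, ← hmap, ← hmap, ← hΓ S S₁ hS]
    congr 1
    exact DFunLike.congr_fun key w
  · intro h X Y hX' hY' hiX hiY S
    obtain ⟨X₁, hX⟩ := exists_intertwiner_right V V' X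
    obtain ⟨Y₁, hY⟩ := exists_intertwiner_right W W' Y
    obtain ⟨S₁, hS⟩ := exists_conj_right hfib S
    have hpX := (hΨ.left.intertwines_iff I.dag I.bicyclic hΨ'.left hX).1 hiX
    have hpY := (hΨ.right.intertwines_iff I.alg I.bicyclic.op hΨ'.right hY).1 hiY
    have key := h X₁ Y₁ ((hφ.intertwiner_iff hA hX).1 hX') ((hψ.intertwiner_iff hC hY).1 hY')
      hpX hpY S₁
    have hmap := hΨ.map hΨ' I hX hY hiX hiY hpX hpY
    ext w
    apply Ψ'.injective
    change Ψ' (Γ.op S (G.map hiX hiY w)) = Ψ' (G.map hiX hiY (S.1 w))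
    rw [hΓ S S₁ hS, hmap, hmap, hS]
    exact DFunLike.congr_fun key (Ψ w)

/-- On vectors |ξ⟩₁Wk, both 1 ⊗ τ(x) and the representation of α ▷ γ act on the second leg alone,
where τ and γ already match. As a result Ψ can take the place of V in a further comparison, which
gives access to threefold products. -/
theorem IsComparison.carries_legTwo (hΨ : IsComparison U ζ V W Ψ)
    (I : IsBaseIdentification G B ζ U) {τ : Nᵐᵒᵖ →⋆ₐ[ℂ] (K →L[ℂ] K)} {γ : CStarFact B K₁}
    (hτ : Carries G.πop U τ γ W) (h : ∀ x, GNS.Intertwines σ σ (τ x))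
    (hc : CStarFact.Compatible β γ) :
    Carries G.πop U (G.legTwo ρ τ h) (CStarFact.triRight α β γ hc) Ψ := by
  intro x b hx w
  refine DFunLike.congr_fun (f := (Ψ : G.RelTensor ρ σ →L[ℂ] _) ∘L G.legTwo ρ τ h x)
    (g := (CStarFact.triRight α β γ hc).rep b ∘L (Ψ : G.RelTensor ρ σ →L[ℂ] _))
    (G.rel_ext fun ξ k => ?_) w
  change Ψ (G.legTwo ρ τ h x (G.tmul ρ σ ξ k)) =
    (CStarFact.triRight α β γ hc).rep b (Ψ (G.tmul ρ σ ξ k))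
  -- The vector in the first leg is written as V*ξζ with ξ ∈ α, the form in which Ψ turns it into
  -- the operator |ξ⟩₁.
  obtain ⟨ξ, rfl⟩ := V.symm.surjective ξ
  obtain ⟨ξ, rfl⟩ := CStarFact.exists_apply_eq I.bicyclic α ξ
  rw [GNS.legTwo_tmul, hΨ.ketOne I, hΨ.ketOne I, CStarFact.triRight_rep, hτ x b hx]

/-- The mirror image, with action on the first leg of |η⟩₂Vh; here Ψ can take the place of W in a
further comparison. -/
theorem IsComparison.carries_legOne (hΨ : IsComparison U ζ V W Ψ)
    (I : IsBaseIdentification G B ζ U) {τ : N →⋆ₐ[ℂ] (H →L[ℂ] H)} {δ : CStarFact B.op H₁}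
    (hτ : Carries G.π U τ δ V) (h : ∀ y, GNS.Intertwines ρ ρ (τ y))
    (hc : CStarFact.Compatible α δ) :
    Carries G.π U (G.legOne σ τ h) (CStarFact.triLeft α β δ hc) Ψ := by
  intro y b hy w
  refine DFunLike.congr_fun (f := (Ψ : G.RelTensor ρ σ →L[ℂ] _) ∘L G.legOne σ τ h y)
    (g := (CStarFact.triLeft α β δ hc).rep b ∘L (Ψ : G.RelTensor ρ σ →L[ℂ] _))
    (G.rel_ext fun k η => ?_) w
  change Ψ (G.legOne σ τ h y (G.tmul ρ σ k η)) =
    (CStarFact.triLeft α β δ hc).rep b (Ψ (G.tmul ρ σ k η))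
  obtain ⟨η, rfl⟩ := W.symm.surjective η
  obtain ⟨η, rfl⟩ := CStarFact.exists_apply_eq I.bicyclic.op β η
  rw [GNS.legOne_tmul, hΨ.ketTwo I, hΨ.ketTwo I, CStarFact.triLeft_rep, hτ y b hy]

end

/-! ### Threefold products, and `Φ` as a comparison unitary -/

section

variable {N : Type*} [CStarAlgebra N] [FiniteDimensional ℂ N] {μ : FaithfulState N}
  {L : Type*} [NormedAddCommGroup L] [InnerProductSpace ℂ L] [CompleteSpace L]
  [FiniteDimensional ℂ L] {G : GNS μ L}
  {E : Type*} [NormedAddCommGroup E] [InnerProductSpace ℂ E] [CompleteSpace E]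
  [FiniteDimensional ℂ E] {B : CStarBase E} {ζ : E} {U : E ≃ₗᵢ[ℂ] L}
  {H : Type*}
  [NormedAddCommGroup H] [InnerProductSpace ℂ H] [CompleteSpace H] [FiniteDimensional ℂ H]
  {ρ : Nᵐᵒᵖ →⋆ₐ[ℂ] (H →L[ℂ] H)} {σ : N →⋆ₐ[ℂ] (H →L[ℂ] H)}
  {α : CStarFact B H} {β : CStarFact B.op H}

/-- The comparison unitaries of threefold relative tensor products are compatible with the
associativity isomorphisms. -/
theorem comparison_assoc (I : IsBaseIdentification G B ζ U) (hc : CStarFact.Compatible α β)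
    (h : ∀ x, GNS.Intertwines σ σ (ρ x)) (h' : ∀ y, GNS.Intertwines ρ ρ (σ y))
    {Φ : G.RelTensor ρ σ ≃ₗᵢ[ℂ] CStarFact.RelTensor α β}
    (hΦ : IsComparison U ζ (LinearIsometryEquiv.refl ℂ H) (LinearIsometryEquiv.refl ℂ H) Φ)
    {Ψ₁ : G.RelTensor (G.legTwo ρ ρ h) σ ≃ₗᵢ[ℂ]
      CStarFact.RelTensor (CStarFact.triRight α β α hc.symm) β}
    (hΨ₁ : IsComparison U ζ Φ (LinearIsometryEquiv.refl ℂ H) Ψ₁)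
    {Ψ₂ : G.RelTensor ρ (G.legOne σ σ h') ≃ₗᵢ[ℂ]
      CStarFact.RelTensor α (CStarFact.triLeft α β β hc)}
    (hΨ₂ : IsComparison U ζ (LinearIsometryEquiv.refl ℂ H) Φ Ψ₂)
    (w : G.RelTensor (G.legTwo ρ ρ h) σ) :
    Ψ₂ (G.assoc ρ σ ρ σ h h' w) = CStarFact.assoc α β α β hc.symm (Ψ₁ w) := by
  refine DFunLike.congr_fun
    (f := (Ψ₂ : G.RelTensor ρ (G.legOne σ σ h') →L[ℂ] _) ∘L
      (G.assoc ρ σ ρ σ h h' : G.RelTensor (G.legTwo ρ ρ h) σ →L[ℂ] _))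
    (g := (CStarFact.assoc α β α β hc.symm :
        CStarFact.RelTensor (CStarFact.triRight α β α hc.symm) β →L[ℂ]
          CStarFact.RelTensor α (CStarFact.triLeft α β β hc)) ∘L
      (Ψ₁ : G.RelTensor (G.legTwo ρ ρ h) σ →L[ℂ] _))
    (operator_ext G.span_tmul_tmul ?_) w
  rintro ⟨ξ, k, η⟩
  -- With outer vectors ξζ and ηζ, each comparison unitary turns an outer leg into an operator |ξ⟩₁
  -- or |η⟩₂. The left side becomes |ξ⟩₁|η⟩₂k and the right side the image of |η⟩₂|ξ⟩₁k, which the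
  -- associativity isomorphism identifies.
  obtain ⟨ξ, rfl⟩ := CStarFact.exists_apply_eq I.bicyclic α ξ
  obtain ⟨η, rfl⟩ := CStarFact.exists_apply_eq I.bicyclic.op β η
  change Ψ₂ (G.assoc ρ σ ρ σ h h' (G.tmul _ _ (G.tmul ρ σ (ξ.1 ζ) k) (η.1 ζ))) =
    CStarFact.assoc α β α β hc.symm (Ψ₁ (G.tmul _ _ (G.tmul ρ σ (ξ.1 ζ) k) (η.1 ζ)))
  have e1 := hΨ₁.ketTwo I (G.tmul ρ σ (ξ.1 ζ) k) η
  have e2 := hΦ.ketOne I ξ k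
  have e3 := hΨ₂.ketOne I ξ (G.tmul ρ σ k (η.1 ζ))
  have e4 := hΦ.ketTwo I k η
  have hr : ∀ x : H, (LinearIsometryEquiv.refl ℂ H).symm x = x := fun _ => rfl
  simp only [hr, LinearIsometryEquiv.coe_refl, id_eq] at e1 e2 e3 e4
  rw [GNS.assoc_tmul, e1, e2, e3, e4, CStarFact.assoc_apply]

namespace IsIdentification

theorem isBaseIdentification (hU : IsIdentification G B ζ ρ σ α β U) (hζ : B.IsBicyclic ζ) :
    IsBaseIdentification G B ζ U where
  dag :=
    { exists_left := fun b => let ⟨x, hx, _⟩ := hU.exists_dag b; ⟨x, hx⟩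
      exists_right := fun x => by
        have h : G.πop x ∈ U.conjStarAlgEquiv '' (B.dag : Set (E →L[ℂ] E)) := by
          rw [hU.map_dag]; exact ⟨x, rfl⟩
        obtain ⟨b, hb, h⟩ := h
        refine ⟨⟨b, hb⟩, fun v => ?_⟩
        rw [← h]; simp }
  alg :=
    { exists_left := fun b => let ⟨x, hx, _⟩ := hU.exists_alg b; ⟨x, hx⟩
      exists_right := fun x => by
        have h : G.π x ∈ U.conjStarAlgEquiv '' (B.alg : Set (E →L[ℂ] E)) := by
          rw [hU.map_alg]; exact ⟨x, rfl⟩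
        obtain ⟨b, hb, h⟩ := h
        refine ⟨⟨b, hb⟩, fun v => ?_⟩
        rw [← h]; simp }
  map_ζ := hU.map_ζ
  bicyclic := hζ

/-- Matching means U*π_μ^op(x)U = b, so the operator in `ρ_eq` can be replaced by any b that matches
x. -/
theorem ρ_eq_rep (hU : IsIdentification G B ζ ρ σ α β U) {x : Nᵐᵒᵖ} {b : B.dag}
    (h : Matches G.πop U x b.1) : ρ x = α.rep b := by
  have h1 : U.symm.conjStarAlgEquiv (G.πop x) = b.1 := by
    ext v
    simp [← h v]
  rw [hU.ρ_eq x (h1 ▸ b.2)]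
  congr 1
  exact Subtype.ext h1

theorem σ_eq_rep (hU : IsIdentification G B ζ ρ σ α β U) {y : N} {b : B.op.dag}
    (h : Matches G.π U y b.1) : σ y = β.rep b := by
  have h1 : U.symm.conjStarAlgEquiv (G.π y) = b.1 := by
    ext v
    simp [← h v]
  rw [hU.σ_eq y (h1 ▸ b.2)]
  congr 1
  exact Subtype.ext h1

/-- For ξ ∈ α and η ∈ β one has R(ξζ)U = ξ and R(ηζ)U = η, so the formula for `Φ` takes the form
required of a comparison with identity unitaries on the legs. -/
theorem isComparison_Φ (hU : IsIdentification G B ζ ρ σ α β U) (hζ : B.IsBicyclic ζ) :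
    IsComparison U ζ (LinearIsometryEquiv.refl ℂ H) (LinearIsometryEquiv.refl ℂ H)
      (hU.Φ hζ) where
  left _ _ h _ := by rw [hU.ρ_eq_rep h]; rfl
  right _ _ h _ := by rw [hU.σ_eq_rep h]; rfl
  tmul ξ η := by
    change hU.Φ hζ (G.tmul ρ σ (ξ.1 ζ) (η.1 ζ)) = _
    rw [hU.Φ_tmul hζ, hU.left_surjective, hU.right_surjective]

end IsIdentification

end

end HopfBimodule

/-! ### The equivalence of the two notions of bimodule -/

theorem mainTheorem2
    {N : Type*} [CStarAlgebra N] [FiniteDimensional ℂ N] (μ : HopfBimodule.FaithfulState N)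
    {L : Type*} [NormedAddCommGroup L] [InnerProductSpace ℂ L] [CompleteSpace L]
    [FiniteDimensional ℂ L] (G : HopfBimodule.GNS μ L)
    {H : Type*} [NormedAddCommGroup H] [InnerProductSpace ℂ H] [CompleteSpace H]
    [FiniteDimensional ℂ H] (A : StarSubalgebra ℂ (H →L[ℂ] H))
    (ρ : Nᵐᵒᵖ →⋆ₐ[ℂ] (H →L[ℂ] H)) (σ : N →⋆ₐ[ℂ] (H →L[ℂ] H))
    (hρ_inj : Function.Injective ρ) (hσ_inj : Function.Injective σ)
    (hρ : ∀ x, ρ x ∈ A) (hσ : ∀ y, σ y ∈ A) (hcomm : ∀ x y, ρ x * σ y = σ y * ρ x)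
    {E : Type*} [NormedAddCommGroup E] [InnerProductSpace ℂ E] [CompleteSpace E]
    [FiniteDimensional ℂ E] (B : HopfBimodule.CStarBase E) (ζ : E) (hζ : B.IsBicyclic ζ)
    (α : HopfBimodule.CStarFact B H) (β : HopfBimodule.CStarFact B.op H)
    (hα : ∀ b, α.rep b ∈ A) (hβ : ∀ b, β.rep b ∈ A)
    (hαβ : HopfBimodule.CStarFact.Compatible α β)
    (U : E ≃ₗᵢ[ℂ] L) (hU : HopfBimodule.IsIdentification G B ζ ρ σ α β U)
    (Δμ : HopfBimodule.OpHom A (G.fibre A A hρ hσ))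
    (ΔE : HopfBimodule.OpHom A (HopfBimodule.CStarFact.fibre α β A A))
    (hΔ : ∀ a : A, ΔE.op a = (hU.Φ hζ).conjStarAlgEquiv (Δμ.op a)) :
    G.IsHopfVonNeumannBimodule A ρ σ hρ hσ hcomm Δμ ↔
      HopfBimodule.CStarFact.IsConcreteHopfCStarBimodule A α β hαβ ΔE := by
  have I := hU.isBaseIdentification hζ
  have hΦ := hU.isComparison_Φ hζ
  have hcomm' := fun y x => (hcomm x y).symm
  have hid : ∀ T : H →L[ℂ] H,
      (LinearIsometryEquiv.refl ℂ H).conjStarAlgEquiv T ∈ A ↔ T ∈ A := fun _ => Iff.rfl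
  have hfib := hΦ.mem_fibre_iff I hρ hσ hid hid
  have hleg₁ := hΦ.carries_legTwo I hΦ.left hcomm hαβ.symm
  have hleg₂ := hΦ.carries_legOne I hΦ.right hcomm' hαβ
  -- The threefold comparisons are taken over `Φ` on the composite leg: the first leg for Ψ₁, the
  -- second leg for Ψ₂.
  obtain ⟨Ψ₁, hΨ₁⟩ := I.exists_comparison hleg₁ hΦ.right
  obtain ⟨Ψ₂, hΨ₂⟩ := I.exists_comparison hΦ.left hleg₂
  have hfib₁ := hΨ₁.mem_fibre_iff I (G.legTwo_mem_fibre hρ hσ hcomm hρ) hσ hfib hid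
  have hfib₂ := hΨ₂.mem_fibre_iff I hρ (G.legOne_mem_fibre hρ hσ hcomm' hσ) hid hfib
  have hassoc := HopfBimodule.comparison_assoc I hαβ hcomm hcomm' hΦ hΨ₁ hΨ₂
  -- Elements of `A` related by the identity unitary are equal, so this is the hypothesis that the
  -- two comultiplications are conjugate under `Φ`.
  have hconj : HopfBimodule.OpHom.IsConj (LinearIsometryEquiv.refl ℂ H) (hU.Φ hζ) Δμ ΔE := by
    intro a a₁ h x
    obtain rfl : a = a₁ := Subtype.ext (ContinuousLinearMap.ext h)
    rw [hΔ]
    simp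
  have hconj_id : HopfBimodule.OpHom.IsConj (LinearIsometryEquiv.refl ℂ H)
      (LinearIsometryEquiv.refl ℂ H) (HopfBimodule.OpHom.id A) (HopfBimodule.OpHom.id A) := by
    intro a a₁ h x
    obtain rfl : a = a₁ := Subtype.ext (ContinuousLinearMap.ext h)
    rfl
  have hleft : HopfBimodule.CStarFact.IsMorphism A α (HopfBimodule.CStarFact.fibre α β A A)
      (HopfBimodule.CStarFact.triRight α β α hαβ.symm) ΔE ↔
      ∀ x, Δμ.op ⟨ρ x, hρ x⟩ = G.legTwo ρ ρ hcomm x := by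
    -- What remains is that ΔE(ρ_α(b)) is the representation of α ▷ α at b. For x matching b, both
    -- sides are the conjugates under `Φ` of Δμ(ρ(x)) and 1 ⊗ ρ(x).
    rw [HopfBimodule.CStarFact.isMorphism_iff hζ hα]
    constructor
    · intro h x
      obtain ⟨b, hb⟩ := I.dag.exists_right x
      ext w
      apply (hU.Φ hζ).injective
      rw [hleg₁ x b hb, ← h b]
      exact hconj ⟨ρ x, hρ x⟩ ⟨α.rep b, hα b⟩ (DFunLike.congr_fun (hU.ρ_eq_rep hb)) w
    · intro h b
      obtain ⟨x, hx⟩ := I.dag.exists_left b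
      ext w
      obtain ⟨w, rfl⟩ := (hU.Φ hζ).surjective w
      rw [← hleg₁ x b hx, ← h x]
      exact (hconj ⟨ρ x, hρ x⟩ ⟨α.rep b, hα b⟩ (DFunLike.congr_fun (hU.ρ_eq_rep hx)) w).symm
  have hright : HopfBimodule.CStarFact.IsMorphism A β (HopfBimodule.CStarFact.fibre α β A A)
      (HopfBimodule.CStarFact.triLeft α β β hαβ) ΔE ↔
      ∀ y, Δμ.op ⟨σ y, hσ y⟩ = G.legOne σ σ hcomm' y := by
    -- The argument on the other leg uses the opposite base, for which ζ is again bicyclic.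
    rw [HopfBimodule.CStarFact.isMorphism_iff hζ.op hβ]
    constructor
    · intro h x
      obtain ⟨b, hb⟩ := I.alg.exists_right x
      ext w
      apply (hU.Φ hζ).injective
      rw [hleg₂ x b hb, ← h b]
      exact hconj ⟨σ x, hσ x⟩ ⟨β.rep b, hβ b⟩ (DFunLike.congr_fun (hU.σ_eq_rep hb)) w
    · intro h b
      obtain ⟨x, hx⟩ := I.alg.exists_left b
      ext w
      obtain ⟨w, rfl⟩ := (hU.Φ hζ).surjective w
      rw [← hleg₂ x b hx, ← h x]
      exact (hconj ⟨σ x, hσ x⟩ ⟨β.rep b, hβ b⟩ (DFunLike.congr_fun (hU.σ_eq_rep hx)) w).symm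
  have hΔΔ : ∀ (a : A) w, hU.Φ hζ ((Δμ a).1 w) = (ΔE a).1 (hU.Φ hζ w) :=
    fun a w => hconj a a (fun _ => rfl) w
  constructor
  · rintro ⟨h₁, h₂, Γ₁, Γ₂, hΓ₁, hΓ₂, hco⟩
    obtain ⟨Θ₁, hΘ₁⟩ := HopfBimodule.OpHom.exists_isConj_right hfib hfib₁ Γ₁
    obtain ⟨Θ₂, hΘ₂⟩ := HopfBimodule.OpHom.exists_isConj_right hfib hfib₂ Γ₂
    refine ⟨hleft.2 h₁, hright.2 h₂, Θ₁, Θ₂,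
      (hΦ.isFibreMap_iff hΨ₁ I hid hid hconj hconj_id hΘ₁).1 hΓ₁,
      (hΦ.isFibreMap_iff hΨ₂ I hid hid hconj_id hconj hΘ₂).1 hΓ₂, fun a w => ?_⟩
    obtain ⟨w, rfl⟩ := Ψ₁.surjective w
    -- Both sides are images under Ψ₂ of vectors over μ: Θ₁ and Θ₂ are conjugates of Γ₁ and Γ₂, and
    -- the associativity isomorphisms correspond. Coassociativity over μ then identifies these
    -- vectors.
    rw [← hΘ₁ _ _ (hΔΔ a), ← hassoc, ← hassoc, hco, hΘ₂ _ _ (hΔΔ a)]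
  · rintro ⟨h₁, h₂, Θ₁, Θ₂, hΘ₁, hΘ₂, hco⟩
    obtain ⟨Γ₁, hΓ₁⟩ := HopfBimodule.OpHom.exists_isConj_left hfib hfib₁ Θ₁
    obtain ⟨Γ₂, hΓ₂⟩ := HopfBimodule.OpHom.exists_isConj_left hfib hfib₂ Θ₂
    refine ⟨hleft.1 h₁, hright.1 h₂, Γ₁, Γ₂,
      (hΦ.isFibreMap_iff hΨ₁ I hid hid hconj hconj_id hΓ₁).2 hΘ₁,
      (hΦ.isFibreMap_iff hΨ₂ I hid hid hconj_id hconj hΓ₂).2 hΘ₂, fun a w => ?_⟩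
    -- Equality over μ is tested after Ψ₂, where the same relations reduce it to coassociativity on
    -- the C⋆-side.
    apply Ψ₂.injective
    rw [hassoc, hΓ₁ _ _ (hΔΔ a), hco, hΓ₂ _ _ (hΔΔ a), hassoc]
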